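/- A positive Borel measure $\mu$ on $\mathbb R^n$ is called a Nevanlinna measure if $$\int_{\mathbb R^n}\prod_{\ell=1}^n\frac{1}{1+t_\ell^2}\,\mathrm d\mu(t)<\infty$$ and, for all $z\in\mathbb C^n$ with $\operatorname{Im} z_\ell>0$ for every $\ell$ and all indices $1\le j_1<j_2\le n$, $$\int_{\mathbb R^n}\frac{1}{(t_{j_1}-z_{j_1})^2(t_{j_2}-\overline{z_{j_2}})^2}\prod_{\ell\ne j_1,j_2}\left(\frac1{t_\ell-z_\ell}-\frac1{t_\ell-\overline{z_\ell}}\right)\mathrm d\mu(t)=0 .$$ It is supported by a closed set $M$ if $\mu(\mathbb R^n\setminus M)=0$, and non-trivial if $\mu\neq0$. **Theorem.** Let $0\le m<n$ and let $M\subset\mathbb R^n$ be an $m$-dimensional affine plane that is not parallel to a coordinate hyperplane, i.e. is not contained in any set $\{x\in\mathbb R^n : x_j=d\}$ with $1\le j\le n$ and $d\in\mathbb R$. Then $M$ supports a non-trivial Nevanlinna measure if and only if $m=n-1$ and there are $a=(a_1,\dots,a_n)\in\mathbb R^n$, with $a_k\ge0$ for all $k$ and at least two of the $a_k$ non-zero,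 and $c\in\mathbb R$ such that $$M=\{x\in\mathbb R^n : a\cdot x=c\}.$$ In this case, for any such $a$ and $c$, the Nevanlinna measures supported by $M$ are exactly the measures $$\mu=p(x_1,\dots,x_n)\,\mathcal H^{m}|_M ,$$ where $\mathcal H^{m}$ is the $m$-dimensional Hausdorff measure and $p$ is a real polynomial of degree at most $2$ with $p|_M\ge0$ that depends only on the variables $x_j$ for which $a_j>0$. -/

import Mathlib

open MeasureTheory

/-- A positive Borel measure `μ` on `ℝⁿ` is a Nevanlinna measure if it satisfies the growth condition
`∫ ∏ 1 / (1 + t_l ^ 2) dμ(t) < ∞` and the Nevanlinna condition: for all `z` in the poly-upper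
half-plane and all pairs of indices `j₁ < j₂`, the integral of
`(t_{j₁} - z_{j₁})⁻² (t_{j₂} - conj z_{j₂})⁻² ∏_{l ≠ j₁, j₂} ((t_l - z_l)⁻¹ - (t_l - conj z_l)⁻¹)`
against `μ` vanishes. (Under the growth condition this integrand is `μ`-integrable.) -/
structure IsNevanlinnaMeasure {n : ℕ} (μ : Measure (EuclideanSpace ℝ (Fin n))) : Prop where
  growth : ∫⁻ t, ENNReal.ofReal (∏ l, 1 / (1 + t l ^ 2)) ∂μ < ⊤
  nevanlinna : ∀ z : Fin n → ℂ, (∀ l, 0 < (z l).im) → ∀ j₁ j₂ : Fin n, j₁ < j₂ →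
    ∫ t, 1 / (((t j₁ : ℂ) - z j₁) ^ 2 * ((t j₂ : ℂ) - starRingEnd ℂ (z j₂)) ^ 2) *
      ∏ l ∈ ({j₁, j₂} : Finset (Fin n))ᶜ,
        (1 / ((t l : ℂ) - z l) - 1 / ((t l : ℂ) - starRingEnd ℂ (z l))) ∂μ = 0

/-- `μ` is a Nevanlinna measure supported by (carried by) the affine plane `M`. As `M` is closed,
`μ Mᶜ = 0` says exactly that the topological support of `μ` lies in `M`. -/
def IsNevanlinnaMeasureOn {n : ℕ} (M : AffineSubspace ℝ (EuclideanSpace ℝ (Fin n)))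
    (μ : Measure (EuclideanSpace ℝ (Fin n))) : Prop :=
  IsNevanlinnaMeasure μ ∧ μ (M : Set (EuclideanSpace ℝ (Fin n)))ᶜ = 0

/-- `M` is parallel to a coordinate hyperplane: it is contained in a translate `{x | x_j = d}` of
one of the coordinate hyperplanes. -/
def ParallelToCoordinateHyperplane {n : ℕ}
    (M : AffineSubspace ℝ (EuclideanSpace ℝ (Fin n))) : Prop :=
  ∃ (j : Fin n) (d : ℝ), ∀ x ∈ M, x j = d

/-- `M = {x | a · x = c}` where all `a_k ≥ 0` and at least two of the `a_k` are positive. -/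
def IsNonnegHyperplane {n : ℕ} (M : AffineSubspace ℝ (EuclideanSpace ℝ (Fin n)))
    (a : Fin n → ℝ) (c : ℝ) : Prop :=
  (∀ k, 0 ≤ a k) ∧ (∃ j k, j ≠ k ∧ 0 < a j ∧ 0 < a k) ∧
    (M : Set (EuclideanSpace ℝ (Fin n))) = {x | ∑ k, a k * x k = c}

/-!
Integrating the Nevanlinna condition over the real parts of all parameters but two, against a
compactly supported function of them, and letting the imaginary parts of these parameters tend to
`0` freezes the corresponding variables: a Nevanlinna measure `μ` annihilates every function
`θ(t') (t_i - X - I y)⁻² (t_j - Y + I y')⁻²`, where `t'` stands for the variables other than `t_i`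
and `t_j`, and `X`, `Y` may depend on `t'`
(`IsNevanlinnaMeasure.integrable_and_integral_eq_zero`).

Let `μ` be carried by a hyperplane `w · t = c`, on which `t_j` is a function of `t_i` and `t'` if
`w_j ≠ 0`. If `w_i > 0 > w_j`, then `X` and `Y` can be chosen such that the two factors are
complex conjugates up to a positive constant, so `μ = 0` by positivity
(`IsNevanlinnaMeasure.eq_zero_of_mixed_sign`). If a plane supports a nontrivial Nevanlinna
measure, then no vector orthogonal to it has coordinates of both signs. Hence these vectors form a
line (`exists_smul_eq_of_no_mixed_sign`), and the plane is a hyperplane `a · t = c` with `a ≥ 0`.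

If `w = a ≥ 0` and `a_j > 0`, then the product of the two factors can be made proportional to
`(t_i - ξ - I y)⁻⁴` for `a_i > 0`, and to `(t_i - ξ - I y)⁻²` for `a_i = 0`. These are third and
first derivatives of `(t_i - ξ - I y)⁻¹`, whose imaginary part is the Poisson kernel, so as
`y → 0` the distributional derivative of `μ` of order `3` or `1` in the direction
`e_i / a_i - e_j / a_j` or `e_i`, respectively, vanishes (`integral_iterate_dirDeriv_eq_zero`). The mollifications of
`μ` are therefore nonnegative functions that are quadratic along each `e_i / a_i - e_j / a_j`. A
nonnegative function with this property is a polynomial of degree at most `2` on the hyperplane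
(`exists_quadratic_of_nonneg`): its second differences along one side of a triangle are
nonnegative, and affine along the other sides, so they are constant. Choosing a mollifier that
reproduces quadratic polynomials, one finds that `μ` itself has a polynomial density
(`IsNevanlinnaMeasure.exists_density`).

Conversely, for such a density the integrand of the Nevanlinna condition integrates to zero along
the lines of direction `e_i - (a_i / a_j) e_j`, as a quadratic polynomial times
`(s - z)⁻² (s - w)⁻²` with both poles in the same half-plane, or of direction `e_i` if `a_i = 0`
(`integral_eval_mul_nevanlinnaKernel_eq_zero`). The growth condition holds since, on the
hyperplane, any one of the factors `1 / (1 + t_l ^ 2)` with `a_l > 0` can be spared.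
-/

open scoped ContDiff Topology
open Filter

/-! ### Directional derivatives and mollifications -/

/-- The derivative of `f` in the direction `w`. -/
noncomputable def dirDeriv {E : Type*} [NormedAddCommGroup E] [NormedSpace ℝ E] (w : E) (f : E → ℝ) :
    E → ℝ := fun x => fderiv ℝ f x w

section DirDeriv

variable {E : Type*} [NormedAddCommGroup E] [NormedSpace ℝ E]

lemma ContDiff.dirDeriv {f : E → ℝ} (hf : ContDiff ℝ ∞ f) (w : E) :
    ContDiff ℝ ∞ (dirDeriv w f) := by
  unfold _root_.dirDeriv
  exact (hf.fderiv_right (m := ∞) (by simp)).clm_apply contDiff_const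

lemma HasCompactSupport.dirDeriv {f : E → ℝ} (hf : HasCompactSupport f) (w : E) :
    HasCompactSupport (dirDeriv w f) := by
  have := hf.fderiv ℝ (f := f)
  exact this.comp_left (g := fun A : E →L[ℝ] ℝ => A w) (by simp)

lemma contDiff_iterate_dirDeriv {f : E → ℝ} (hf : ContDiff ℝ ∞ f) (w : E) (k : ℕ) :
    ContDiff ℝ ∞ ((dirDeriv w)^[k] f) := by
  induction k with
  | zero => exact hf
  | succ k ih => rw [Function.iterate_succ_apply']; exact ih.dirDeriv w

lemma hasCompactSupport_iterate_dirDeriv {f : E → ℝ} (hf : HasCompactSupport f) (w : E) (k : ℕ) :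
    HasCompactSupport ((dirDeriv w)^[k] f) := by
  induction k with
  | zero => exact hf
  | succ k ih => rw [Function.iterate_succ_apply']; exact ih.dirDeriv w

lemma hasDerivAt_sub_smul {f : E → ℝ} (hf : ContDiff ℝ ∞ f) (b w : E) (s : ℝ) :
    HasDerivAt (fun s : ℝ => f (b - s • w)) (-dirDeriv w f (b - s • w)) s := by
  have h1 : HasDerivAt (fun s : ℝ => b - s • w) (-w) s := by
    simpa using ((hasDerivAt_id s).smul_const w).const_sub b
  have h2 := (hf.differentiable (by simp) (b - s • w)).hasFDerivAt
  have h3 := h2.comp_hasDerivAt s h1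
  rw [map_neg] at h3
  exact h3

lemma dirDeriv_comp_add {f : E → ℝ} (w b x : E) :
    dirDeriv w (fun y => f (y + b)) x = dirDeriv w f (x + b) := by
  simp [dirDeriv, fderiv_comp_add_right]

lemma iterate_dirDeriv_comp_add (f : E → ℝ) (w b : E) (k : ℕ) :
    (dirDeriv w)^[k] (fun y => f (y + b)) = fun x => (dirDeriv w)^[k] f (x + b) := by
  induction k with
  | zero => rfl
  | succ k ih =>
    rw [Function.iterate_succ_apply', Function.iterate_succ_apply', ih]
    funext x
    exact dirDeriv_comp_add w b x

end DirDeriv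

section Translates

variable {E : Type*} [NormedAddCommGroup E] [MeasurableSpace E] [BorelSpace E]
  {μ : Measure E} [IsFiniteMeasureOnCompacts μ]

lemma integrable_comp_sub {f : E → ℝ} (hf : Continuous f) (hc : HasCompactSupport f) (b : E) :
    Integrable (fun t => f (t - b)) μ :=
  (hf.comp (continuous_id.sub continuous_const)).integrable_of_hasCompactSupport
    (hc.comp_homeomorph (Homeomorph.subRight b))

variable [NormedSpace ℝ E]

lemma hasDerivAt_integral_translate {f : E → ℝ} (hf : ContDiff ℝ ∞ f) (hc : HasCompactSupport f)
    (b w : E) (s : ℝ) :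
    HasDerivAt (fun s : ℝ => ∫ t, f (t - (b + s • w)) ∂μ)
      (-∫ t, dirDeriv w f (t - (b + s • w)) ∂μ) s := by
  obtain ⟨C, hC⟩ := (hc.dirDeriv w).exists_bound_of_continuous (hf.dirDeriv w).continuous
  -- every translate by a parameter at distance at most `1` is supported in the compact set `K`
  let K : Set E := (fun p : E × ℝ => p.1 + (b + p.2 • w)) '' (tsupport f ×ˢ Metric.closedBall s 1)
  have hK : IsCompact K := (hc.isCompact.prod (isCompact_closedBall s 1)).image (by fun_prop)
  have hsub : tsupport (dirDeriv w f) ⊆ tsupport f :=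
    closure_minimal (fun x hx => by
      by_contra h
      apply hx
      have : fderiv ℝ f x = 0 := by
        by_contra h'
        exact h (support_fderiv_subset ℝ h')
      simp [dirDeriv, this]) (isClosed_tsupport f)
  have key := hasDerivAt_integral_of_dominated_loc_of_deriv_le (μ := μ) (𝕜 := ℝ)
    (F := fun s t => f (t - (b + s • w))) (F' := fun s t => -dirDeriv w f (t - (b + s • w)))
    (x₀ := s) (s := Metric.closedBall s 1) (bound := K.indicator fun _ => C)
    (Metric.closedBall_mem_nhds s one_pos)
    (Eventually.of_forall fun x => (integrable_comp_sub hf.continuous hc _).aestronglyMeasurable)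
    (integrable_comp_sub hf.continuous hc _)
    ((integrable_comp_sub (hf.dirDeriv w).continuous (hc.dirDeriv w) _).neg.aestronglyMeasurable)
    (Eventually.of_forall fun t x hx => ?_)
    ((integrable_indicator_iff hK.measurableSet).2
      (integrableOn_const (hK.measure_lt_top.ne)))
    (Eventually.of_forall fun t x hx => ?_)
  · simpa [integral_neg] using key.2
  · by_cases ht : t ∈ K
    · rw [Set.indicator_of_mem ht, norm_neg]; exact hC _
    · rw [Set.indicator_of_notMem ht, norm_neg]
      have : dirDeriv w f (t - (b + x • w)) = 0 := by
        by_contra h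
        exact ht ⟨(t - (b + x • w), x), ⟨hsub (subset_tsupport _ h), hx⟩, by simp⟩
      simp [this]
  · have := hasDerivAt_sub_smul hf (t - b) w x
    simpa [sub_sub] using this

/-- If the derivative in the direction `w` of every translate of `f` has integral zero, then
`v ↦ ∫ f (t - v) dμ(t)` is constant along lines of direction `w`. -/
lemma integral_translate_const {f : E → ℝ} (hf : ContDiff ℝ ∞ f) (hc : HasCompactSupport f) (w : E)
    (h0 : ∀ b, ∫ t, dirDeriv w f (t - b) ∂μ = 0) (b : E) (s : ℝ) :
    ∫ t, f (t - (b + s • w)) ∂μ = ∫ t, f (t - b) ∂μ := by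
  have hd : ∀ s, HasDerivAt (fun s : ℝ => ∫ t, f (t - (b + s • w)) ∂μ) 0 s := fun s => by
    simpa [h0] using hasDerivAt_integral_translate hf hc b w s (μ := μ)
  have := is_const_of_deriv_eq_zero (fun s => (hd s).differentiableAt) (fun s => (hd s).deriv) s 0
  simpa using this

/-- If the third derivative in the direction `w` of every translate of `f` has integral zero, then
`v ↦ ∫ f (t - v) dμ(t)` is a quadratic polynomial along lines of direction `w`. -/
lemma integral_translate_quadratic {f : E → ℝ} (hf : ContDiff ℝ ∞ f) (hc : HasCompactSupport f)
    (w : E) (h0 : ∀ b, ∫ t, (dirDeriv w)^[3] f (t - b) ∂μ = 0) (x : E) :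
    ∃ a b c : ℝ, ∀ s : ℝ, ∫ t, f (t - (x + s • w)) ∂μ = a + b * s + c * s ^ 2 := by
  set f1 := dirDeriv w f
  set f2 := dirDeriv w f1
  have hf1 : ContDiff ℝ ∞ f1 := hf.dirDeriv w
  have hc1 : HasCompactSupport f1 := hc.dirDeriv w
  have hf2 : ContDiff ℝ ∞ f2 := hf1.dirDeriv w
  have hc2 : HasCompactSupport f2 := hc1.dirDeriv w
  have e2 : ∀ s : ℝ, ∫ t, f2 (t - (x + s • w)) ∂μ = ∫ t, f2 (t - x) ∂μ :=
    integral_translate_const hf2 hc2 w h0 x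
  set c2 := ∫ t, f2 (t - x) ∂μ
  set c1 := ∫ t, f1 (t - x) ∂μ
  have e1 : ∀ s : ℝ, ∫ t, f1 (t - (x + s • w)) ∂μ = c1 - c2 * s := by
    intro s
    have hd : ∀ s, HasDerivAt (fun s : ℝ => ∫ t, f1 (t - (x + s • w)) ∂μ + c2 * s) 0 s :=
      fun s => by
        have := (hasDerivAt_integral_translate hf1 hc1 x w s (μ := μ)).add
          ((hasDerivAt_id s).const_mul c2)
        have e : ∫ t, dirDeriv w f1 (t - (x + s • w)) ∂μ = c2 := e2 s
        rw [e, mul_one, neg_add_cancel] at this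
        exact this
    have := is_const_of_deriv_eq_zero (fun s => (hd s).differentiableAt)
      (fun s => (hd s).deriv) s 0
    simp only [mul_zero, add_zero, zero_smul] at this
    have e : ∫ t, f1 (t - x) ∂μ = c1 := rfl
    linarith
  refine ⟨∫ t, f (t - x) ∂μ, -c1, c2 / 2, fun s => ?_⟩
  have hd : ∀ s, HasDerivAt (fun s : ℝ => ∫ t, f (t - (x + s • w)) ∂μ + (c1 * s - c2 / 2 * s ^ 2))
      0 s := fun s => by
    have := (hasDerivAt_integral_translate hf hc x w s (μ := μ)).add
      (((hasDerivAt_id s).const_mul c1).sub (((hasDerivAt_id s).pow 2).const_mul (c2 / 2)))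
    have e : ∫ t, dirDeriv w f (t - (x + s • w)) ∂μ = c1 - c2 * s := e1 s
    rw [e] at this
    refine HasDerivAt.congr_deriv this ?_
    push_cast
    simp only [id]
    ring
  have := is_const_of_deriv_eq_zero (fun s => (hd s).differentiableAt) (fun s => (hd s).deriv) s 0
  simp only [mul_zero, add_zero, zero_smul, ne_eq, OfNat.ofNat_ne_zero, not_false_eq_true,
    zero_pow, sub_self] at this
  linarith

end Translates

/-- Two measures that are finite on compact sets and give the same integral to every nonnegative
smooth function with compact support are equal. -/
lemma MeasureTheory.Measure.ext_of_integral_contDiff {E : Type*} [NormedAddCommGroup E]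
    [NormedSpace ℝ E] [FiniteDimensional ℝ E] [MeasurableSpace E] [BorelSpace E] (μ ν : Measure E)
    [IsFiniteMeasureOnCompacts μ] [IsFiniteMeasureOnCompacts ν]
    (h : ∀ f : E → ℝ, ContDiff ℝ ∞ f → HasCompactSupport f → (∀ x, 0 ≤ f x) →
      ∫ x, f x ∂μ = ∫ x, f x ∂ν) : μ = ν := by
  have key : ∀ U : Set E, IsOpen U → Bornology.IsBounded U → μ U = ν U := by
    intro U hU hb
    obtain ⟨f, hs, hf, hr⟩ := hU.exists_contDiff_support_eq (n := ⊤)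
    have hKc : IsCompact (closure U) := hb.isCompact_closure
    -- the functions `smoothTransition (k * f)` increase to the indicator function of `U`
    let g : ℕ → E → ℝ := fun k x => Real.smoothTransition (k * f x)
    have hg : ∀ k, ContDiff ℝ ∞ (g k) := fun k =>
      Real.smoothTransition.contDiff.comp (contDiff_const.mul hf)
    have hg0 : ∀ k x, x ∉ U → g k x = 0 := by
      intro k x hx
      have : f x = 0 := by rw [← hs] at hx; simpa using hx
      simp [g, this]
    have hgc : ∀ k, HasCompactSupport (g k) := fun k =>
      HasCompactSupport.intro hKc fun x hx => hg0 k x fun h => hx (subset_closure h)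
    have hlim : ∀ x, Tendsto (fun k => g k x) atTop (𝓝 (U.indicator (fun _ => (1 : ℝ)) x)) := by
      intro x
      by_cases hx : x ∈ U
      · have hpos : 0 < f x := lt_of_le_of_ne (hr ⟨x, rfl⟩).1 (by
          rw [← hs] at hx; exact fun h => hx h.symm)
        rw [Set.indicator_of_mem hx]
        refine tendsto_const_nhds.congr' ?_
        filter_upwards [eventually_ge_atTop ⌈(f x)⁻¹⌉₊] with k hk
        have : (f x)⁻¹ ≤ k := (Nat.le_ceil _).trans (by exact_mod_cast hk)
        refine (Real.smoothTransition.one_of_one_le ?_).symm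
        calc 1 = (f x)⁻¹ * f x := (inv_mul_cancel₀ hpos.ne').symm
          _ ≤ k * f x := by gcongr
      · simp only [Set.indicator_of_notMem hx, hg0 _ x hx]
        exact tendsto_const_nhds
    have hfin : ∀ (κ : Measure E) [IsFiniteMeasureOnCompacts κ],
        Tendsto (fun k => ∫ x, g k x ∂κ) atTop (𝓝 (κ.real U)) := by
      intro κ _
      have hUfin : κ U < ⊤ := (measure_mono subset_closure).trans_lt hKc.measure_lt_top
      have := tendsto_integral_of_dominated_convergence (μ := κ) (F := g)
        (f := U.indicator fun _ => (1 : ℝ)) (U.indicator fun _ => (1 : ℝ))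
        (fun k => (hg k).continuous.aestronglyMeasurable)
        ((integrable_indicator_iff hU.measurableSet).2 (integrableOn_const hUfin.ne))
        (fun k => Eventually.of_forall fun x => by
          by_cases hx : x ∈ U
          · rw [Set.indicator_of_mem hx, Real.norm_of_nonneg (Real.smoothTransition.nonneg _)]
            exact Real.smoothTransition.le_one _
          · simp [hg0 _ x hx, Set.indicator_of_notMem hx])
        (Eventually.of_forall hlim)
      simpa [integral_indicator hU.measurableSet] using this
    have e : μ.real U = ν.real U := by
      refine tendsto_nhds_unique (hfin μ) ?_
      have : ∀ k, ∫ x, g k x ∂μ = ∫ x, g k x ∂ν := fun k =>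
        h _ (hg k) (hgc k) fun x => Real.smoothTransition.nonneg _
      simpa [this] using hfin ν
    have h1 : μ U ≠ ⊤ := ((measure_mono subset_closure).trans_lt hKc.measure_lt_top).ne
    have h2 : ν U ≠ ⊤ := ((measure_mono subset_closure).trans_lt hKc.measure_lt_top).ne
    exact (ENNReal.toReal_eq_toReal_iff' h1 h2).1 e
  refine Measure.ext_of_generateFrom_of_iUnion {U : Set E | IsOpen U ∧ Bornology.IsBounded U}
    (fun k : ℕ => Metric.ball (0 : E) k) ?_ ?_ ?_ ?_ ?_ ?_
  · rw [BorelSpace.measurable_eq (α := E)]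
    apply le_antisymm
    · refine MeasurableSpace.generateFrom_le fun U (hU : IsOpen U) => ?_
      have : U = ⋃ k : ℕ, U ∩ Metric.ball (0 : E) k := by
        rw [← Set.inter_iUnion, Metric.iUnion_ball_nat, Set.inter_univ]
      rw [this]
      exact MeasurableSet.iUnion fun k => MeasurableSpace.measurableSet_generateFrom
        ⟨hU.inter Metric.isOpen_ball, Metric.isBounded_ball.subset Set.inter_subset_right⟩
    · refine MeasurableSpace.generateFrom_le fun U hU => ?_
      exact MeasurableSpace.measurableSet_generateFrom hU.1
  · exact fun U hU W hW _ => ⟨hU.1.inter hW.1, hU.2.subset Set.inter_subset_left⟩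
  · exact Metric.iUnion_ball_nat 0
  · exact fun k => ⟨Metric.isOpen_ball, Metric.isBounded_ball⟩
  · exact fun k => measure_ball_lt_top.ne
  · exact fun U hU => key U hU.1 hU.2

/-! ### Nonnegative functions that are quadratic along several directions -/

section QuadraticAlong

variable {E : Type*} [AddCommGroup E]

/-- The symmetric second difference of `F` with step `u`. -/
def secondDiff (u : E) (F : E → ℝ) : E → ℝ := fun x => F (x + u) + F (x - u) - 2 * F x

/-- The symmetric first difference of `F` with step `u`. -/
noncomputable def centralDiff (u : E) (F : E → ℝ) : E → ℝ := fun x => (F (x + u) - F (x - u)) / 2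

lemma secondDiff_neg (u : E) (F : E → ℝ) : secondDiff (-u) F = secondDiff u F := by
  funext x
  simp only [secondDiff, sub_neg_eq_add, ← sub_eq_add_neg]
  ring

variable [Module ℝ E]

/-- `F` restricted to any line of direction `u` is a polynomial of degree at most `2`. -/
def QuadraticAlong (F : E → ℝ) (u : E) : Prop :=
  ∀ x, ∃ a b c : ℝ, ∀ s : ℝ, F (x + s • u) = a + b * s + c * s ^ 2

variable {F : E → ℝ} {u v : E}

lemma QuadraticAlong.eq (h : QuadraticAlong F u) (x : E) (s : ℝ) :
    F (x + s • u) = F x + centralDiff u F x * s + secondDiff u F x / 2 * s ^ 2 := by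
  obtain ⟨a, b, c, h⟩ := h x
  have h0 := h 0
  have h1 := h 1
  have h2 := h (-1)
  simp only [zero_smul, one_smul, neg_smul, add_zero, ← sub_eq_add_neg] at h0 h1 h2
  rw [h s, centralDiff, secondDiff, h0, h1, h2]
  ring

lemma QuadraticAlong.secondDiff_nonneg (h : QuadraticAlong F u) (hF : ∀ x, 0 ≤ F x) (x : E) :
    0 ≤ secondDiff u F x := by
  by_contra! hneg
  have e := h.eq x
  set A := secondDiff u F x
  set B := centralDiff u F x
  -- a quadratic polynomial with negative leading coefficient takes a negative value at `± s`
  have e1 := e (2 * (|F x| + 1) / -A + 1)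
  have e2 := e (-(2 * (|F x| + 1) / -A + 1))
  set s := 2 * (|F x| + 1) / -A + 1
  have h1 := hF (x + s • u)
  have h2 := hF (x + (-s) • u)
  have hs : 1 ≤ s := by
    have : 0 ≤ 2 * (|F x| + 1) / -A := div_nonneg (by positivity) (by linarith)
    simp only [s]; linarith
  have hAs : A * s = -(2 * (|F x| + 1)) + A := by
    have : A ≠ 0 := hneg.ne
    simp only [s]; field_simp
  have : A * s ^ 2 ≤ A * s := by
    nlinarith [mul_nonneg (mul_nonneg (neg_nonneg.2 hneg.le) (zero_le_one.trans hs))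
      (sub_nonneg.2 hs)]
  have := le_abs_self (F x)
  nlinarith

lemma QuadraticAlong.secondDiff (h : QuadraticAlong F u) (v : E) :
    QuadraticAlong (secondDiff v F) u := by
  intro x
  obtain ⟨a, b, c, h1⟩ := h (x + v)
  obtain ⟨a', b', c', h2⟩ := h (x - v)
  obtain ⟨a'', b'', c'', h3⟩ := h x
  refine ⟨a + a' - 2 * a'', b + b' - 2 * b'', c + c' - 2 * c'', fun s => ?_⟩
  have e1 : x + s • u + v = x + v + s • u := by abel
  have e2 : x + s • u - v = x - v + s • u := by abel
  rw [_root_.secondDiff, e1, e2, h1, h2, h3]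
  ring

lemma QuadraticAlong.smul (h : QuadraticAlong F u) (r : ℝ) : QuadraticAlong F (r • u) := by
  intro x
  obtain ⟨a, b, c, h1⟩ := h x
  refine ⟨a, b * r, c * r ^ 2, fun s => ?_⟩
  rw [smul_smul, h1]
  ring

lemma QuadraticAlong.secondDiff_smul (h : QuadraticAlong F u) (r : ℝ) (x : E) :
    _root_.secondDiff (r • u) F x = r ^ 2 * _root_.secondDiff u F x := by
  have h1 := h.eq x r
  have h2 := h.eq x (-r)
  rw [neg_smul, ← sub_eq_add_neg] at h2
  rw [_root_.secondDiff, h1, h2]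
  ring

/-- A function of two real variables that is quadratic in each of them has a mixed fourth order term
`s² t²`, and no other fourth order term; this term vanishes if the function is quadratic on the
diagonal. -/
lemma mixed_secondDiff_eq_zero (φ : ℝ → ℝ → ℝ)
    (h1 : ∀ t, ∃ a b c : ℝ, ∀ s, φ s t = a + b * s + c * s ^ 2)
    (h2 : ∀ s, ∃ a b c : ℝ, ∀ t, φ s t = a + b * t + c * t ^ 2)
    (h3 : ∃ a b c : ℝ, ∀ s, φ s s = a + b * s + c * s ^ 2) :
    φ 1 1 + φ (-1) 1 - 2 * φ 0 1 + (φ 1 (-1) + φ (-1) (-1) - 2 * φ 0 (-1))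
      - 2 * (φ 1 0 + φ (-1) 0 - 2 * φ 0 0) = 0 := by
  have e1 : ∀ s t, φ s t = φ 0 t + (φ 1 t - φ (-1) t) / 2 * s
      + (φ 1 t + φ (-1) t - 2 * φ 0 t) / 2 * s ^ 2 := by
    intro s t
    obtain ⟨a, b, c, h⟩ := h1 t
    rw [h s, h 0, h 1, h (-1)]
    ring
  have e2 : ∀ s t, φ s t = φ s 0 + (φ s 1 - φ s (-1)) / 2 * t
      + (φ s 1 + φ s (-1) - 2 * φ s 0) / 2 * t ^ 2 := by
    intro s t
    obtain ⟨a, b, c, h⟩ := h2 s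
    rw [h t, h 0, h 1, h (-1)]
    ring
  obtain ⟨a, b, c, h⟩ := h3
  have d0 := h 0
  have d1 := h 1
  have d2 := h (-1)
  have d3 := h 2
  have d4 := h (-2)
  rw [e1, e2 0, e2 1, e2 (-1)] at d3 d4
  linarith

/-- For a function that is quadratic along `u`, `v` and `u + v`, the mixed fourth order term in the
plane spanned by `u` and `v` vanishes. -/
lemma secondDiff_secondDiff_eq_zero (hu : QuadraticAlong F u) (hv : QuadraticAlong F v)
    (huv : QuadraticAlong F (u + v)) (x : E) : secondDiff v (secondDiff u F) x = 0 := by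
  have := mixed_secondDiff_eq_zero (fun s t => F (x + s • u + t • v))
    (fun t => by
      obtain ⟨a, b, c, h⟩ := hu (x + t • v)
      exact ⟨a, b, c, fun s => by rw [← h]; congr 1; abel⟩)
    (fun s => hv (x + s • u))
    (by
      obtain ⟨a, b, c, h⟩ := huv x
      exact ⟨a, b, c, fun s => by rw [← h, smul_add, add_assoc]⟩)
  rw [← this]
  simp only [secondDiff, one_smul, neg_smul, zero_smul, add_zero, ← sub_eq_add_neg]
  rw [add_right_comm x v u, add_sub_right_comm x v u, sub_add_eq_add_sub x v u,
    sub_right_comm x v u]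

variable {S : Type*} {b : S → E}

lemma quadraticAlong_zero (F : E → ℝ) : QuadraticAlong F 0 :=
  fun x => ⟨F x, 0, 0, fun s => by simp⟩

/-- If `F ≥ 0` is quadratic along all directions `b i - b j`, then its second differences in these
directions are invariant under translations by these directions. Indeed the second difference
`G` with step `b i - b j` is nonnegative and, by `secondDiff_secondDiff_eq_zero` for the triangle
`i, j, k`, affine in the direction `b j - b k`; so it is constant in that direction. -/
lemma secondDiff_invariant (hF : ∀ x, 0 ≤ F x) (hq : ∀ i j, QuadraticAlong F (b i - b j))
    (i j k l : S) (x : E) (s : ℝ) :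
    secondDiff (b i - b j) F (x + s • (b k - b l)) = secondDiff (b i - b j) F x := by
  set G := secondDiff (b i - b j) F
  have hG : ∀ x, 0 ≤ G x := (hq i j).secondDiff_nonneg hF
  have step : ∀ (k : S) (x : E) (s : ℝ), G (x + s • (b j - b k)) = G x := by
    intro k x s
    have hq' : QuadraticAlong G (b j - b k) := (hq j k).secondDiff _
    have h0 : secondDiff (b j - b k) G x = 0 :=
      secondDiff_secondDiff_eq_zero (hq i j) (hq j k) (by simpa using hq i k) x
    have e := hq'.eq x
    simp only [h0, zero_div, zero_mul, add_zero] at e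
    have hc : centralDiff (b j - b k) G x = 0 := by
      by_contra hne
      have h1 := hG (x + (-(G x + 1) / centralDiff (b j - b k) G x) • (b j - b k))
      rw [e, mul_div_cancel₀ _ hne] at h1
      linarith
    rw [e, hc]
    ring
  have : x + s • (b k - b l) = x + s • (b j - b l) + (-s) • (b j - b k) := by
    simp only [smul_sub, neg_smul]; abel
  rw [this, step, step]

/-- A nonnegative function that is quadratic along all directions `b i - b j` is a quadratic
polynomial on each affine subspace whose directions are spanned by these vectors. -/
lemma exists_quadratic_of_nonneg [Fintype S] (hF : ∀ x, 0 ≤ F x)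
    (hq : ∀ i j, QuadraticAlong F (b i - b j)) (k : S) (p : E) :
    ∃ (c : ℝ) (d : S → ℝ) (m : S → S → ℝ), ∀ y : S → ℝ,
      F (p + ∑ l, y l • (b l - b k)) = c + ∑ l, d l * y l + ∑ l, ∑ l', m l l' * (y l * y l') := by
  classical
  set A : S → S → ℝ := fun i j => secondDiff (b i - b j) F p
  set m : S → S → ℝ := fun i j => (A i k + A j k - A i j) / 2
  have hAinv : ∀ (i j : S) (y : S → ℝ) (T : Finset S),
      secondDiff (b i - b j) F (p + ∑ l ∈ T, y l • (b l - b k)) = A i j := by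
    intro i j y T
    induction T using Finset.induction_on with
    | empty => simp [A]
    | insert a T ha ih =>
      rw [Finset.sum_insert ha, add_comm (y a • _), ← add_assoc, secondDiff_invariant hF hq, ih]
  -- the mixed second difference in directions `l, l'` at `x`, by polarization
  have hmixed : ∀ (l l' : S) (x : E) (s : ℝ),
      centralDiff (b l - b k) F (x + s • (b l' - b k)) = centralDiff (b l - b k) F x
        + (secondDiff (b l - b k) F x + secondDiff (b l' - b k) F x
          - secondDiff (b l - b l') F x) / 2 * s := by
    intro l l' x s
    rcases eq_or_ne s 0 with rfl | hs
    · simp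
    set u := b l - b k
    set u' := b l' - b k
    have hd : b l - b l' = u - u' := by simp only [u, u']; abel
    set r := s / 2
    have hr : r ≠ 0 := by simp only [r]; positivity
    have hsr : s = r + r := by simp [r]
    set z := x + r • u'
    have i1 : secondDiff u F z = secondDiff u F x := secondDiff_invariant hF hq l k l' k x r
    have i2 : secondDiff u' F z = secondDiff u' F x := secondDiff_invariant hF hq l' k l' k x r
    have i3 : secondDiff (b l - b l') F z = secondDiff (b l - b l') F x :=
      secondDiff_invariant hF hq l l' l' k x r
    have i4 : secondDiff u F (x + s • u') = secondDiff u F x :=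
      secondDiff_invariant hF hq l k l' k x s
    have e1 := (hq l l').secondDiff_smul r z
    have e2 := (hq l k).eq x r
    have e3 := (hq l k).eq (x + s • u') (-r)
    have e4 := (hq l' k).secondDiff_smul r z
    have q1 : z - r • u' = x := by simp [z]
    have q2 : z + r • u' = x + s • u' := by simp only [z, hsr, add_smul]; abel
    have q3 : z + r • (u - u') = x + r • u := by simp only [z, smul_sub]; abel
    have q4 : z - r • (u - u') = x + s • u' + (-r) • u := by
      simp only [z, hsr, smul_sub, add_smul, neg_smul]; abel
    rw [i3] at e1
    change secondDiff (r • u') F z = r ^ 2 * secondDiff u' F z at e4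
    change F (x + r • u) = F x + centralDiff u F x * r + secondDiff u F x / 2 * r ^ 2 at e2
    change F (x + s • u' + (-r) • u) = F (x + s • u') + centralDiff u F (x + s • u') * (-r)
      + secondDiff u F (x + s • u') / 2 * (-r) ^ 2 at e3
    rw [i4] at e3
    rw [i2, secondDiff, q1, q2] at e4
    rw [hd, secondDiff, q3, q4, e2, e3, ← hd] at e1
    have : r * (centralDiff u F (x + s • u') - (centralDiff u F x
        + (secondDiff u F x + secondDiff u' F x - secondDiff (b l - b l') F x) / 2 * s)) = 0 := by
      rw [hsr]
      rw [hsr] at e1 e4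
      linarith
    rcases mul_eq_zero.1 this with h | h
    · exact absurd h hr
    · linarith
  have hmsymm : ∀ i j, m i j = m j i := by
    intro i j
    simp only [m, A]
    rw [← neg_sub (b j) (b i), secondDiff_neg]
    ring
  have hmdiag : ∀ i, m i i = A i k := by
    intro i
    have : A i i = 0 := by simp [A, secondDiff]; ring
    simp only [m, this]; ring
  have hcentral : ∀ (i : S) (y : S → ℝ) (T : Finset S),
      centralDiff (b i - b k) F (p + ∑ l ∈ T, y l • (b l - b k))
        = centralDiff (b i - b k) F p + ∑ l ∈ T, m i l * y l := by
    intro i y T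
    induction T using Finset.induction_on with
    | empty => simp
    | insert a T ha ih =>
      rw [Finset.sum_insert ha, Finset.sum_insert ha, add_comm (y a • _), ← add_assoc, hmixed, ih,
        hAinv, hAinv, hAinv]
      simp only [m]
      ring
  refine ⟨F p, fun l => centralDiff (b l - b k) F p, fun l l' => m l l' / 2, fun y => ?_⟩
  have main : ∀ T : Finset S, F (p + ∑ l ∈ T, y l • (b l - b k)) = F p
      + ∑ l ∈ T, centralDiff (b l - b k) F p * y l
      + ∑ l ∈ T, ∑ l' ∈ T, m l l' / 2 * (y l * y l') := by
    intro T
    induction T using Finset.induction_on with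
    | empty => simp
    | insert a T ha ih =>
      have e := (hq a k).eq (p + ∑ l ∈ T, y l • (b l - b k)) (y a)
      rw [hAinv, hcentral, ih] at e
      rw [Finset.sum_insert ha, add_comm (y a • _), ← add_assoc, e]
      simp only [Finset.sum_insert ha, Finset.sum_add_distrib]
      have s1 : ∑ l ∈ T, m l a / 2 * (y l * y a) = ∑ l ∈ T, m a l / 2 * (y a * y l) :=
        Finset.sum_congr rfl fun l _ => by rw [hmsymm l a, mul_comm (y l)]
      have s2 : ∑ l ∈ T, m a l / 2 * (y a * y l) = (∑ l ∈ T, m a l * y l) * y a / 2 := by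
        rw [Finset.sum_mul, Finset.sum_div]
        exact Finset.sum_congr rfl fun l _ => by ring
      rw [s1, s2, hmdiag]
      ring
  exact main Finset.univ

end QuadraticAlong

/-! ### Reciprocal powers and derivatives along lines -/

/-- The reciprocal power `(s - I y)⁻ʲ`. As a function of the real variable `s` it extends
holomorphically to the lower half-plane if `y > 0`. -/
noncomputable def recipPow (j : ℕ) (y s : ℝ) : ℂ := (((s : ℂ) - y * Complex.I) ^ j)⁻¹

section RecipPow

variable {y : ℝ}

lemma ofReal_sub_mul_I_ne_zero (hy : y ≠ 0) (s : ℝ) : (s : ℂ) - y * Complex.I ≠ 0 := by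
  intro h
  have := congrArg Complex.im h
  simp at this
  exact hy this

lemma continuous_recipPow (hy : y ≠ 0) (j : ℕ) : Continuous (recipPow j y) := by
  unfold recipPow
  exact Continuous.inv₀ (by fun_prop) fun s => pow_ne_zero _ (ofReal_sub_mul_I_ne_zero hy s)

lemma hasDerivAt_recipPow (hy : y ≠ 0) (j : ℕ) (s : ℝ) :
    HasDerivAt (recipPow j y) (-j * recipPow (j + 1) y s) s := by
  have hne := ofReal_sub_mul_I_ne_zero hy s
  have h1 : HasDerivAt (fun s : ℝ => (s : ℂ) - y * Complex.I) 1 s := by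
    simpa using (HasDerivAt.ofReal_comp (hasDerivAt_id s)).sub_const (y * Complex.I)
  have h2 := (h1.pow j).inv (pow_ne_zero _ hne)
  refine h2.congr_deriv ?_
  rcases j with _ | j
  · simp
  · simp only [recipPow, Nat.add_sub_cancel, Pi.pow_apply]
    field_simp
    ring

lemma norm_recipPow (j : ℕ) (y s : ℝ) :
    ‖recipPow j y s‖ = (‖(s : ℂ) - y * Complex.I‖ ^ j)⁻¹ := by
  rw [recipPow, norm_inv, norm_pow]

lemma norm_ofReal_sub_mul_I_sq (y s : ℝ) : ‖(s : ℂ) - y * Complex.I‖ ^ 2 = s ^ 2 + y ^ 2 := by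
  rw [← Complex.normSq_eq_norm_sq, Complex.normSq_apply]
  simp
  ring

lemma norm_recipPow_two (y s : ℝ) : ‖recipPow 2 y s‖ = (s ^ 2 + y ^ 2)⁻¹ := by
  rw [norm_recipPow, norm_ofReal_sub_mul_I_sq]

lemma recipPow_one_im (y s : ℝ) : (recipPow 1 y s).im = y / (s ^ 2 + y ^ 2) := by
  rw [recipPow, pow_one, Complex.inv_im, Complex.normSq_eq_norm_sq, norm_ofReal_sub_mul_I_sq]
  simp

/-- The functions `(s - ξ - I y)⁻ʲ` with bounded `ξ` are comparable with `(s - I)⁻ʲ`. -/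
lemma exists_norm_recipPow_sub_le (hy : 0 < y) (j : ℕ) (A : ℝ) :
    ∃ C : ℝ, 0 ≤ C ∧ ∀ ξ s : ℝ, |ξ| ≤ A → ‖recipPow j y (s - ξ)‖ ≤ C * ‖recipPow j 1 s‖ := by
  set c : ℝ := 2 + (1 + 2 * A ^ 2) / y ^ 2
  have hc : 0 ≤ c := by positivity
  refine ⟨Real.sqrt c ^ j, by positivity, fun ξ s hξ => ?_⟩
  rw [norm_recipPow, norm_recipPow, ← div_eq_mul_inv, ← one_div,
    div_le_div_iff₀ (pow_pos (norm_pos_iff.2 (ofReal_sub_mul_I_ne_zero hy.ne' _)) _)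
      (pow_pos (norm_pos_iff.2 (ofReal_sub_mul_I_ne_zero one_ne_zero _)) _), one_mul, ← mul_pow]
  refine pow_le_pow_left₀ (norm_nonneg _) ?_ j
  refine abs_le_of_sq_le_sq' ?_ (by positivity) |>.2
  rw [mul_pow, Real.sq_sqrt hc, norm_ofReal_sub_mul_I_sq, norm_ofReal_sub_mul_I_sq]
  have h1 : ξ ^ 2 ≤ A ^ 2 := sq_le_sq' (abs_le.1 hξ).1 (abs_le.1 hξ).2
  have h2 : s ^ 2 ≤ 2 * (s - ξ) ^ 2 + 2 * A ^ 2 := by nlinarith [sq_nonneg (s - 2 * ξ)]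
  have h3 : (1 + 2 * A ^ 2) / y ^ 2 * y ^ 2 = 1 + 2 * A ^ 2 := by field_simp
  have h4 : 0 ≤ (1 + 2 * A ^ 2) / y ^ 2 * (s - ξ) ^ 2 := by positivity
  have h5 : 0 ≤ y ^ 2 := sq_nonneg y
  simp only [c]
  nlinarith

end RecipPow

section PoissonKernel

lemma integral_poissonKernel_comp {y : ℝ} (hy : 0 < y) (h : ℝ → ℝ) :
    ∫ s, h s * (y / (s ^ 2 + y ^ 2)) = ∫ r, h (y * r) * (1 + r ^ 2)⁻¹ := by
  have := Measure.integral_comp_mul_left (fun s => h s * (y / (s ^ 2 + y ^ 2))) y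
  rw [abs_of_pos (inv_pos.2 hy), smul_eq_mul, eq_inv_mul_iff_mul_eq₀ hy.ne'] at this
  rw [← this, ← integral_const_mul]
  refine integral_congr_ae (Eventually.of_forall fun r => ?_)
  simp only
  have : (y * r) ^ 2 + y ^ 2 ≠ 0 := by positivity
  have : (1 + r ^ 2) ≠ 0 := by positivity
  field_simp
  ring

lemma abs_integral_poissonKernel_le {y : ℝ} (hy : 0 < y) {h : ℝ → ℝ} {C : ℝ}
    (hC : ∀ s, |h s| ≤ C) : |∫ s, h s * (y / (s ^ 2 + y ^ 2))| ≤ C * Real.pi := by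
  rw [integral_poissonKernel_comp hy, ← integral_univ_inv_one_add_sq, ← integral_const_mul,
    ← Real.norm_eq_abs]
  refine norm_integral_le_of_norm_le (integrable_inv_one_add_sq.const_mul C)
    (Eventually.of_forall fun r => ?_)
  rw [Real.norm_eq_abs, abs_mul, abs_of_pos (by positivity : (0 : ℝ) < (1 + r ^ 2)⁻¹)]
  gcongr
  exact hC _

lemma tendsto_integral_poissonKernel {h : ℝ → ℝ} (hh : Continuous h) {C : ℝ} (hC : ∀ s, |h s| ≤ C)
    {y : ℕ → ℝ} (hy : ∀ m, 0 < y m) (hy0 : Tendsto y atTop (𝓝 0)) :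
    Tendsto (fun m => ∫ s, h s * (y m / (s ^ 2 + y m ^ 2))) atTop (𝓝 (h 0 * Real.pi)) := by
  simp_rw [fun m => integral_poissonKernel_comp (hy m) h]
  rw [← integral_univ_inv_one_add_sq, ← integral_const_mul]
  refine tendsto_integral_of_dominated_convergence (fun r => C * (1 + r ^ 2)⁻¹)
    (fun m => ?_) (integrable_inv_one_add_sq.const_mul C)
    (fun m => Eventually.of_forall fun r => ?_) (Eventually.of_forall fun r => ?_)
  · exact ((hh.comp (continuous_const.mul continuous_id)).aestronglyMeasurable).mul
      integrable_inv_one_add_sq.aestronglyMeasurable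
  · rw [Real.norm_eq_abs, abs_mul, abs_of_pos (by positivity : (0 : ℝ) < (1 + r ^ 2)⁻¹)]
    gcongr
    exact hC _
  · refine Tendsto.mul_const _ ?_
    have : Tendsto (fun m => y m * r) atTop (𝓝 0) := by simpa using hy0.mul_const r
    exact (hh.tendsto 0).comp this

end PoissonKernel

section Line

variable {E : Type*} [NormedAddCommGroup E] [NormedSpace ℝ E]

/-- Integration by parts on a line. -/
lemma integral_dirDeriv_mul_recipPow {f : E → ℝ} (hf : ContDiff ℝ ∞ f) {t w : E}
    (hc : ∀ g : E → ℝ, HasCompactSupport g → HasCompactSupport fun s : ℝ => g (t - s • w))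
    (hcf : HasCompactSupport f) {y : ℝ} (hy : 0 < y) (j : ℕ) :
    ∫ s : ℝ, (dirDeriv w f (t - s • w) : ℂ) * recipPow j y s
      = -j * ∫ s : ℝ, (f (t - s • w) : ℂ) * recipPow (j + 1) y s := by
  have hint : ∀ g : E → ℝ, Continuous g → HasCompactSupport g → ∀ j,
      Integrable fun s : ℝ => (g (t - s • w) : ℂ) * recipPow j y s := by
    intro g hg hgc j
    refine Continuous.integrable_of_hasCompactSupport ?_ ?_
    · exact (Complex.continuous_ofReal.comp (hg.comp (by fun_prop))).mul
        (continuous_recipPow hy.ne' j)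
    · exact ((hc g hgc).comp_left (g := ((↑) : ℝ → ℂ)) Complex.ofReal_zero).mul_right
  have i1 : Integrable fun s : ℝ => -((dirDeriv w f (t - s • w) : ℂ) * recipPow j y s) :=
    (hint _ (hf.dirDeriv w).continuous (hcf.dirDeriv w) j).neg
  have i2 := (hint f hf.continuous hcf (j + 1)).const_mul (j : ℂ)
  have h0 := integral_eq_zero_of_hasDerivAt_of_integrable
    (f := fun s : ℝ => (f (t - s • w) : ℂ) * recipPow j y s)
    (f' := fun s : ℝ => -((dirDeriv w f (t - s • w) : ℂ) * recipPow j y s)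
      - (j : ℂ) * ((f (t - s • w) : ℂ) * recipPow (j + 1) y s))
    (fun s => by
      have := (hasDerivAt_sub_smul hf t w s).ofReal_comp.mul (hasDerivAt_recipPow hy.ne' j s)
      refine this.congr_deriv ?_
      push_cast
      ring)
    (i1.sub i2) (hint f hf.continuous hcf j)
  rw [integral_sub i1 i2, integral_neg, integral_const_mul] at h0
  linear_combination -h0

lemma integral_iterate_dirDeriv_mul_recipPow {f : E → ℝ} (hf : ContDiff ℝ ∞ f) {t w : E}
    (hc : ∀ g : E → ℝ, HasCompactSupport g → HasCompactSupport fun s : ℝ => g (t - s • w))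
    (hcf : HasCompactSupport f) {y : ℝ} (hy : 0 < y) (k j : ℕ) :
    ∫ s : ℝ, ((dirDeriv w)^[k] f (t - s • w) : ℂ) * recipPow (j + 1) y s
      = (-1) ^ k * ((j + 1).ascFactorial k : ℂ) *
        ∫ s : ℝ, (f (t - s • w) : ℂ) * recipPow (j + 1 + k) y s := by
  induction k generalizing j with
  | zero => simp
  | succ k ih =>
    rw [Function.iterate_succ_apply', integral_dirDeriv_mul_recipPow
      (contDiff_iterate_dirDeriv hf w k) hc (hasCompactSupport_iterate_dirDeriv hcf w k) hy,
      ih (j + 1), Nat.ascFactorial_succ, show j + 1 + 1 + k = j + 1 + (k + 1) by ring]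
    have : (j + 1 + 1).ascFactorial k * (j + 1) = (j + 1 + k) * (j + 1).ascFactorial k := by
      have := Nat.succ_ascFactorial (j + 1) k
      rw [mul_comm]; exact this
    have h' : (((j + 1 + 1).ascFactorial k : ℕ) : ℂ) * (j + 1)
        = (j + 1 + k) * ((j + 1).ascFactorial k : ℕ) := by exact_mod_cast this
    push_cast
    rw [pow_succ]
    linear_combination (-(-1) ^ k * ∫ s : ℝ, (f (t - s • w) : ℂ) * recipPow (j + 1 + (k + 1)) y s) * h'

variable [FiniteDimensional ℝ E] [MeasurableSpace E] [BorelSpace E]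

/-- Let `w` be a vector and `L` a linear functional with `L w = 1`, so that `t - L t • w` is the
projection of `t` to `ker L` along `w`. If `μ` annihilates all products of a compactly supported
continuous function of `t - L t • w` with `(L t - ξ - I y)⁻⁽ᵏ⁺¹⁾`, then its `k`-th distributional
derivative in the direction `w` vanishes. Indeed, up to a constant `(s - I y)⁻⁽ᵏ⁺¹⁾` is the `k`-th
derivative of `(s - I y)⁻¹`, whose imaginary part is the Poisson kernel; integration by parts and
Fubini show that `μ` annihilates the Poisson means of the `k`-th derivative of a test function along
the lines of direction `w`, and these means converge to that derivative as `y → 0`. -/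
lemma integral_iterate_dirDeriv_eq_zero {μ : Measure E} [IsFiniteMeasureOnCompacts μ] {w : E}
    {L : E →L[ℝ] ℝ} (hLw : L w = 1) (k : ℕ)
    (hint : ∀ f : E → ℝ, Continuous f → HasCompactSupport f → ∀ ξ y : ℝ, 0 < y →
      Integrable (fun t => (f (t - L t • w) : ℂ) * recipPow (k + 1) y (L t - ξ)) μ)
    (hzero : ∀ f : E → ℝ, Continuous f → HasCompactSupport f → ∀ ξ y : ℝ, 0 < y →
      ∫ t, (f (t - L t • w) : ℂ) * recipPow (k + 1) y (L t - ξ) ∂μ = 0)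
    {f : E → ℝ} (hf : ContDiff ℝ ∞ f) (hcf : HasCompactSupport f) :
    ∫ t, (dirDeriv w)^[k] f t ∂μ = 0 := by
  set D := (dirDeriv w)^[k] f with hD
  have hDc : Continuous D := (contDiff_iterate_dirDeriv hf w k).continuous
  have hDs : HasCompactSupport D := hasCompactSupport_iterate_dirDeriv hcf w k
  obtain ⟨M0, hM0⟩ := hcf.exists_bound_of_continuous hf.continuous
  obtain ⟨M1, hM1⟩ := hDs.exists_bound_of_continuous hDc
  have hM0' : 0 ≤ M0 := (norm_nonneg _).trans (hM0 0)
  have hM1' : 0 ≤ M1 := (norm_nonneg _).trans (hM1 0)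
  -- a ball that contains the supports of `f` and of its derivative
  obtain ⟨R, hR0, hRf, hRD⟩ : ∃ R : ℝ, 0 ≤ R ∧ (∀ x, f x ≠ 0 → ‖x‖ ≤ R) ∧
      ∀ x, D x ≠ 0 → ‖x‖ ≤ R := by
    obtain ⟨R1, h1⟩ := hcf.isCompact.isBounded.exists_norm_le
    obtain ⟨R2, h2⟩ := hDs.isCompact.isBounded.exists_norm_le
    exact ⟨max (max R1 R2) 0, le_max_right _ _,
      fun x hx => (h1 x (subset_tsupport _ hx)).trans ((le_max_left _ _).trans (le_max_left _ _)),
      fun x hx => (h2 x (subset_tsupport _ hx)).trans ((le_max_right _ _).trans (le_max_left _ _))⟩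
  set A := ‖L‖ * R
  have hA0 : 0 ≤ A := by positivity
  have hLA : ∀ x, ‖x‖ ≤ R → |L x| ≤ A := fun x hx =>
    (L.le_opNorm x).trans (mul_le_mul_of_nonneg_left hx (norm_nonneg _))
  have hLsub : ∀ (t : E) (s : ℝ), L (t - s • w) = L t - s := fun t s => by simp [hLw]
  have hproj : ∀ (t : E) (s : ℝ), ‖t - s • w‖ ≤ R → ‖t - L t • w‖ ≤ R + A * ‖w‖ := by
    intro t s h
    have e : t - L t • w = (t - s • w) - (L (t - s • w)) • w := by
      rw [hLsub, sub_smul]; abel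
    rw [e]
    refine (norm_sub_le _ _).trans (add_le_add h ?_)
    rw [norm_smul]
    gcongr
    exact hLA _ h
  set R' := R + A * ‖w‖
  -- a compactly supported continuous function that is at least `1` on the ball of radius `R'`
  set φ : E → ℝ := fun x => max 0 (R' + 1 - ‖x‖)
  have hφ0 : ∀ x, 0 ≤ φ x := fun x => le_max_left _ _
  have hφ1 : ∀ x, ‖x‖ ≤ R' → 1 ≤ φ x := fun x hx =>
    le_trans (by linarith) (le_max_right _ _)
  have hφc : Continuous φ := by fun_prop
  have hφs : HasCompactSupport φ := by
    refine HasCompactSupport.intro (isCompact_closedBall (0 : E) (R' + 1)) fun x hx => ?_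
    rw [mem_closedBall_zero_iff, not_le] at hx
    exact max_eq_left (by linarith)
  -- up to a constant, `W` dominates the Poisson means of `D` for all `y`
  set W : E → ℝ := fun t => φ (t - L t • w) * ‖recipPow (k + 1) 1 (L t)‖
  have hW0 : ∀ t, 0 ≤ W t := fun t => mul_nonneg (hφ0 _) (norm_nonneg _)
  have hWint : Integrable W μ := by
    have := (hint φ hφc hφs 0 1 one_pos).norm
    refine this.congr (Eventually.of_forall fun t => ?_)
    simp only [norm_mul, sub_zero, Complex.norm_real, Real.norm_of_nonneg (hφ0 _), W]
  have hcs : ∀ t (g : E → ℝ), HasCompactSupport g →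
      HasCompactSupport fun s : ℝ => g (t - s • w) := by
    intro t g hg
    obtain ⟨r, hr⟩ := (hg.isCompact.image L.continuous).isBounded.exists_norm_le
    refine HasCompactSupport.intro (isCompact_closedBall (L t) r) fun s hs => ?_
    by_contra hne
    apply hs
    have := hr _ ⟨_, subset_tsupport _ hne, rfl⟩
    rwa [hLsub, ← dist_eq_norm, dist_comm] at this
  -- integrability on the product, for Fubini's theorem
  have hprod : ∀ y : ℝ, 0 < y → Integrable (Function.uncurry fun (t : E) (ξ : ℝ) =>
      (f (t - L t • w + ξ • w) : ℂ) * recipPow (k + 1) y (L t - ξ)) (μ.prod volume) := by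
    intro y hy
    obtain ⟨C, hC0, hC⟩ := exists_norm_recipPow_sub_le hy (k + 1) A
    refine Integrable.mono' (hWint.mul_prod (g := (Set.Icc (-A) A).indicator fun _ => M0 * C)
      ((integrable_indicator_iff measurableSet_Icc).2 (integrableOn_const (by simp)))) ?_ ?_
    · refine Continuous.aestronglyMeasurable ?_
      exact (Complex.continuous_ofReal.comp (hf.continuous.comp (by fun_prop))).mul
        ((continuous_recipPow hy.ne' (k + 1)).comp (by fun_prop))
    · refine Eventually.of_forall fun p => ?_
      obtain ⟨t, ξ⟩ := p
      simp only [Function.uncurry_apply_pair]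
      by_cases h0 : f (t - L t • w + ξ • w) = 0
      · rw [h0]
        simp only [Complex.ofReal_zero, zero_mul, norm_zero]
        refine mul_nonneg (hW0 _) (Set.indicator_nonneg (fun _ _ => by positivity) _)
      · have e1 : t - L t • w + ξ • w = t - (L t - ξ) • w := by
          rw [sub_smul, sub_sub_eq_add_sub, add_sub_right_comm]
        have hb := hRf _ h0
        rw [e1] at hb
        have h1 := hLA _ hb
        rw [hLsub, sub_sub_cancel] at h1
        rw [Set.indicator_of_mem (Set.mem_Icc.2 (abs_le.1 h1)), norm_mul, Complex.norm_real]
        have h2 := hφ1 _ (hproj _ _ hb)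
        calc ‖f (t - L t • w + ξ • w)‖ * ‖recipPow (k + 1) y (L t - ξ)‖
            ≤ M0 * (C * ‖recipPow (k + 1) 1 (L t)‖) := by
              gcongr
              · exact hM0 _
              · exact hC _ _ h1
          _ = 1 * ‖recipPow (k + 1) 1 (L t)‖ * (M0 * C) := by ring
          _ ≤ W t * (M0 * C) := by simp only [W]; gcongr
  have hsubst : ∀ y t, ∫ s : ℝ, (f (t - s • w) : ℂ) * recipPow (k + 1) y s
      = ∫ ξ : ℝ, (f (t - L t • w + ξ • w) : ℂ) * recipPow (k + 1) y (L t - ξ) := by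
    intro y t
    rw [← integral_sub_left_eq_self _ _ (L t)]
    refine integral_congr_ae (Eventually.of_forall fun ξ => ?_)
    simp only [sub_smul]
    rw [sub_sub_eq_add_sub, add_sub_right_comm]
  have hfub : ∀ y : ℝ, 0 < y →
      ∫ t, ∫ s : ℝ, (f (t - s • w) : ℂ) * recipPow (k + 1) y s ∂volume ∂μ = 0 := by
    intro y hy
    simp_rw [hsubst y]
    rw [integral_integral_swap (hprod y hy)]
    refine integral_eq_zero_of_ae (Eventually.of_forall fun ξ => ?_)
    exact hzero (fun x => f (x + ξ • w)) (hf.continuous.comp (by fun_prop))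
      (hcf.comp_homeomorph (Homeomorph.addRight (ξ • w))) ξ y hy
  set N : ℂ := (-1) ^ k * ((0 + 1).ascFactorial k : ℂ)
  have hibp : ∀ (y : ℝ), 0 < y → ∀ t, ∫ s : ℝ, (D (t - s • w) : ℂ) * recipPow 1 y s
      = N * ∫ s : ℝ, (f (t - s • w) : ℂ) * recipPow (k + 1) y s := by
    intro y hy t
    have := integral_iterate_dirDeriv_mul_recipPow hf (t := t) (w := w) (hcs t) hcf hy k 0
    rw [show 0 + 1 + k = k + 1 by ring] at this
    exact this
  -- the Poisson mean of `D` is an imaginary part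
  set G : ℝ → E → ℝ := fun y t => ∫ s : ℝ, D (t - s • w) * (y / (s ^ 2 + y ^ 2))
  have hGim : ∀ y, 0 < y → ∀ t, G y t
      = (N * ∫ s : ℝ, (f (t - s • w) : ℂ) * recipPow (k + 1) y s).im := by
    intro y hy t
    rw [← hibp y hy t]
    have hi : Integrable fun s : ℝ => (D (t - s • w) : ℂ) * recipPow 1 y s := by
      refine Continuous.integrable_of_hasCompactSupport ?_ ?_
      · exact (Complex.continuous_ofReal.comp (hDc.comp (by fun_prop))).mul
          (continuous_recipPow hy.ne' 1)
      · exact ((hcs t D hDs).comp_left (g := ((↑) : ℝ → ℂ)) Complex.ofReal_zero).mul_right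
    have := integral_im hi
    simp only [RCLike.im_eq_complex_im] at this
    rw [← this]
    simp only [G, Complex.im_ofReal_mul, recipPow_one_im]
  have hintF : ∀ y, 0 < y → Integrable
      (fun t => ∫ s : ℝ, (f (t - s • w) : ℂ) * recipPow (k + 1) y s) μ := by
    intro y hy
    simp_rw [hsubst y]
    exact (hprod y hy).integral_prod_left
  have hG0 : ∀ y, 0 < y → ∫ t, G y t ∂μ = 0 := by
    intro y hy
    simp_rw [hGim y hy]
    have := integral_im ((hintF y hy).const_mul N)
    simp only [RCLike.im_eq_complex_im] at this
    rw [this, integral_const_mul, hfub y hy, mul_zero, Complex.zero_im]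
  -- For bounded `L t` the Poisson means are bounded because `D` is; for large `L t`, where the Poisson
  -- kernel is smooth on the support, the form after integration by parts decays like `|L t|⁻⁽ᵏ⁺¹⁾`.
  have hbound : ∃ C : ℝ, ∀ y, 0 < y → ∀ t, ‖G y t‖ ≤ C * W t := by
    refine ⟨M1 * Real.pi * (2 * A + 2) ^ (k + 1) + ‖N‖ * (2 * A * M0 * 2 ^ (k + 1)),
      fun y hy t => ?_⟩
    by_cases hex : ∃ s : ℝ, ‖t - s • w‖ ≤ R
    swap
    · have : G y t = 0 := by
        refine integral_eq_zero_of_ae (Eventually.of_forall fun s => ?_)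
        have : D (t - s • w) = 0 := by
          by_contra h
          exact hex ⟨s, hRD _ h⟩
        simp [this]
      rw [this, norm_zero]
      exact mul_nonneg (by positivity) (hW0 t)
    obtain ⟨s₀, hs₀⟩ := hex
    set K := ‖recipPow (k + 1) 1 (L t)‖
    have hKW : K ≤ W t := le_mul_of_one_le_left (norm_nonneg _) (hφ1 _ (hproj _ _ hs₀))
    have hK : ((|L t| + 1) ^ (k + 1))⁻¹ ≤ K := by
      simp only [K, norm_recipPow]
      have hpos := norm_pos_iff.2 (ofReal_sub_mul_I_ne_zero (one_ne_zero (α := ℝ)) (L t))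
      gcongr
      refine (norm_sub_le _ _).trans ?_
      simp
    have hK0 : 0 ≤ K := norm_nonneg _
    refine le_trans ?_ (mul_le_mul_of_nonneg_left hKW (by positivity))
    rw [add_mul]
    rcases le_or_gt |L t| (2 * A + 1) with hsmall | hlarge
    · have h1 : ‖G y t‖ ≤ M1 * Real.pi := abs_integral_poissonKernel_le hy fun s => hM1 _
      have h2 : 1 ≤ (2 * A + 2) ^ (k + 1) * K := by
        calc (1 : ℝ) = (2 * A + 2) ^ (k + 1) * ((2 * A + 2) ^ (k + 1))⁻¹ :=
              (mul_inv_cancel₀ (by positivity)).symm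
          _ ≤ (2 * A + 2) ^ (k + 1) * ((|L t| + 1) ^ (k + 1))⁻¹ :=
              mul_le_mul_of_nonneg_left (inv_anti₀ (by positivity)
                (pow_le_pow_left₀ (by positivity) (by linarith) _)) (by positivity)
          _ ≤ _ := by gcongr
      have h3 : 0 ≤ ‖N‖ * (2 * A * M0 * 2 ^ (k + 1)) * K := by positivity
      have h4 : M1 * Real.pi * 1 ≤ M1 * Real.pi * ((2 * A + 2) ^ (k + 1) * K) := by gcongr
      linarith
    · have h1 : ‖∫ s : ℝ, (f (t - s • w) : ℂ) * recipPow (k + 1) y s‖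
          ≤ 2 * A * M0 * 2 ^ (k + 1) * ((|L t| + 1) ^ (k + 1))⁻¹ := by
        have hi : Integrable ((Set.Icc (L t - A) (L t + A)).indicator
            fun _ => M0 * (2 ^ (k + 1) * ((|L t| + 1) ^ (k + 1))⁻¹)) (volume : Measure ℝ) :=
          (integrable_indicator_iff measurableSet_Icc).2 (integrableOn_const (by simp))
        refine (norm_integral_le_of_norm_le hi (Eventually.of_forall fun s => ?_)).trans ?_
        · by_cases h0 : f (t - s • w) = 0
          · rw [h0]
            simp only [Complex.ofReal_zero, zero_mul, norm_zero]
            exact Set.indicator_nonneg (fun _ _ => by positivity) _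
          · have h1 := hLA _ (hRf _ h0)
            rw [hLsub, abs_le] at h1
            rw [Set.indicator_of_mem (Set.mem_Icc.2 ⟨by linarith, by linarith⟩), norm_mul,
              Complex.norm_real, norm_recipPow]
            have h2 : (|L t| + 1) / 2 ≤ ‖(s : ℂ) - y * Complex.I‖ := by
              have h3 : |s| ≤ ‖(s : ℂ) - y * Complex.I‖ := by
                simpa using Complex.abs_re_le_norm ((s : ℂ) - y * Complex.I)
              have h4 : |L t| ≤ |s| + A := by
                have := abs_sub_abs_le_abs_sub (L t) s
                have := abs_le.2 h1
                linarith
              linarith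
            have h5 : (‖(s : ℂ) - y * Complex.I‖ ^ (k + 1))⁻¹
                ≤ 2 ^ (k + 1) * ((|L t| + 1) ^ (k + 1))⁻¹ := by
              have : 2 ^ (k + 1) * ((|L t| + 1) ^ (k + 1))⁻¹ = (((|L t| + 1) / 2) ^ (k + 1))⁻¹ := by
                rw [div_pow, inv_div, div_eq_mul_inv]
              rw [this]
              gcongr
            gcongr
            exact hM0 _
        · rw [integral_indicator measurableSet_Icc, setIntegral_const]
          simp only [Measure.real, Real.volume_Icc, smul_eq_mul]
          rw [ENNReal.toReal_ofReal (by linarith)]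
          exact le_of_eq (by ring)
      have h2 : ‖G y t‖ ≤ ‖N‖ * ‖∫ s : ℝ, (f (t - s • w) : ℂ) * recipPow (k + 1) y s‖ := by
        rw [hGim y hy, ← norm_mul]
        exact Complex.abs_im_le_norm _
      have h3 : 0 ≤ M1 * Real.pi * (2 * A + 2) ^ (k + 1) * K := by positivity
      have h4 : ‖N‖ * ‖∫ s : ℝ, (f (t - s • w) : ℂ) * recipPow (k + 1) y s‖
          ≤ ‖N‖ * (2 * A * M0 * 2 ^ (k + 1) * K) := by
        refine mul_le_mul_of_nonneg_left (h1.trans ?_) (norm_nonneg _)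
        gcongr
      linarith
  obtain ⟨C, hC⟩ := hbound
  have hlim : Tendsto (fun m : ℕ => ∫ t, G (1 / ((m : ℝ) + 1)) t ∂μ) atTop
      (𝓝 (∫ t, D t * Real.pi ∂μ)) := by
    refine tendsto_integral_of_dominated_convergence (fun t => C * W t) (fun m => ?_)
      (hWint.const_mul C) (fun m => Eventually.of_forall fun t => hC _ (by positivity) t)
      (Eventually.of_forall fun t => ?_)
    · rw [funext (hGim _ (by positivity))]
      exact (Complex.continuous_im.comp_aestronglyMeasurable
        ((hintF _ (by positivity)).const_mul N).aestronglyMeasurable)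
    · have : Tendsto (fun m : ℕ => G (1 / ((m : ℝ) + 1)) t) atTop
          (𝓝 (D (t - (0 : ℝ) • w) * Real.pi)) := tendsto_integral_poissonKernel (h := fun s => D (t - s • w))
        (hDc.comp (by fun_prop)) (fun s => hM1 _) (y := fun m : ℕ => 1 / ((m : ℝ) + 1))
        (fun m => by positivity) tendsto_one_div_add_atTop_nhds_zero_nat
      simpa only [zero_smul, sub_zero] using this
  have hz : (fun m : ℕ => ∫ t, G (1 / ((m : ℝ) + 1)) t ∂μ) = fun _ => 0 :=
    funext fun m => hG0 _ (by positivity)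
  rw [hz] at hlim
  have := tendsto_nhds_unique hlim tendsto_const_nhds
  rw [integral_mul_const] at this
  exact (mul_eq_zero.1 this).resolve_right Real.pi_ne_zero

end Line

/-! ### Freezing variables in the Nevanlinna condition -/

section PoissonProduct

lemma poissonKernel_mul_one_add_sq_le {ε : ℝ} (hε : 0 < ε) (hε1 : ε ≤ 1) {A x : ℝ} (hx : |x| ≤ A)
    (t : ℝ) : ε / ((t - x) ^ 2 + ε ^ 2) ≤
      2 * (1 + A ^ 2) * (1 + ε / ((t - x) ^ 2 + ε ^ 2)) * (1 + t ^ 2)⁻¹ := by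
  rw [← div_eq_mul_inv, le_div_iff₀ (by positivity)]
  have hx2 : x ^ 2 ≤ A ^ 2 := sq_le_sq' (abs_le.1 hx).1 (abs_le.1 hx).2
  have h1 : 1 + t ^ 2 ≤ 2 * (1 + A ^ 2) * (1 + (t - x) ^ 2) := by
    nlinarith [sq_nonneg (t - 2 * x), mul_nonneg (sq_nonneg A) (sq_nonneg (t - x))]
  have h2 : ε / ((t - x) ^ 2 + ε ^ 2) * (1 + (t - x) ^ 2) ≤ 1 + ε / ((t - x) ^ 2 + ε ^ 2) := by
    rw [mul_add, mul_one, add_comm 1]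
    gcongr
    rw [div_mul_eq_mul_div, div_le_one (by positivity)]
    nlinarith [sq_nonneg (t - x), sq_nonneg ε, mul_nonneg (sub_nonneg.2 hε1) (sq_nonneg (t - x))]
  have h0 : 0 ≤ ε / ((t - x) ^ 2 + ε ^ 2) := by positivity
  calc ε / ((t - x) ^ 2 + ε ^ 2) * (1 + t ^ 2)
      ≤ ε / ((t - x) ^ 2 + ε ^ 2) * (2 * (1 + A ^ 2) * (1 + (t - x) ^ 2)) := by gcongr
    _ = 2 * (1 + A ^ 2) * (ε / ((t - x) ^ 2 + ε ^ 2) * (1 + (t - x) ^ 2)) := by ring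
    _ ≤ _ := by gcongr

lemma integrable_poissonKernel_sub {ε : ℝ} (hε : 0 < ε) (t : ℝ) :
    Integrable fun x => ε / ((t - x) ^ 2 + ε ^ 2) := by
  have h := (integrable_inv_one_add_sq.comp_div hε.ne').const_mul ε⁻¹
  have h2 : Integrable fun s : ℝ => ε / (s ^ 2 + ε ^ 2) := by
    refine h.congr (Eventually.of_forall fun s => ?_)
    have : (1 + (s / ε) ^ 2) ≠ 0 := by positivity
    have : s ^ 2 + ε ^ 2 ≠ 0 := by positivity
    simp only
    field_simp
    ring
  exact h2.comp_sub_left t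

lemma integral_poissonKernel_sub {ε : ℝ} (hε : 0 < ε) (t : ℝ) :
    ∫ x, ε / ((t - x) ^ 2 + ε ^ 2) = Real.pi := by
  rw [integral_sub_left_eq_self (fun s : ℝ => ε / (s ^ 2 + ε ^ 2)) volume t]
  have := integral_poissonKernel_comp hε fun _ => 1
  simpa using this

/-- The mass that the Poisson kernels centred at `t` give to a bounded interval decays like `t⁻²`,
uniformly in the width of the kernel. -/
lemma setIntegral_poissonKernel_le {ε : ℝ} (hε : 0 < ε) (hε1 : ε ≤ 1) {A : ℝ} (hA : 0 ≤ A) (t : ℝ) :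
    ∫ x in Set.Icc (-A) A, ε / ((t - x) ^ 2 + ε ^ 2)
      ≤ 2 * (1 + A ^ 2) * (2 * A + Real.pi) * (1 + t ^ 2)⁻¹ := by
  have hi := integrable_poissonKernel_sub hε t
  have hc : IntegrableOn (fun _ : ℝ => (1 : ℝ)) (Set.Icc (-A) A) :=
    integrableOn_const (by simp)
  calc ∫ x in Set.Icc (-A) A, ε / ((t - x) ^ 2 + ε ^ 2)
      ≤ ∫ x in Set.Icc (-A) A,
          2 * (1 + A ^ 2) * (1 + ε / ((t - x) ^ 2 + ε ^ 2)) * (1 + t ^ 2)⁻¹ := by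
        refine setIntegral_mono_on hi.integrableOn
          (((hc.add hi.integrableOn).const_mul _).mul_const _) measurableSet_Icc fun x hx => ?_
        exact poissonKernel_mul_one_add_sq_le hε hε1 (abs_le.2 hx) t
    _ = 2 * (1 + A ^ 2) * (2 * A + ∫ x in Set.Icc (-A) A, ε / ((t - x) ^ 2 + ε ^ 2))
          * (1 + t ^ 2)⁻¹ := by
        rw [integral_mul_const, integral_const_mul, integral_add hc hi.integrableOn,
          setIntegral_const]
        simp only [Measure.real, Real.volume_Icc, smul_eq_mul]
        rw [ENNReal.toReal_ofReal (by linarith)]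
        ring
    _ ≤ _ := by
        gcongr
        rw [← integral_poissonKernel_sub hε t]
        exact setIntegral_le_integral hi (Eventually.of_forall fun x => by positivity)

variable {ι : Type*} [Fintype ι]

lemma integral_prod_poissonKernel_comp {ε : ℝ} (hε : 0 < ε) (t : ι → ℝ) (h : (ι → ℝ) → ℂ) :
    ∫ x : ι → ℝ, h x * ((∏ l, ε / ((t l - x l) ^ 2 + ε ^ 2) : ℝ) : ℂ)
      = ∫ r : ι → ℝ, h (t - ε • r) * ((∏ l, (1 + r l ^ 2)⁻¹ : ℝ) : ℂ) := by
  rw [← integral_sub_left_eq_self _ _ t]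
  have := Measure.integral_comp_smul (volume : Measure (ι → ℝ)) (fun s : ι → ℝ =>
    h (t - s) * ((∏ l, ε / ((t l - (t - s) l) ^ 2 + ε ^ 2) : ℝ) : ℂ)) ε
  rw [Module.finrank_fintype_fun_eq_card, abs_of_pos (by positivity),
    eq_inv_smul_iff₀ (by positivity)] at this
  rw [← this, ← integral_smul]
  refine integral_congr_ae (Eventually.of_forall fun r => ?_)
  simp only [Pi.sub_apply, sub_sub_cancel, Pi.smul_apply, smul_eq_mul, Complex.real_smul]
  rw [mul_left_comm]
  congr 1
  rw [← Complex.ofReal_mul]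
  congr 1
  rw [← Finset.card_univ, ← Finset.prod_const, ← Finset.prod_mul_distrib]
  refine Finset.prod_congr rfl fun l _ => ?_
  have : (ε * r l) ^ 2 + ε ^ 2 ≠ 0 := by positivity
  have : 1 + r l ^ 2 ≠ 0 := by positivity
  field_simp
  ring

lemma integrable_prod_inv_one_add_sq :
    Integrable fun r : ι → ℝ => ∏ l, (1 + r l ^ 2)⁻¹ :=
  Integrable.fintype_prod fun _ => integrable_inv_one_add_sq

lemma tendsto_integral_prod_poissonKernel {h : (ι → ℝ) → ℂ} (hh : Continuous h) {C : ℝ}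
    (hC : ∀ x, ‖h x‖ ≤ C) (t : ι → ℝ) {ε : ℕ → ℝ} (hε : ∀ m, 0 < ε m)
    (hε0 : Tendsto ε atTop (𝓝 0)) :
    Tendsto (fun m => ∫ x : ι → ℝ, h x * ((∏ l, ε m / ((t l - x l) ^ 2 + ε m ^ 2) : ℝ) : ℂ)) atTop
      (𝓝 (h t * (Real.pi : ℂ) ^ Fintype.card ι)) := by
  simp_rw [fun m => integral_prod_poissonKernel_comp (hε m) t h]
  have e : ((Real.pi : ℂ) ^ Fintype.card ι) = ∫ r : ι → ℝ, ((∏ l, (1 + r l ^ 2)⁻¹ : ℝ) : ℂ) := by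
    rw [integral_complex_ofReal, integral_fintype_prod_volume_eq_pow
      (fun r : ℝ => (1 + r ^ 2)⁻¹), integral_univ_inv_one_add_sq]
    push_cast; rfl
  rw [e, ← integral_const_mul]
  have hP : Continuous fun r : ι → ℝ => ((∏ l, (1 + r l ^ 2)⁻¹ : ℝ) : ℂ) := by
    refine Complex.continuous_ofReal.comp (continuous_finsetProd _ fun l _ => ?_)
    exact Continuous.inv₀ (by fun_prop) fun r => by positivity
  refine tendsto_integral_of_dominated_convergence (fun r => C * ∏ l, (1 + r l ^ 2)⁻¹)
    (fun m => ?_) (integrable_prod_inv_one_add_sq.const_mul C)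
    (fun m => Eventually.of_forall fun r => ?_) (Eventually.of_forall fun r => ?_)
  · exact ((hh.comp (by fun_prop)).mul hP).aestronglyMeasurable
  · have h0 : 0 ≤ ∏ l, (1 + r l ^ 2)⁻¹ := Finset.prod_nonneg fun l _ => by positivity
    rw [norm_mul, Complex.norm_real, Real.norm_of_nonneg h0]
    gcongr
    exact hC _
  · refine Tendsto.mul_const _ ?_
    have : Tendsto (fun m => t - ε m • r) atTop (𝓝 t) := by
      simpa using tendsto_const_nhds.sub (hε0.smul_const r)
    exact (hh.tendsto t).comp this

end PoissonProduct

section Nevanlinna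

variable {n : ℕ} {μ : Measure (EuclideanSpace ℝ (Fin n))}

/-- The weight `∏ 1 / (1 + t_l ^ 2)` of the growth condition. -/
noncomputable def growthWeight (t : EuclideanSpace ℝ (Fin n)) : ℝ := ∏ l, (1 + t l ^ 2)⁻¹

lemma growthWeight_nonneg (t : EuclideanSpace ℝ (Fin n)) : 0 ≤ growthWeight t :=
  Finset.prod_nonneg fun l _ => by positivity

lemma continuous_growthWeight : Continuous (growthWeight (n := n)) :=
  continuous_finsetProd _ fun l _ => Continuous.inv₀ (by fun_prop) fun r => by positivity

lemma growthWeight_eq {i j : Fin n} (hij : i ≠ j) (t : EuclideanSpace ℝ (Fin n)) :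
    growthWeight t = (1 + t i ^ 2)⁻¹ * (1 + t j ^ 2)⁻¹ *
      ∏ l : ({i, j}ᶜ : Finset (Fin n)), (1 + t l ^ 2)⁻¹ := by
  rw [growthWeight, ← Finset.prod_mul_prod_compl {i, j}, Finset.prod_pair hij,
    Finset.prod_coe_sort ({i, j}ᶜ : Finset (Fin n)) fun l => (1 + t l ^ 2)⁻¹]

lemma integrable_growthWeight_iff :
    Integrable growthWeight μ ↔ ∫⁻ t, ENNReal.ofReal (∏ l, 1 / (1 + t l ^ 2)) ∂μ < ⊤ := by
  rw [Integrable, and_iff_right continuous_growthWeight.aestronglyMeasurable,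
    hasFiniteIntegral_iff_ofReal (Eventually.of_forall growthWeight_nonneg)]
  simp only [growthWeight, one_div]

lemma IsNevanlinnaMeasure.integrable_growthWeight (hμ : IsNevanlinnaMeasure μ) :
    Integrable growthWeight μ :=
  integrable_growthWeight_iff.2 hμ.growth

lemma isFiniteMeasureOnCompacts_of_growth (h : Integrable growthWeight μ) :
    IsFiniteMeasureOnCompacts μ := by
  refine ⟨fun K hK => ?_⟩
  rcases K.eq_empty_or_nonempty with rfl | hne
  · simp
  obtain ⟨x, -, hx⟩ := hK.exists_isMinOn hne continuous_growthWeight.continuousOn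
  have hpos : 0 < growthWeight x := Finset.prod_pos fun l _ => by positivity
  refine (measure_mono fun t ht => ?_).trans_lt (h.measure_norm_ge_lt_top hpos)
  rw [Set.mem_ofPred_eq, Real.norm_of_nonneg (growthWeight_nonneg t)]
  exact hx ht

lemma one_div_sub_one_div_conj (t x ε : ℝ) (hε : ε ≠ 0) :
    1 / ((t : ℂ) - (x + ε * Complex.I)) - 1 / ((t : ℂ) - starRingEnd ℂ (x + ε * Complex.I))
      = 2 * Complex.I * ((ε / ((t - x) ^ 2 + ε ^ 2) : ℝ) : ℂ) := by
  have h1 : (t : ℂ) - (x + ε * Complex.I) ≠ 0 := by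
    have := ofReal_sub_mul_I_ne_zero hε (t - x)
    push_cast at this
    rwa [sub_sub] at this
  have h2 : (t : ℂ) - (x - ε * Complex.I) ≠ 0 := by
    have := ofReal_sub_mul_I_ne_zero (neg_ne_zero.2 hε) (t - x)
    push_cast at this
    convert this using 1; ring
  have h3 : (((t - x) ^ 2 + ε ^ 2 : ℝ) : ℂ)
      = ((t : ℂ) - (x + ε * Complex.I)) * ((t : ℂ) - (x - ε * Complex.I)) := by
    push_cast
    linear_combination (ε : ℂ) ^ 2 * Complex.I_sq
  have h4 : starRingEnd ℂ (x + ε * Complex.I) = x - ε * Complex.I := by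
    simp [sub_eq_add_neg]
  rw [h4, Complex.ofReal_div, h3]
  field_simp
  ring

lemma conj_recipPow (j : ℕ) (y s : ℝ) : starRingEnd ℂ (recipPow j y s) = recipPow j (-y) s := by
  simp [recipPow]

/-- The Nevanlinna condition in terms of Poisson kernels, for distinct indices in any order. -/
lemma IsNevanlinnaMeasure.integral_poissonKernel_eq_zero (hμ : IsNevanlinnaMeasure μ) {i j : Fin n}
    (hij : i ≠ j) {yi yj ε : ℝ} (hyi : 0 < yi) (hyj : 0 < yj) (hε : 0 < ε) (a b : ℝ)
    (x : ({i, j}ᶜ : Finset (Fin n)) → ℝ) :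
    ∫ t, recipPow 2 yi (t i - a) * recipPow 2 (-yj) (t j - b) *
      ((∏ l : ({i, j}ᶜ : Finset (Fin n)), ε / ((t l - x l) ^ 2 + ε ^ 2) : ℝ) : ℂ) ∂μ = 0 := by
  classical
  -- the case in which the smaller index carries the pole in the upper half-plane; the other case
  -- follows by complex conjugation
  have key : ∀ i' j' : Fin n, i' < j' → ({i', j'} : Finset (Fin n)) = {i, j} →
      ∀ (y1 y2 a b : ℝ), 0 < y1 → 0 < y2 →
      ∫ t, recipPow 2 y1 (t i' - a) * recipPow 2 (-y2) (t j' - b) *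
        ((∏ l : ({i, j}ᶜ : Finset (Fin n)), ε / ((t l - x l) ^ 2 + ε ^ 2) : ℝ) : ℂ) ∂μ = 0 := by
    intro i' j' hlt hs y1 y2 a b h1 h2
    set z : Fin n → ℂ := fun l => if l = i' then a + y1 * Complex.I else
      if l = j' then b + y2 * Complex.I else
      if h : l ∈ ({i, j}ᶜ : Finset (Fin n)) then x ⟨l, h⟩ + ε * Complex.I else Complex.I
    have hzi : z i' = a + y1 * Complex.I := if_pos rfl
    have hzj : z j' = b + y2 * Complex.I := by
      simp only [z, if_neg hlt.ne', if_true]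
    have hzl : ∀ l : ({i, j}ᶜ : Finset (Fin n)), z l = x l + ε * Complex.I := by
      intro l
      have hl : (l : Fin n) ∉ ({i', j'} : Finset (Fin n)) := by
        rw [hs]; exact Finset.mem_compl.1 l.2
      rw [Finset.mem_insert, Finset.mem_singleton, not_or] at hl
      simp only [z, if_neg hl.1, if_neg hl.2, dif_pos l.2]
    have hz : ∀ l, 0 < (z l).im := by
      intro l
      simp only [z]
      split_ifs <;> simp [h1, h2, hε]
    have h0 := hμ.nevanlinna z hz i' j' hlt
    rw [hs, hzi, hzj] at h0
    have e : ∀ t : EuclideanSpace ℝ (Fin n),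
        1 / (((t i' : ℂ) - (a + y1 * Complex.I)) ^ 2 *
            ((t j' : ℂ) - starRingEnd ℂ (b + y2 * Complex.I)) ^ 2) *
          ∏ l ∈ ({i, j} : Finset (Fin n))ᶜ,
            (1 / ((t l : ℂ) - z l) - 1 / ((t l : ℂ) - starRingEnd ℂ (z l)))
        = (2 * Complex.I) ^ Fintype.card ({i, j}ᶜ : Finset (Fin n)) *
          (recipPow 2 y1 (t i' - a) * recipPow 2 (-y2) (t j' - b) *
            ((∏ l : ({i, j}ᶜ : Finset (Fin n)), ε / ((t l - x l) ^ 2 + ε ^ 2) : ℝ) : ℂ)) := by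
      intro t
      rw [← Finset.prod_coe_sort]
      simp_rw [hzl, one_div_sub_one_div_conj _ _ _ hε.ne']
      rw [Finset.prod_mul_distrib, Finset.prod_const, Finset.card_univ, recipPow, recipPow,
        one_div, mul_inv]
      push_cast
      have e1 : (t i' : ℂ) - (a + y1 * Complex.I) = t i' - a - y1 * Complex.I := by ring
      have e2 : (t j' : ℂ) - starRingEnd ℂ (b + y2 * Complex.I) = t j' - b - -y2 * Complex.I := by
        simp; ring
      rw [e1, e2]
      ring
    simp_rw [e] at h0
    rw [integral_const_mul] at h0
    exact (mul_eq_zero.1 h0).resolve_left (pow_ne_zero _ (by simp))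
  rcases lt_or_gt_of_ne hij with hlt | hlt
  · exact key i j hlt rfl yi yj a b hyi hyj
  · have h := congrArg (starRingEnd ℂ) (key j i hlt (Finset.pair_comm j i) yj yi b a hyj hyi)
    rw [← integral_conj, map_zero] at h
    rw [← h]
    refine integral_congr_ae (Eventually.of_forall fun t => ?_)
    simp only [map_mul, conj_recipPow, Complex.conj_ofReal, neg_neg]
    ring

/-- The kernels that a Nevanlinna measure annihilates, with all variables other than `t i` and `t j`
frozen: for a compactly supported continuous function `θ` of these other variables, the poles of the
two remaining factors may depend continuously on them. This follows by integrating the Nevanlinna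
condition over the real parts `x` of the other parameters against `θ x`, and letting their imaginary
parts tend to zero. -/
lemma IsNevanlinnaMeasure.integrable_and_integral_eq_zero (hμ : IsNevanlinnaMeasure μ)
    {i j : Fin n} (hij : i ≠ j) {yi yj : ℝ} (hyi : 0 < yi) (hyj : 0 < yj)
    {θ a b : (({i, j}ᶜ : Finset (Fin n)) → ℝ) → ℝ} (hθ : Continuous θ) (hθc : HasCompactSupport θ)
    (ha : Continuous a) (hb : Continuous b) :
    Integrable (fun t => (θ (fun l => t l) : ℂ) * (recipPow 2 yi (t i - a fun l => t l) *
      recipPow 2 (-yj) (t j - b fun l => t l))) μ ∧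
    ∫ t, (θ (fun l => t l) : ℂ) * (recipPow 2 yi (t i - a fun l => t l) *
      recipPow 2 (-yj) (t j - b fun l => t l)) ∂μ = 0 := by
  have : IsFiniteMeasureOnCompacts μ := isFiniteMeasureOnCompacts_of_growth hμ.integrable_growthWeight
  set g : EuclideanSpace ℝ (Fin n) → (({i, j}ᶜ : Finset (Fin n)) → ℝ) → ℂ := fun t x =>
    (θ x : ℂ) * (recipPow 2 yi (t i - a x) * recipPow 2 (-yj) (t j - b x))
  have hgc : Continuous (Function.uncurry g) := by
    refine Continuous.mul (by fun_prop) (Continuous.mul ?_ ?_)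
    · exact (continuous_recipPow hyi.ne' 2).comp (by fun_prop)
    · exact (continuous_recipPow (neg_ne_zero.2 hyj.ne') 2).comp (by fun_prop)
  -- a cube that contains the support of `θ`
  obtain ⟨A, hA0, hA⟩ : ∃ A : ℝ, 0 ≤ A ∧ ∀ x, θ x ≠ 0 → ∀ l, |x l| ≤ A := by
    obtain ⟨A, hA⟩ := hθc.isCompact.isBounded.exists_norm_le
    exact ⟨max A 0, le_max_right _ _, fun x hx l => (norm_le_pi_norm x l).trans
      ((hA x (subset_tsupport _ hx)).trans (le_max_left _ _))⟩
  set B : ℝ → ℝ := (Set.Icc (-A) A).indicator fun _ => 1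
  have hB0 : ∀ x, 0 ≤ B x := fun x => Set.indicator_nonneg (fun _ _ => zero_le_one) _
  obtain ⟨C, hC0, hC⟩ : ∃ C : ℝ, 0 ≤ C ∧ ∀ t x, ‖g t x‖ ≤
      C * ((1 + t i ^ 2)⁻¹ * (1 + t j ^ 2)⁻¹) * ∏ l, B (x l) := by
    obtain ⟨M, hM⟩ := hθc.exists_bound_of_continuous hθ
    obtain ⟨Ra, hRa⟩ := (hθc.isCompact.image ha).isBounded.exists_norm_le
    obtain ⟨Rb, hRb⟩ := (hθc.isCompact.image hb).isBounded.exists_norm_le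
    obtain ⟨Ca, hCa0, hCa⟩ := exists_norm_recipPow_sub_le hyi 2 Ra
    obtain ⟨Cb, hCb0, hCb⟩ := exists_norm_recipPow_sub_le hyj 2 Rb
    have hM0 : 0 ≤ M := (norm_nonneg _).trans (hM 0)
    refine ⟨M * Ca * Cb, by positivity, fun t x => ?_⟩
    by_cases hx : θ x = 0
    · simp only [g, hx, Complex.ofReal_zero, zero_mul, norm_zero]
      exact mul_nonneg (by positivity) (Finset.prod_nonneg fun l _ => hB0 _)
    · have h1 : ∏ l, B (x l) = 1 := Finset.prod_eq_one fun l _ =>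
        Set.indicator_of_mem (Set.mem_Icc.2 (abs_le.1 (hA x hx l))) _
      have h2 := hCa (a x) (t i) (hRa _ ⟨x, subset_tsupport _ hx, rfl⟩)
      have h3 := hCb (b x) (t j) (hRb _ ⟨x, subset_tsupport _ hx, rfl⟩)
      have h4 : ‖recipPow 2 (-yj) (t j - b x)‖ = ‖recipPow 2 yj (t j - b x)‖ := by
        rw [norm_recipPow_two, norm_recipPow_two, neg_sq]
      rw [norm_recipPow_two 1, one_pow, add_comm] at h2 h3
      simp only [g, norm_mul, Complex.norm_real, h1, mul_one, h4]
      calc ‖θ x‖ * (‖recipPow 2 yi (t i - a x)‖ * ‖recipPow 2 yj (t j - b x)‖)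
          ≤ M * ((Ca * (1 + t i ^ 2)⁻¹) * (Cb * (1 + t j ^ 2)⁻¹)) := by
            gcongr
            exact hM x
        _ = _ := by ring
  have hP0 : ∀ (ε : ℝ) (_ : 0 < ε) (t : EuclideanSpace ℝ (Fin n))
      (x : ({i, j}ᶜ : Finset (Fin n)) → ℝ),
      0 ≤ ∏ l : ({i, j}ᶜ : Finset (Fin n)), ε / ((t l - x l) ^ 2 + ε ^ 2) :=
    fun ε hε t x => Finset.prod_nonneg fun l _ => by positivity
  -- integrability on the product, for Fubini's theorem
  have hprod : ∀ ε : ℝ, 0 < ε → ε ≤ 1 → Integrable (Function.uncurry fun t x => g t x *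
      ((∏ l : ({i, j}ᶜ : Finset (Fin n)), ε / ((t l - x l) ^ 2 + ε ^ 2) : ℝ) : ℂ))
      (μ.prod volume) := by
    intro ε hε hε1
    set Cε := 2 * (1 + A ^ 2) * (1 + ε⁻¹)
    have hCε : 0 ≤ Cε := by positivity
    have hbox : Integrable fun x : ({i, j}ᶜ : Finset (Fin n)) → ℝ => ∏ l, B (x l) :=
      Integrable.fintype_prod fun _ =>
        (integrable_indicator_iff measurableSet_Icc).2 (integrableOn_const (by simp))
    refine Integrable.mono' ((hμ.integrable_growthWeight.mul_prod hbox).const_mul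
      (C * Cε ^ Fintype.card ({i, j}ᶜ : Finset (Fin n)))) ?_ ?_
    · refine Continuous.aestronglyMeasurable (hgc.mul (Complex.continuous_ofReal.comp ?_))
      refine continuous_finsetProd _ fun l _ => Continuous.div (by fun_prop) (by fun_prop) ?_
      intro p
      positivity
    · refine Eventually.of_forall fun p => ?_
      obtain ⟨t, x⟩ := p
      simp only [Function.uncurry_apply_pair]
      rw [norm_mul, Complex.norm_real, Real.norm_of_nonneg (hP0 ε hε t x), growthWeight_eq hij]
      have h1 : (∏ l, B (x l)) *
          ∏ l : ({i, j}ᶜ : Finset (Fin n)), ε / ((t l - x l) ^ 2 + ε ^ 2) ≤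
          Cε ^ Fintype.card ({i, j}ᶜ : Finset (Fin n)) *
            (∏ l : ({i, j}ᶜ : Finset (Fin n)), (1 + t l ^ 2)⁻¹) * ∏ l, B (x l) := by
        rw [← Finset.card_univ, ← Finset.prod_const, ← Finset.prod_mul_distrib,
          ← Finset.prod_mul_distrib, ← Finset.prod_mul_distrib]
        refine Finset.prod_le_prod (fun l _ => mul_nonneg (hB0 _) (by positivity)) fun l _ => ?_
        by_cases hl : x l ∈ Set.Icc (-A) A
        · simp only [B, Set.indicator_of_mem hl, one_mul, mul_one]
          refine (poissonKernel_mul_one_add_sq_le hε hε1 (abs_le.2 hl) (t l)).trans ?_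
          simp only [Cε]
          gcongr
          rw [div_le_iff₀ (by positivity)]
          have : ε⁻¹ * ε = 1 := inv_mul_cancel₀ hε.ne'
          have : ε⁻¹ * ε ^ 2 = ε := by field_simp
          have : 0 ≤ ε⁻¹ * (t l - x l) ^ 2 := by positivity
          linarith
        · simp [B, Set.indicator_of_notMem hl]
      calc ‖g t x‖ * ∏ l : ({i, j}ᶜ : Finset (Fin n)), ε / ((t l - x l) ^ 2 + ε ^ 2)
          ≤ C * ((1 + t i ^ 2)⁻¹ * (1 + t j ^ 2)⁻¹) * (∏ l, B (x l)) *
            ∏ l : ({i, j}ᶜ : Finset (Fin n)), ε / ((t l - x l) ^ 2 + ε ^ 2) :=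
            mul_le_mul_of_nonneg_right (hC t x) (hP0 ε hε t x)
        _ = C * ((1 + t i ^ 2)⁻¹ * (1 + t j ^ 2)⁻¹) * ((∏ l, B (x l)) *
            ∏ l : ({i, j}ᶜ : Finset (Fin n)), ε / ((t l - x l) ^ 2 + ε ^ 2)) := by ring
        _ ≤ C * ((1 + t i ^ 2)⁻¹ * (1 + t j ^ 2)⁻¹) *
            (Cε ^ Fintype.card ({i, j}ᶜ : Finset (Fin n)) *
            (∏ l : ({i, j}ᶜ : Finset (Fin n)), (1 + t l ^ 2)⁻¹) * ∏ l, B (x l)) :=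
            mul_le_mul_of_nonneg_left h1 (by positivity)
        _ = _ := by ring
  set J : ℝ → EuclideanSpace ℝ (Fin n) → ℂ := fun ε t => ∫ x, g t x *
      ((∏ l : ({i, j}ᶜ : Finset (Fin n)), ε / ((t l - x l) ^ 2 + ε ^ 2) : ℝ) : ℂ)
  have hJ0 : ∀ ε : ℝ, 0 < ε → ε ≤ 1 → ∫ t, J ε t ∂μ = 0 := by
    intro ε hε hε1
    simp only [J]
    rw [integral_integral_swap (hprod ε hε hε1)]
    refine integral_eq_zero_of_ae (Eventually.of_forall fun x => ?_)
    simp only [g, mul_assoc, Pi.zero_apply]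
    rw [integral_const_mul]
    have := hμ.integral_poissonKernel_eq_zero hij hyi hyj hε (a x) (b x) x
    simp only [mul_assoc] at this
    rw [this, mul_zero]
  set C' := C * (2 * (1 + A ^ 2) * (2 * A + Real.pi)) ^ Fintype.card ({i, j}ᶜ : Finset (Fin n))
  have hJle : ∀ ε : ℝ, 0 < ε → ε ≤ 1 → ∀ t, ‖J ε t‖ ≤ C' * growthWeight t := by
    intro ε hε hε1 t
    have hi : ∀ l : ({i, j}ᶜ : Finset (Fin n)),
        Integrable fun x : ℝ => B x * (ε / ((t l - x) ^ 2 + ε ^ 2)) := by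
      intro l
      have := (integrable_poissonKernel_sub hε (t l)).indicator (measurableSet_Icc (a := -A) (b := A))
      refine this.congr (Eventually.of_forall fun x => ?_)
      by_cases hx : x ∈ Set.Icc (-A) A <;> simp [B, hx]
    have h1 : ∀ l : ({i, j}ᶜ : Finset (Fin n)), ∫ x : ℝ, B x * (ε / ((t l - x) ^ 2 + ε ^ 2))
        ≤ 2 * (1 + A ^ 2) * (2 * A + Real.pi) * (1 + t l ^ 2)⁻¹ := by
      intro l
      refine le_trans (le_of_eq ?_) (setIntegral_poissonKernel_le hε hε1 hA0 (t l))
      rw [← integral_indicator measurableSet_Icc]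
      refine integral_congr_ae (Eventually.of_forall fun x => ?_)
      by_cases hx : x ∈ Set.Icc (-A) A <;> simp [B, hx]
    calc ‖J ε t‖ ≤ ∫ x : ({i, j}ᶜ : Finset (Fin n)) → ℝ,
          C * ((1 + t i ^ 2)⁻¹ * (1 + t j ^ 2)⁻¹) *
            ∏ l, (B (x l) * (ε / ((t l - x l) ^ 2 + ε ^ 2))) := by
          refine norm_integral_le_of_norm_le ((Integrable.fintype_prod hi).const_mul _)
            (Eventually.of_forall fun x => ?_)
          rw [norm_mul, Complex.norm_real, Real.norm_of_nonneg (hP0 ε hε t x),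
            Finset.prod_mul_distrib, ← mul_assoc]
          exact mul_le_mul_of_nonneg_right (hC t x) (hP0 ε hε t x)
      _ = C * ((1 + t i ^ 2)⁻¹ * (1 + t j ^ 2)⁻¹) * ∏ l : ({i, j}ᶜ : Finset (Fin n)),
            ∫ x : ℝ, B x * (ε / ((t l - x) ^ 2 + ε ^ 2)) := by
          rw [integral_const_mul, integral_fintype_prod_volume_eq_prod
            (fun (l : ({i, j}ᶜ : Finset (Fin n))) (x : ℝ) => B x * (ε / ((t l - x) ^ 2 + ε ^ 2)))]
      _ ≤ C * ((1 + t i ^ 2)⁻¹ * (1 + t j ^ 2)⁻¹) * ∏ l : ({i, j}ᶜ : Finset (Fin n)),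
            (2 * (1 + A ^ 2) * (2 * A + Real.pi) * (1 + t l ^ 2)⁻¹) := by
          refine mul_le_mul_of_nonneg_left (Finset.prod_le_prod (fun l _ => ?_) fun l _ => h1 l)
            (by positivity)
          exact integral_nonneg fun x => mul_nonneg (hB0 x) (by positivity)
      _ = C' * growthWeight t := by
          rw [Finset.prod_mul_distrib, Finset.prod_const, Finset.card_univ, growthWeight_eq hij]
          ring
  have hres : Continuous fun t : EuclideanSpace ℝ (Fin n) =>
      (fun l : ({i, j}ᶜ : Finset (Fin n)) => t l) := by fun_prop
  have hcont : Continuous fun t : EuclideanSpace ℝ (Fin n) => g t fun l => t l :=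
    hgc.comp (continuous_id.prodMk hres)
  have hlim : ∀ t, Tendsto (fun m : ℕ => J (1 / ((m : ℝ) + 1)) t) atTop
      (𝓝 (g t (fun l => t l) *
        (Real.pi : ℂ) ^ Fintype.card ({i, j}ᶜ : Finset (Fin n)))) := by
    intro t
    refine tendsto_integral_prod_poissonKernel (h := g t)
      (C := C * ((1 + t i ^ 2)⁻¹ * (1 + t j ^ 2)⁻¹))
      (hgc.comp (continuous_const.prodMk continuous_id))
      (fun x => (hC t x).trans ?_) (fun l => t l) (ε := fun m : ℕ => 1 / ((m : ℝ) + 1))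
      (fun m => by positivity) tendsto_one_div_add_atTop_nhds_zero_nat
    refine mul_le_of_le_one_right (by positivity) (Finset.prod_le_one (fun l _ => hB0 _) fun l _ => ?_)
    exact Set.indicator_le_self' (fun _ _ => zero_le_one) _
  have hε : ∀ m : ℕ, 0 < 1 / ((m : ℝ) + 1) := fun m => by positivity
  have hε1 : ∀ m : ℕ, 1 / ((m : ℝ) + 1) ≤ 1 := fun m => by
    rw [div_le_one (by positivity)]
    linarith [(Nat.cast_nonneg m : (0 : ℝ) ≤ m)]
  have hgle : ∀ t, ‖g t (fun l => t l) *
      (Real.pi : ℂ) ^ Fintype.card ({i, j}ᶜ : Finset (Fin n))‖ ≤ C' * growthWeight t := fun t =>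
    le_of_tendsto (hlim t).norm (Eventually.of_forall fun m => hJle _ (hε m) (hε1 m) t)
  have hpi : (Real.pi : ℂ) ^ Fintype.card ({i, j}ᶜ : Finset (Fin n)) ≠ 0 :=
    pow_ne_zero _ (Complex.ofReal_ne_zero.2 Real.pi_ne_zero)
  have hint : Integrable (fun t => g t (fun l => t l) *
      (Real.pi : ℂ) ^ Fintype.card ({i, j}ᶜ : Finset (Fin n))) μ :=
    (hμ.integrable_growthWeight.const_mul C').mono' (hcont.mul continuous_const).aestronglyMeasurable
      (Eventually.of_forall hgle)
  have hconv := tendsto_integral_of_dominated_convergence (μ := μ) (fun t => C' * growthWeight t)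
    (fun m => (hprod _ (hε m) (hε1 m)).integral_prod_left.aestronglyMeasurable)
    (hμ.integrable_growthWeight.const_mul C')
    (fun m => Eventually.of_forall fun t => hJle _ (hε m) (hε1 m) t) (Eventually.of_forall hlim)
  have hz : ∫ t, g t (fun l => t l) *
      (Real.pi : ℂ) ^ Fintype.card ({i, j}ᶜ : Finset (Fin n)) ∂μ = 0 := by
    refine tendsto_nhds_unique hconv (tendsto_const_nhds.congr fun m => ?_)
    exact (hJ0 _ (hε m) (hε1 m)).symm
  rw [integral_mul_const] at hz
  refine ⟨?_, (mul_eq_zero.1 hz).resolve_right hpi⟩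
  exact (integrable_mul_const_iff (isUnit_iff_ne_zero.2 hpi) _).1 hint

end Nevanlinna

/-! ### Nevanlinna measures on hyperplanes -/

section Hyperplane

variable {n : ℕ} {μ : Measure (EuclideanSpace ℝ (Fin n))} {a : Fin n → ℝ} {c : ℝ}

lemma recipPow_mul (j : ℕ) (r y s : ℝ) :
    recipPow j (r * y) (r * s) = ((r : ℂ) ^ j)⁻¹ * recipPow j y s := by
  rw [recipPow, recipPow, ← mul_inv, ← mul_pow]
  push_cast
  ring

lemma sum_eq_pair_add (a : Fin n → ℝ) {i j : Fin n} (hij : i ≠ j) (t : EuclideanSpace ℝ (Fin n)) :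
    ∑ l, a l * t l = a i * t i + a j * t j + ∑ l : ({i, j}ᶜ : Finset (Fin n)), a l * t l := by
  rw [← Finset.sum_add_sum_compl {i, j}, Finset.sum_pair hij,
    Finset.sum_coe_sort ({i, j}ᶜ : Finset (Fin n)) fun l => a l * t l]

/-- A Nevanlinna measure that is carried by a hyperplane whose normal vector has entries of both signs
vanishes: freezing the other variables, the poles in the Nevanlinna kernel can be chosen so that on
the hyperplane the kernel is a positive multiple of `|t_i - I|⁻⁴`. -/
lemma IsNevanlinnaMeasure.eq_zero_of_mixed_sign (hμ : IsNevanlinnaMeasure μ)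
    (hM : ∀ᵐ t ∂μ, ∑ l, a l * t l = c) {i j : Fin n} (hi : 0 < a i) (hj : a j < 0) : μ = 0 := by
  have hij : i ≠ j := fun h => by rw [h] at hi; exact lt_asymm hi hj
  set r : (({i, j}ᶜ : Finset (Fin n)) → ℝ) → ℝ := fun q =>
    ∑ l : ({i, j}ᶜ : Finset (Fin n)), a l * q l
  set κ := -(a i / a j)
  have hκ : 0 < κ := neg_pos.2 (div_neg_of_pos_of_neg hi hj)
  have hzero : ∀ N : ℕ, ∀ᵐ t ∂μ, max 0 ((N : ℝ) + 1 -
      ‖fun l : ({i, j}ᶜ : Finset (Fin n)) => t l‖) = 0 := by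
    intro N
    set θ : (({i, j}ᶜ : Finset (Fin n)) → ℝ) → ℝ := fun q => max 0 ((N : ℝ) + 1 - ‖q‖)
    have hθ : Continuous θ := by fun_prop
    have hθc : HasCompactSupport θ :=
      HasCompactSupport.intro (isCompact_closedBall 0 ((N : ℝ) + 1)) fun q hq => by
        rw [mem_closedBall_zero_iff, not_le] at hq
        exact max_eq_left (by linarith)
    obtain ⟨h1, h2⟩ := hμ.integrable_and_integral_eq_zero hij one_pos hκ hθ hθc
      (a := fun _ => 0) (b := fun q => (c - r q) / a j) continuous_const (by fun_prop)
    have e : (fun t : EuclideanSpace ℝ (Fin n) =>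
        (θ (fun l => t l) : ℂ) * (recipPow 2 1 (t i - 0) *
        recipPow 2 (-κ) (t j - (c - r fun l => t l) / a j))) =ᵐ[μ] fun t =>
        ((θ (fun l => t l) * ((κ ^ 2)⁻¹ * ((1 + t i ^ 2) ^ 2)⁻¹) : ℝ) : ℂ) := by
      filter_upwards [hM] with t ht
      rw [sum_eq_pair_add a hij] at ht
      have e1 : t j - (c - r fun l => t l) / a j = κ * t i := by
        simp only [r, κ, ← ht]
        field_simp [hj.ne]
        ring
      have e2 : -κ = κ * (-1) := by ring
      have e3 : (recipPow 2 1 (t i)) * recipPow 2 (-1) (t i) = (((1 + t i ^ 2) ^ 2 : ℝ) : ℂ)⁻¹ := by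
        rw [recipPow, recipPow, ← mul_inv, ← mul_pow]
        push_cast
        congr 2
        linear_combination -Complex.I_sq
      rw [e1, e2, recipPow_mul, sub_zero, mul_left_comm (recipPow 2 1 (t i)), e3]
      push_cast
      ring
    rw [integral_congr_ae e, integral_complex_ofReal, Complex.ofReal_eq_zero,
      integral_eq_zero_iff_of_nonneg] at h2
    · filter_upwards [h2] with t ht
      have : (κ ^ 2)⁻¹ * ((1 + t i ^ 2) ^ 2)⁻¹ ≠ 0 := by positivity
      exact (mul_eq_zero.1 ht).resolve_right this
    · intro t
      exact mul_nonneg (le_max_left _ _) (by positivity)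
    · exact (h1.congr e).re.congr (Eventually.of_forall fun t => Complex.ofReal_re _)
  have : ∀ᵐ t ∂μ, False := by
    filter_upwards [ae_all_iff.2 hzero] with t ht
    obtain ⟨N, hN⟩ := exists_nat_ge ‖fun l : ({i, j}ᶜ : Finset (Fin n)) => t l‖
    have := max_eq_left_iff.1 (ht N)
    linarith
  simpa [ae_iff] using this

/-- For `a k ≠ 0`, the direction `e_o - (a_o / a_k) e_k` of the hyperplane `a · x = c`. -/
noncomputable def hyperplaneDir (a : Fin n → ℝ) (k o : Fin n) : EuclideanSpace ℝ (Fin n) :=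
  EuclideanSpace.single o 1 - (a o / a k) • EuclideanSpace.single k 1

lemma hyperplaneDir_apply (a : Fin n → ℝ) (k o l : Fin n) :
    hyperplaneDir a k o l = (if l = o then 1 else 0) - a o / a k * (if l = k then 1 else 0) := by
  simp [hyperplaneDir]

/-- On the hyperplane `a · x = c`, the projection `t - t_o u` along `u = hyperplaneDir a k o` is a
function of the coordinates other than `t_o` and `t_k`; composed with it, a compactly supported
function stays compactly supported. -/
lemma exists_comp_projection {k o : Fin n} (hok : o ≠ k) (hk : a k ≠ 0) (c : ℝ)
    {f : EuclideanSpace ℝ (Fin n) → ℝ} (hf : Continuous f) (hfc : HasCompactSupport f) :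
    ∃ θ : (({o, k}ᶜ : Finset (Fin n)) → ℝ) → ℝ, Continuous θ ∧ HasCompactSupport θ ∧
      ∀ t : EuclideanSpace ℝ (Fin n), ∑ l, a l * t l = c →
        f (t - t o • hyperplaneDir a k o) = θ fun l => t l := by
  set Ψ : (({o, k}ᶜ : Finset (Fin n)) → ℝ) → EuclideanSpace ℝ (Fin n) := fun q =>
    WithLp.toLp 2 fun l => if h : l ∈ ({o, k}ᶜ : Finset (Fin n)) then q ⟨l, h⟩ else
      if l = k then (c - ∑ l : ({o, k}ᶜ : Finset (Fin n)), a l * q l) / a k else 0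
  have hΨ : Continuous Ψ := by
    refine (PiLp.continuous_toLp 2 _).comp (continuous_pi fun l => ?_)
    split_ifs <;> fun_prop
  have hΨl : ∀ q (l : ({o, k}ᶜ : Finset (Fin n))), Ψ q l = q l := by
    intro q l
    change (if h : (l : Fin n) ∈ ({o, k}ᶜ : Finset (Fin n)) then q ⟨l, h⟩ else _) = _
    rw [dif_pos l.2]
  refine ⟨fun q => f (Ψ q), hf.comp hΨ, ?_, fun t ht => ?_⟩
  · obtain ⟨R, hR⟩ := hfc.isCompact.isBounded.exists_norm_le
    refine HasCompactSupport.intro (isCompact_closedBall 0 (max R 0)) fun q hq => ?_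
    by_contra hne
    apply hq
    rw [mem_closedBall_zero_iff, pi_norm_le_iff_of_nonneg (le_max_right _ _)]
    intro l
    rw [← hΨl q l]
    exact (PiLp.norm_apply_le _ _).trans ((hR _ (subset_tsupport _ hne)).trans (le_max_left _ _))
  · congr 1
    rw [sum_eq_pair_add a hok] at ht
    ext l
    change t l - t o * hyperplaneDir a k o l = if h : l ∈ ({o, k}ᶜ : Finset (Fin n)) then t l else
      if l = k then (c - ∑ l : ({o, k}ᶜ : Finset (Fin n)), a l * t l) / a k else 0
    rw [hyperplaneDir_apply]
    rcases eq_or_ne l o with rfl | hlo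
    · simp [hok]
    rcases eq_or_ne l k with rfl | hlk
    · have : l ∉ ({o, l}ᶜ : Finset (Fin n)) := by simp
      rw [dif_neg this, if_neg hlo, if_pos rfl, if_pos rfl, ← ht]
      field_simp
      ring
    · have : l ∈ ({o, k}ᶜ : Finset (Fin n)) := by simp [hlo, hlk]
      rw [dif_pos this, if_neg hlo, if_neg hlk]
      ring

/-- The distributional derivatives of a Nevanlinna measure carried by a hyperplane with nonnegative
normal vector: the third derivative in the direction `hyperplaneDir a k o` vanishes if `a o > 0`, and
the first one vanishes if `a o = 0`. -/
lemma IsNevanlinnaMeasure.integral_dirDeriv_eq_zero (hμ : IsNevanlinnaMeasure μ)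
    (hM : ∀ᵐ t ∂μ, ∑ l, a l * t l = c) {k o : Fin n} (hok : o ≠ k) (hk : 0 < a k)
    {f : EuclideanSpace ℝ (Fin n) → ℝ} (hf : ContDiff ℝ ∞ f) (hcf : HasCompactSupport f) :
    (0 < a o → ∫ t, (dirDeriv (hyperplaneDir a k o))^[3] f t ∂μ = 0) ∧
    (a o = 0 → ∫ t, dirDeriv (hyperplaneDir a k o) f t ∂μ = 0) := by
  have : IsFiniteMeasureOnCompacts μ := isFiniteMeasureOnCompacts_of_growth hμ.integrable_growthWeight
  set u := hyperplaneDir a k o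
  set r : (({o, k}ᶜ : Finset (Fin n)) → ℝ) → ℝ := fun q =>
    ∑ l : ({o, k}ᶜ : Finset (Fin n)), a l * q l
  set L : EuclideanSpace ℝ (Fin n) →L[ℝ] ℝ := EuclideanSpace.proj o
  have hL : ∀ t, L t = t o := fun t => rfl
  have hLu : L u = 1 := by rw [hL, hyperplaneDir_apply]; simp [hok]
  have hsolve : ∀ t : EuclideanSpace ℝ (Fin n), ∑ l, a l * t l = c →
      t k = (c - r fun l => t l) / a k - a o / a k * t o := by
    intro t ht
    rw [sum_eq_pair_add a hok] at ht
    simp only [r, ← ht]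
    field_simp
    ring
  -- a kernel in `t o` is annihilated as soon as it is a kernel of the Nevanlinna condition on the
  -- hyperplane
  have key : ∀ (j : ℕ), (∀ ξ y : ℝ, 0 < y → ∃ (C : ℂ) (y' : ℝ)
        (b : (({o, k}ᶜ : Finset (Fin n)) → ℝ) → ℝ), 0 < y' ∧ Continuous b ∧
        ∀ t : EuclideanSpace ℝ (Fin n), ∑ l, a l * t l = c → recipPow (j + 1) y (t o - ξ)
          = C * (recipPow 2 y (t o - ξ) * recipPow 2 (-y') (t k - b fun l => t l))) →
      ∫ t, (dirDeriv u)^[j] f t ∂μ = 0 := by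
    intro j hj
    have main : ∀ f : EuclideanSpace ℝ (Fin n) → ℝ, Continuous f → HasCompactSupport f →
        ∀ ξ y : ℝ, 0 < y →
        Integrable (fun t => (f (t - L t • u) : ℂ) * recipPow (j + 1) y (L t - ξ)) μ ∧
        ∫ t, (f (t - L t • u) : ℂ) * recipPow (j + 1) y (L t - ξ) ∂μ = 0 := by
      intro f hf hfc ξ y hy
      obtain ⟨C, y', b, hy', hb, hC⟩ := hj ξ y hy
      obtain ⟨θ, hθ, hθc, hθf⟩ := exists_comp_projection hok hk.ne' c hf hfc
      obtain ⟨h1, h2⟩ := hμ.integrable_and_integral_eq_zero hok hy hy' hθ hθc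
        (a := fun _ => ξ) (b := b) continuous_const hb
      have e : (fun t => C * ((θ (fun l => t l) : ℂ) * (recipPow 2 y (t o - ξ) *
          recipPow 2 (-y') (t k - b fun l => t l)))) =ᵐ[μ]
          fun t => (f (t - L t • u) : ℂ) * recipPow (j + 1) y (L t - ξ) := by
        filter_upwards [hM] with t ht
        rw [hL, hθf t ht, hC t ht]
        ring
      refine ⟨(h1.const_mul C).congr e, ?_⟩
      rw [← integral_congr_ae e, integral_const_mul, h2, mul_zero]
    exact integral_iterate_dirDeriv_eq_zero hLu j (fun f hf hfc ξ y hy => (main f hf hfc ξ y hy).1)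
      (fun f hf hfc ξ y hy => (main f hf hfc ξ y hy).2) hf hcf
  refine ⟨fun ho => key 3 fun ξ y hy => ?_, fun ho => key 1 fun ξ y hy => ?_⟩
  · -- the pole in `t k` is chosen so that the second factor is proportional to the first one
    set κ := a o / a k
    have hκ : 0 < κ := div_pos ho hk
    refine ⟨(κ : ℂ) ^ 2, κ * y, fun q => (c - r q) / a k - κ * ξ, by positivity, by fun_prop,
      fun t ht => ?_⟩
    have e1 : t k - ((c - r fun l => t l) / a k - κ * ξ) = -κ * (t o - ξ) := by
      rw [hsolve t ht]; ring
    have hκ' : (κ : ℂ) ≠ 0 := Complex.ofReal_ne_zero.2 hκ.ne'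
    rw [e1, show -(κ * y) = -κ * y by ring, recipPow_mul]
    push_cast
    simp only [recipPow]
    field_simp
  · -- `t k` is a function of the frozen variables, so the second factor can be made constant
    refine ⟨-1, 1, fun q => (c - r q) / a k, one_pos, by fun_prop, fun t ht => ?_⟩
    have e1 : t k - (c - r fun l => t l) / a k = 0 := by
      rw [hsolve t ht, ho]; ring
    rw [e1]
    simp [recipPow]

end Hyperplane

/-! ### Mollifications are quadratic polynomials -/

section Polynomial

variable {n : ℕ} {a : Fin n → ℝ}

/-- Restricted to a line, a polynomial of total degree at most `2` is a quadratic polynomial. -/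
lemma MvPolynomial.exists_eval_line {σ : Type*} {p : MvPolynomial σ ℝ} (hp : p.totalDegree ≤ 2)
    (x v : σ → ℝ) : ∃ a b c : ℝ, ∀ s : ℝ,
      MvPolynomial.eval (fun j => x j + s * v j) p = a + b * s + c * s ^ 2 := by
  set q : Polynomial ℝ := MvPolynomial.aeval (fun j => Polynomial.C (x j) +
    Polynomial.C (v j) * Polynomial.X) p
  have hq : q.natDegree < 3 := by
    refine Nat.lt_succ_of_le ?_
    have := MvPolynomial.aeval_natDegree_le p hp (fun j => Polynomial.C (x j) +
      Polynomial.C (v j) * Polynomial.X) (n := 1) (fun j => by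
        refine (Polynomial.natDegree_add_le _ _).trans (max_le (by simp) ?_)
        exact (Polynomial.natDegree_C_mul_le _ _).trans Polynomial.natDegree_X_le)
    simpa using this
  refine ⟨q.coeff 0, q.coeff 1, q.coeff 2, fun s => ?_⟩
  have h1 : MvPolynomial.eval (fun j => x j + s * v j) p = q.eval s := by
    have := MvPolynomial.comp_aeval_apply (fun j => Polynomial.C (x j) +
      Polynomial.C (v j) * Polynomial.X) (Polynomial.aeval s) p
    rw [← Polynomial.coe_aeval_eq_eval]
    simp only [q]
    rw [this, ← MvPolynomial.coe_aeval_eq_eval]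
    simp only [map_add, map_mul, Polynomial.aeval_C, Polynomial.aeval_X, Algebra.algebraMap_self,
      RingHom.id_apply, mul_comm s]
    rfl
  rw [h1, Polynomial.eval_eq_sum_range' hq]
  simp [Finset.sum_range_succ]

lemma continuous_eval_euclidean (p : MvPolynomial (Fin n) ℝ) :
    Continuous fun x : EuclideanSpace ℝ (Fin n) => MvPolynomial.eval (fun j => x j) p :=
  (MvPolynomial.continuous_eval p).comp (by fun_prop)

/-- The polynomials of degree at most `2` in the variables `X j` with `0 < a j`. -/
noncomputable def quadraticPolynomials (a : Fin n → ℝ) : Submodule ℝ (MvPolynomial (Fin n) ℝ) :=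
  MvPolynomial.restrictTotalDegree (Fin n) ℝ 2 ⊓
    (MvPolynomial.supported ℝ {j | 0 < a j}).toSubmodule

lemma mem_quadraticPolynomials {p : MvPolynomial (Fin n) ℝ} :
    p ∈ quadraticPolynomials a ↔ p.totalDegree ≤ 2 ∧ ∀ j ∈ p.vars, 0 < a j := by
  rw [quadraticPolynomials, Submodule.mem_inf, MvPolynomial.mem_restrictTotalDegree,
    Subalgebra.mem_toSubmodule, MvPolynomial.mem_supported]
  rfl

/-- A quadratic expression in the coordinates `a l * (x l - x₀ l)`, where `0 < a l`, is the value of a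
polynomial. -/
lemma exists_mem_quadraticPolynomials (a : Fin n → ℝ) (x₀ : EuclideanSpace ℝ (Fin n)) (c : ℝ)
    (d : {l // 0 < a l} → ℝ) (m : {l // 0 < a l} → {l // 0 < a l} → ℝ) :
    ∃ p ∈ quadraticPolynomials a, ∀ x : EuclideanSpace ℝ (Fin n),
      MvPolynomial.eval (fun j => x j) p = c + ∑ l, d l * (a l * (x l - x₀ l))
        + ∑ l, ∑ l', m l l' * (a l * (x l - x₀ l) * (a l' * (x l' - x₀ l'))) := by
  set Y : {l // 0 < a l} → MvPolynomial (Fin n) ℝ := fun l =>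
    MvPolynomial.C (a l) * (MvPolynomial.X (l : Fin n) - MvPolynomial.C (x₀ l))
  have hYd : ∀ l, (Y l).totalDegree ≤ 1 := by
    intro l
    refine (MvPolynomial.totalDegree_mul _ _).trans ?_
    rw [MvPolynomial.totalDegree_C, zero_add]
    refine (MvPolynomial.totalDegree_sub _ _).trans (max_le ?_ ?_) <;> simp
  have hYs : ∀ l, Y l ∈ MvPolynomial.supported ℝ {j | 0 < a j} := by
    intro l
    refine mul_mem (Subalgebra.algebraMap_mem _ _) (sub_mem ?_ (Subalgebra.algebraMap_mem _ _))
    exact MvPolynomial.X_mem_supported.2 l.2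
  refine ⟨MvPolynomial.C c + ∑ l, MvPolynomial.C (d l) * Y l
    + ∑ l, ∑ l', MvPolynomial.C (m l l') * (Y l * Y l'), ⟨?_, ?_⟩, fun x => ?_⟩
  · refine add_mem (add_mem ?_ (sum_mem fun l _ => ?_)) (sum_mem fun l _ => sum_mem fun l' _ => ?_)
      <;> refine (MvPolynomial.mem_restrictTotalDegree _ _ _).2 ?_
    · simp
    · refine (MvPolynomial.totalDegree_mul _ _).trans ?_
      rw [MvPolynomial.totalDegree_C, zero_add]
      exact (hYd l).trans one_le_two
    · refine (MvPolynomial.totalDegree_mul _ _).trans ?_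
      rw [MvPolynomial.totalDegree_C, zero_add]
      exact (MvPolynomial.totalDegree_mul _ _).trans (Nat.add_le_add (hYd l) (hYd l'))
  · refine (Subalgebra.mem_toSubmodule (MvPolynomial.supported ℝ {j | 0 < a j})).2 ?_
    refine add_mem (add_mem ?_ (sum_mem fun l _ => ?_)) (sum_mem fun l _ => sum_mem fun l' _ => ?_)
    · exact Subalgebra.algebraMap_mem _ _
    · exact mul_mem (Subalgebra.algebraMap_mem _ _) (hYs l)
    · exact mul_mem (Subalgebra.algebraMap_mem _ _) (mul_mem (hYs l) (hYs l'))
  · simp [Y, map_sum]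

end Polynomial

section Mollification

variable {n : ℕ} {μ : Measure (EuclideanSpace ℝ (Fin n))} {a : Fin n → ℝ} {c : ℝ}

lemma hyperplaneDir_smul_eq (a : Fin n → ℝ) {i : Fin n} (hi : a i ≠ 0) (j : Fin n) :
    (a i)⁻¹ • EuclideanSpace.single i (1 : ℝ) - (a j)⁻¹ • EuclideanSpace.single j (1 : ℝ)
      = (a i)⁻¹ • hyperplaneDir a j i := by
  rw [hyperplaneDir, smul_sub, smul_smul, div_eq_mul_inv, ← mul_assoc, inv_mul_cancel₀ hi, one_mul]

/-- For a Nevanlinna measure carried by a hyperplane with nonnegative normal vector `a`, the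
mollifications are polynomials of degree at most `2` on the hyperplane, in the variables for which the
entry of `a` is positive. -/
lemma IsNevanlinnaMeasure.exists_mollification_eq_eval (hμ : IsNevanlinnaMeasure μ)
    (ha : ∀ l, 0 ≤ a l) {k : Fin n} (hk : 0 < a k) (hM : ∀ᵐ t ∂μ, ∑ l, a l * t l = c)
    {f : EuclideanSpace ℝ (Fin n) → ℝ} (hf : ContDiff ℝ ∞ f) (hcf : HasCompactSupport f)
    (hf0 : ∀ x, 0 ≤ f x) {x₀ : EuclideanSpace ℝ (Fin n)} (hx₀ : ∑ l, a l * x₀ l = c) :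
    ∃ p ∈ quadraticPolynomials a, ∀ x : EuclideanSpace ℝ (Fin n), ∑ l, a l * x l = c →
      ∫ t, f (t - x) ∂μ = MvPolynomial.eval (fun j => x j) p := by
  have : IsFiniteMeasureOnCompacts μ := isFiniteMeasureOnCompacts_of_growth hμ.integrable_growthWeight
  set F : EuclideanSpace ℝ (Fin n) → ℝ := fun x => ∫ t, f (t - x) ∂μ
  have hF0 : ∀ x, 0 ≤ F x := fun x => integral_nonneg fun t => hf0 _
  have htrans : ∀ b, ContDiff ℝ ∞ (fun y => f (y + b)) ∧ HasCompactSupport (fun y => f (y + b)) :=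
    fun b => ⟨hf.comp (contDiff_id.add contDiff_const),
      hcf.comp_homeomorph (Homeomorph.addRight b)⟩
  have hquad : ∀ i j, i ≠ j → 0 < a i → 0 < a j → QuadraticAlong F (hyperplaneDir a j i) := by
    intro i j hij hi hj
    refine integral_translate_quadratic hf hcf _ fun b => ?_
    have := (hμ.integral_dirDeriv_eq_zero hM hij hj (htrans (-b)).1 (htrans (-b)).2).1 hi
    rw [iterate_dirDeriv_comp_add] at this
    simpa only [sub_eq_add_neg] using this
  have hinv : ∀ o, a o = 0 → ∀ (s : ℝ) x, F (x + s • EuclideanSpace.single o 1) = F x := by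
    intro o ho s x
    have hok : o ≠ k := fun h => by rw [h] at ho; exact hk.ne' ho
    have hdir : hyperplaneDir a k o = EuclideanSpace.single o 1 := by simp [hyperplaneDir, ho]
    refine integral_translate_const hf hcf _ (fun b => ?_) x s
    have := (hμ.integral_dirDeriv_eq_zero hM hok hk (htrans (-b)).1 (htrans (-b)).2).2 ho
    rw [hdir] at this
    simpa only [sub_eq_add_neg, dirDeriv_comp_add] using this
  have hq : ∀ i j : {l // 0 < a l}, QuadraticAlong F
      ((a i)⁻¹ • EuclideanSpace.single (i : Fin n) (1 : ℝ)
        - (a j)⁻¹ • EuclideanSpace.single (j : Fin n) (1 : ℝ)) := by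
    intro i j
    rcases eq_or_ne i j with rfl | hij
    · rw [sub_self]; exact quadraticAlong_zero F
    · rw [hyperplaneDir_smul_eq a i.2.ne']
      exact (hquad i j (fun h => hij (Subtype.ext h)) i.2 j.2).smul _
  obtain ⟨c₀, d, m, h⟩ := exists_quadratic_of_nonneg hF0 hq ⟨k, hk⟩ x₀
  obtain ⟨p, hp, hpe⟩ := exists_mem_quadraticPolynomials a x₀ c₀ d m
  refine ⟨p, hp, fun x hx => ?_⟩
  rw [hpe x, ← h fun l => a l * (x l - x₀ l)]
  change F x = _
  have hinv' : ∀ (T : Finset (Fin n)), (∀ l ∈ T, a l = 0) → ∀ (s : Fin n → ℝ) y,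
      F (y + ∑ l ∈ T, s l • EuclideanSpace.single l (1 : ℝ)) = F y := by
    intro T
    induction T using Finset.induction_on with
    | empty => simp
    | insert o T ho ih =>
      intro hT s y
      rw [Finset.sum_insert ho, ← add_assoc, ih (fun l hl => hT l (Finset.mem_insert_of_mem hl)),
        hinv o (hT o (Finset.mem_insert_self _ _))]
  refine Eq.trans ?_ (hinv' (Finset.univ.filter fun l => ¬ 0 < a l)
    (fun l hl => le_antisymm (not_lt.1 (Finset.mem_filter.1 hl).2) (ha l)) (fun l => x l - x₀ l) _)
  congr 1
  have h1 : ∑ l : {l // 0 < a l}, (a l * (x l - x₀ l)) •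
      ((a l)⁻¹ • EuclideanSpace.single (l : Fin n) (1 : ℝ)
        - (a k)⁻¹ • EuclideanSpace.single k (1 : ℝ))
      = ∑ l : {l // 0 < a l}, (x l - x₀ l) • EuclideanSpace.single (l : Fin n) (1 : ℝ) := by
    have hs : ∑ l : {l // 0 < a l}, a l * (x l - x₀ l) = 0 := by
      have e : ∑ l, a l * (x l - x₀ l) = 0 := by
        simp only [mul_sub, Finset.sum_sub_distrib, hx, hx₀, sub_self]
      have e' : ∑ l with ¬ 0 < a l, a l * (x l - x₀ l) = 0 := by
        refine Finset.sum_eq_zero fun l hl => ?_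
        rw [le_antisymm (not_lt.1 (Finset.mem_filter.1 hl).2) (ha l), zero_mul]
      rw [← Finset.sum_filter_add_sum_filter_not Finset.univ (fun l => 0 < a l), e', add_zero] at e
      refine Eq.trans ?_ e
      exact (Finset.sum_subtype (Finset.univ.filter fun l => 0 < a l) (p := fun l => 0 < a l)
        (by simp) fun l => a l * (x l - x₀ l)).symm
    simp only [smul_sub, Finset.sum_sub_distrib]
    rw [← Finset.sum_smul, hs, zero_smul, sub_zero]
    refine Finset.sum_congr rfl fun l _ => ?_
    rw [smul_smul]
    congr 1
    have := l.2.ne'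
    field_simp
  rw [h1, add_assoc, ← Finset.sum_subtype (Finset.univ.filter fun l => 0 < a l)
    (p := fun l => 0 < a l) (by simp) fun l => (x l - x₀ l) • EuclideanSpace.single l (1 : ℝ),
    Finset.sum_filter_add_sum_filter_not]
  ext l
  simp [Pi.single_apply]

end Mollification

/-! ### The polynomial density -/

section Duality

/-- Combining an even weight with its dilate by the factor `2` cancels the second moments: the
resulting functional is a multiple of evaluation at the origin on functions that are quadratic along
all lines through the origin. -/
lemma integral_richardson {V : Type*} [NormedAddCommGroup V] [NormedSpace ℝ V]
    [FiniteDimensional ℝ V] [MeasurableSpace V] [BorelSpace V] (ν : Measure V) [ν.IsAddHaarMeasure]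
    {β q : V → ℝ} (hβ : Continuous β) (hβc : HasCompactSupport β) (hβe : ∀ v, β (-v) = β v)
    (hq : Continuous q) (hquad : ∀ v, ∃ a b c : ℝ, ∀ s : ℝ, q (s • v) = a + b * s + c * s ^ 2) :
    ∫ v, (4 / 3 * β v - 1 / 3 * ((2 : ℝ) ^ Module.finrank ℝ V)⁻¹ * β ((2 : ℝ)⁻¹ • v)) * q v ∂ν
      = (∫ v, β v ∂ν) * q 0 := by
  have hi : ∀ r : ℝ, Integrable (fun v => β v * q (r • v)) ν := fun r =>
    (hβ.mul (hq.comp (by fun_prop))).integrable_of_hasCompactSupport hβc.mul_right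
  have hi1 : Integrable (fun v => β v * q v) ν := by simpa using hi 1
  have hi2 : Integrable (fun v => β ((2 : ℝ)⁻¹ • v) * q v) ν := by
    have := (integrable_comp_smul_iff ν (fun v => β v * q ((2 : ℝ) • v))
      (inv_ne_zero two_ne_zero)).2 (hi 2)
    simpa [smul_smul] using this
  have e2 : ∫ v, β ((2 : ℝ)⁻¹ • v) * q v ∂ν
      = 2 ^ Module.finrank ℝ V * ∫ v, β v * q ((2 : ℝ) • v) ∂ν := by
    have := Measure.integral_comp_smul ν (fun v => β v * q ((2 : ℝ) • v)) (2 : ℝ)⁻¹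
    simp only [smul_smul, mul_inv_cancel₀ (two_ne_zero (α := ℝ)), one_smul, inv_pow, inv_inv,
      abs_of_pos (by positivity : (0 : ℝ) < 2 ^ Module.finrank ℝ V), smul_eq_mul] at this
    exact this
  have hneg : ∀ r : ℝ, ∫ v, β v * q (r • v) ∂ν = ∫ v, β v * q ((-r) • v) ∂ν := fun r => by
    rw [← integral_neg_eq_self]
    simp [hβe]
  have hpt : ∀ v, 2 / 3 * (β v * q ((1 : ℝ) • v)) + 2 / 3 * (β v * q ((-1 : ℝ) • v))
      - 1 / 6 * (β v * q ((2 : ℝ) • v)) - 1 / 6 * (β v * q ((-2 : ℝ) • v)) = β v * q 0 := by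
    intro v
    obtain ⟨a, b, c, h⟩ := hquad v
    have h0 := h 0
    rw [zero_smul] at h0
    rw [h, h, h, h, h0]
    ring
  have hi12 : Integrable (fun v => 2 / 3 * (β v * q ((1 : ℝ) • v))
      + 2 / 3 * (β v * q ((-1 : ℝ) • v))) ν := ((hi 1).const_mul _).add ((hi (-1)).const_mul _)
  have hi123 : Integrable (fun v => 2 / 3 * (β v * q ((1 : ℝ) • v))
      + 2 / 3 * (β v * q ((-1 : ℝ) • v)) - 1 / 6 * (β v * q ((2 : ℝ) • v))) ν :=
    hi12.sub ((hi 2).const_mul _)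
  have hsum := integral_congr_ae (μ := ν) (Eventually.of_forall hpt)
  rw [integral_sub hi123 ((hi (-2)).const_mul _), integral_sub hi12 ((hi 2).const_mul _),
    integral_add ((hi 1).const_mul _) ((hi (-1)).const_mul _), integral_const_mul,
    integral_const_mul, integral_const_mul, integral_const_mul, integral_mul_const, ← hneg 1,
    ← hneg 2] at hsum
  rw [← hsum]
  have e : ∀ v, (4 / 3 * β v - 1 / 3 * ((2 : ℝ) ^ Module.finrank ℝ V)⁻¹ * β ((2 : ℝ)⁻¹ • v)) * q v
      = 4 / 3 * (β v * q v)
        - 1 / 3 * ((2 : ℝ) ^ Module.finrank ℝ V)⁻¹ * (β ((2 : ℝ)⁻¹ • v) * q v) := fun v => by ring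
  simp_rw [e]
  rw [integral_sub (hi1.const_mul _) (hi2.const_mul _), integral_const_mul, integral_const_mul, e2]
  have h2 : (2 : ℝ) ^ Module.finrank ℝ V ≠ 0 := by positivity
  simp only [one_smul]
  field_simp
  ring

/-- The pairings of mollifications along an affine subspace `x₀ + V` that carries the measure are
symmetric in the mollifier and the test function. -/
lemma integral_mul_integral_translate_comm {E : Type*} [NormedAddCommGroup E] [InnerProductSpace ℝ E]
    [FiniteDimensional ℝ E] [MeasurableSpace E] [BorelSpace E] {μ : Measure E}
    [IsFiniteMeasureOnCompacts μ] (V : Submodule ℝ E) {x₀ : E} (hV : ∀ᵐ t ∂μ, t - x₀ ∈ V)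
    {f g : E → ℝ} (hf : Continuous f) (hfc : HasCompactSupport f) (hg : Continuous g)
    (hgc : HasCompactSupport g) :
    ∫ v : V, g v * ∫ t, f (t - (x₀ + v)) ∂μ = ∫ v : V, f v * ∫ t, g (t - (x₀ + v)) ∂μ := by
  have key : ∀ f g : E → ℝ, Continuous f → HasCompactSupport f → Continuous g →
      HasCompactSupport g → ∫ v : V, g v * ∫ t, f (t - (x₀ + v)) ∂μ
        = ∫ t, ∫ v : V, g v * f (t - (x₀ + v)) ∂volume ∂μ := by
    intro f g hf hfc hg hgc
    simp_rw [← integral_const_mul]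
    refine integral_integral_swap_of_hasCompactSupport (f := fun (v : V) t =>
      g v * f (t - (x₀ + v))) (by simp only [Function.uncurry_def]; fun_prop) ?_
    have hK : IsCompact ((↑) ⁻¹' tsupport g : Set V) :=
      (Submodule.closed_of_finiteDimensional V).isClosedEmbedding_subtypeVal.isCompact_preimage hgc
    refine HasCompactSupport.intro (hK.prod ((hfc.isCompact.add
      ((isCompact_singleton (x := x₀)).add hgc.isCompact)))) fun p hp => ?_
    obtain ⟨v, t⟩ := p
    simp only [Function.uncurry_apply_pair]
    by_contra hne
    have h1 : (v : E) ∈ tsupport g := subset_tsupport _ (left_ne_zero_of_mul hne)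
    have h2 : t - (x₀ + v) ∈ tsupport f := subset_tsupport _ (right_ne_zero_of_mul hne)
    exact hp ⟨h1, Set.mem_add.2 ⟨_, h2, _, Set.mem_add.2 ⟨x₀, rfl, v, h1, rfl⟩, by simp⟩⟩
  rw [key f g hf hfc hg hgc, key g f hg hgc hf hfc]
  refine integral_congr_ae ?_
  filter_upwards [hV] with t ht
  rw [← integral_sub_left_eq_self _ _ (⟨t - x₀, ht⟩ : V)]
  refine integral_congr_ae (Eventually.of_forall fun v => ?_)
  simp only [Submodule.coe_sub]
  rw [mul_comm]
  congr 2 <;> abel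

end Duality

section Density

lemma AffineSubspace.euclideanHausdorffMeasure_restrict {E : Type*} [NormedAddCommGroup E]
    [InnerProductSpace ℝ E] [FiniteDimensional ℝ E] [MeasurableSpace E] [BorelSpace E]
    (M : AffineSubspace ℝ E) {x₀ : E} (hx₀ : x₀ ∈ M) :
    (μHE[Module.finrank ℝ M.direction] : Measure E).restrict M
      = Measure.map (fun v : M.direction => x₀ + v) volume := by
  have hiso : Isometry fun v : M.direction => x₀ + v :=
    (isometry_add_left x₀).comp isometry_subtype_coe
  have hr : Set.range (fun v : M.direction => x₀ + v) = M := by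
    ext x
    constructor
    · rintro ⟨v, rfl⟩
      have := AffineSubspace.vadd_mem_of_mem_direction v.2 hx₀
      simpa [add_comm] using this
    · intro hx
      exact ⟨⟨x - x₀, AffineSubspace.vsub_mem_direction hx hx₀⟩, by simp⟩
  rw [← hr, ← hiso.map_euclideanHausdorffMeasure, InnerProductSpace.euclideanHausdorffMeasure_eq_volume]

/-- A measure whose integrals against nonnegative test functions are those of a continuous function
on an affine subspace has that function as its density, which is therefore nonnegative. -/
lemma AffineSubspace.eq_withDensity_of_integral_eq {E : Type*} [NormedAddCommGroup E]
    [InnerProductSpace ℝ E] [FiniteDimensional ℝ E] [MeasurableSpace E] [BorelSpace E]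
    {μ : Measure E} [IsFiniteMeasureOnCompacts μ] (M : AffineSubspace ℝ E) {x₀ : E} (hx₀ : x₀ ∈ M)
    {P : E → ℝ} (hP : Continuous P)
    (main : ∀ φ : E → ℝ, ContDiff ℝ ∞ φ → HasCompactSupport φ → (∀ x, 0 ≤ φ x) →
      ∫ t, φ t ∂μ = ∫ v : M.direction, φ (x₀ + v) * P (x₀ + v)) :
    (∀ x ∈ M, 0 ≤ P x) ∧ μ = ((μHE[Module.finrank ℝ M.direction] : Measure E).restrict
      (M : Set E)).withDensity fun x => ENNReal.ofReal (P x) := by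
  have hembed : Topology.IsClosedEmbedding fun v : M.direction => x₀ + (v : E) :=
    (Homeomorph.addLeft x₀).isClosedEmbedding.comp
      (Submodule.closed_of_finiteDimensional M.direction).isClosedEmbedding_subtypeVal
  have hh : Continuous fun v : M.direction => x₀ + (v : E) := hembed.continuous
  have hpos : ∀ x ∈ M, 0 ≤ P x := by
    intro x hx
    by_contra! hneg
    -- a bump function supported where `P` is negative
    obtain ⟨r, hr, hball⟩ := Metric.isOpen_iff.1
      (isOpen_lt hP continuous_const : IsOpen {y | P y < 0}) x hneg
    let φ : ContDiffBump x := ⟨r / 2, r, by positivity, by linarith⟩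
    have h1 := main φ φ.contDiff φ.hasCompactSupport fun y => φ.nonneg
    have h2 : 0 ≤ ∫ t, φ t ∂μ := integral_nonneg fun t => φ.nonneg
    let F : M.direction → ℝ := fun v => φ (x₀ + v) * -P (x₀ + v)
    have hFc : Continuous F := (φ.continuous.comp hh).mul (hP.comp hh).neg
    have hFs : HasCompactSupport F :=
      (φ.hasCompactSupport.comp_isClosedEmbedding hembed).mul_right
    have hF0 : 0 ≤ F := by
      intro v
      by_cases hv : x₀ + (v : E) ∈ Metric.ball x r
      · exact mul_nonneg φ.nonneg (neg_nonneg.2 (hball hv).le)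
      · have : φ (x₀ + v) = 0 := by
          by_contra hne
          have : x₀ + (v : E) ∈ Function.support φ := hne
          rw [φ.support_eq] at this
          exact hv this
        simp [F, this]
    have hFx : F ⟨x - x₀, AffineSubspace.vsub_mem_direction hx hx₀⟩ ≠ 0 := by
      have : φ x = 1 := φ.one_of_mem_closedBall (Metric.mem_closedBall_self (by positivity))
      simpa [F, this] using hneg.ne
    have h3 := hFc.integral_pos_of_hasCompactSupport_nonneg_nonzero (μ := volume) hFs hF0 hFx
    have h4 : ∫ v, F v = -∫ t, φ t ∂μ := by
      rw [h1, ← integral_neg]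
      simp [F]
    linarith
  refine ⟨hpos, ?_⟩
  rw [AffineSubspace.euclideanHausdorffMeasure_restrict M hx₀]
  have : IsFiniteMeasureOnCompacts (Measure.map (fun v : M.direction => x₀ + (v : E)) volume) := by
    refine ⟨fun K hK => ?_⟩
    rw [Measure.map_apply hh.measurable hK.measurableSet]
    exact (hembed.isCompact_preimage hK).measure_lt_top
  have : IsLocallyFiniteMeasure ((Measure.map (fun v : M.direction => x₀ + (v : E))
      volume).withDensity fun x => ENNReal.ofReal (P x)) :=
    IsLocallyFiniteMeasure.withDensity_ofReal hP
  refine Measure.ext_of_integral_contDiff _ _ fun φ hφ hφc hφ0 => ?_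
  rw [main φ hφ hφc hφ0, integral_withDensity_eq_integral_toReal_smul
    hP.measurable.ennreal_ofReal (Eventually.of_forall fun _ => ENNReal.ofReal_lt_top),
    integral_map hh.measurable.aemeasurable]
  · refine integral_congr_ae (Eventually.of_forall fun v => ?_)
    have hv : x₀ + (v : E) ∈ M := by
      have := AffineSubspace.vadd_mem_of_mem_direction v.2 hx₀
      simpa [add_comm] using this
    simp only
    rw [ENNReal.toReal_ofReal (hpos _ hv), smul_eq_mul, mul_comm]
  · refine (Continuous.mul ?_ hφ.continuous).aestronglyMeasurable
    simp only [ENNReal.toReal_ofReal']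
    exact hP.max continuous_const

variable {n : ℕ} {μ : Measure (EuclideanSpace ℝ (Fin n))} {a : Fin n → ℝ} {c : ℝ}

/-- A Nevanlinna measure on a hyperplane `a · x = c` with nonnegative normal vector has a polynomial
density. The density is a mollification of `μ`, by a kernel that reproduces quadratic polynomials. -/
lemma IsNevanlinnaMeasure.exists_density (hμ : IsNevanlinnaMeasure μ) (ha : ∀ l, 0 ≤ a l) {k : Fin n}
    (hk : 0 < a k) {M : AffineSubspace ℝ (EuclideanSpace ℝ (Fin n))}
    (hM : (M : Set (EuclideanSpace ℝ (Fin n))) = {x | ∑ l, a l * x l = c})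
    (hμM : μ (M : Set (EuclideanSpace ℝ (Fin n)))ᶜ = 0) :
    ∃ p ∈ quadraticPolynomials a,
      (∀ x ∈ M, 0 ≤ MvPolynomial.eval (fun j => x j) p) ∧
      μ = ((μHE[Module.finrank ℝ M.direction]).restrict
          (M : Set (EuclideanSpace ℝ (Fin n)))).withDensity
        fun x => ENNReal.ofReal (MvPolynomial.eval (fun j => x j) p) := by
  have : IsFiniteMeasureOnCompacts μ := isFiniteMeasureOnCompacts_of_growth hμ.integrable_growthWeight
  have hmem : ∀ x, x ∈ M ↔ ∑ l, a l * x l = c := fun x => by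
    rw [← SetLike.mem_coe, hM]; rfl
  have hae : ∀ᵐ t ∂μ, t ∈ M := by rwa [ae_iff]
  have hae' : ∀ᵐ t ∂μ, ∑ l, a l * t l = c := hae.mono fun t ht => (hmem t).1 ht
  set x₀ : EuclideanSpace ℝ (Fin n) := (c / a k) • EuclideanSpace.single k 1
  have hx₀ : ∑ l, a l * x₀ l = c := by
    simp [x₀]
    field_simp
  have hx₀M : x₀ ∈ M := (hmem x₀).2 hx₀
  have hVM : ∀ v : M.direction, x₀ + v ∈ M := fun v => by
    have := AffineSubspace.vadd_mem_of_mem_direction v.2 hx₀M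
    simpa [add_comm] using this
  have hV : ∀ᵐ t ∂μ, t - x₀ ∈ M.direction :=
    hae.mono fun t ht => AffineSubspace.vsub_mem_direction ht hx₀M
  -- the mollifier `β` and its dilate `β₂`, combined below to a kernel `g` that reproduces quadratic
  -- polynomials up to the factor `I`
  let β : ContDiffBump (0 : EuclideanSpace ℝ (Fin n)) := ⟨1, 2, one_pos, one_lt_two⟩
  have hβ : ContDiff ℝ ∞ β := β.contDiff
  have hβc : HasCompactSupport β := β.hasCompactSupport
  set β₂ : EuclideanSpace ℝ (Fin n) → ℝ := fun x => β ((2 : ℝ)⁻¹ • x)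
  have hβ₂ : ContDiff ℝ ∞ β₂ := hβ.comp (contDiff_const_smul _)
  have hβ₂c : HasCompactSupport β₂ :=
    hβc.comp_homeomorph (Homeomorph.smulOfNeZero (2 : ℝ)⁻¹ (inv_ne_zero two_ne_zero))
  obtain ⟨p₁, hp₁, hp₁e⟩ := hμ.exists_mollification_eq_eval ha hk hae' hβ hβc
    (fun x => β.nonneg) hx₀
  obtain ⟨p₂, hp₂, hp₂e⟩ := hμ.exists_mollification_eq_eval ha hk hae' hβ₂ hβ₂c
    (fun x => β.nonneg) hx₀
  have hembed : Topology.IsClosedEmbedding ((↑) : M.direction → EuclideanSpace ℝ (Fin n)) :=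
    (Submodule.closed_of_finiteDimensional M.direction).isClosedEmbedding_subtypeVal
  set I := ∫ v : M.direction, β v
  have hI : 0 < I := by
    refine Continuous.integral_pos_of_hasCompactSupport_nonneg_nonzero (x := 0)
      (hβ.continuous.comp continuous_subtype_val) (hβc.comp_isClosedEmbedding hembed)
      (fun v => β.nonneg) ?_
    have : β (0 : EuclideanSpace ℝ (Fin n)) = 1 := β.one_of_mem_closedBall (by simp [β])
    simp [this]
  set κ : ℝ := 1 / 3 * ((2 : ℝ) ^ Module.finrank ℝ M.direction)⁻¹
  set g : EuclideanSpace ℝ (Fin n) → ℝ := fun x => 4 / 3 * β x - κ * β₂ x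
  have hgc : Continuous g := (continuous_const.mul hβ.continuous).sub
    (continuous_const.mul hβ₂.continuous)
  have hgs : HasCompactSupport g := hβc.mul_left.sub hβ₂c.mul_left
  set p := I⁻¹ • ((4 / 3 : ℝ) • p₁ - κ • p₂)
  have hp : p ∈ quadraticPolynomials a :=
    Submodule.smul_mem _ _ (sub_mem (Submodule.smul_mem _ _ hp₁) (Submodule.smul_mem _ _ hp₂))
  have hpe : ∀ x ∈ M, ∫ t, g (t - x) ∂μ = I * MvPolynomial.eval (fun j => x j) p := by
    intro x hx
    have h1 := integrable_comp_sub (μ := μ) hβ.continuous hβc x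
    have h2 := integrable_comp_sub (μ := μ) hβ₂.continuous hβ₂c x
    simp only [g]
    rw [integral_sub (h1.const_mul _) (h2.const_mul _), integral_const_mul, integral_const_mul,
      hp₁e x ((hmem x).1 hx), hp₂e x ((hmem x).1 hx)]
    simp only [p, MvPolynomial.smul_eval, map_sub]
    field_simp
  refine ⟨p, hp, AffineSubspace.eq_withDensity_of_integral_eq M hx₀M (continuous_eval_euclidean p) ?_⟩
  -- for the translate `f` of a test function `φ`, the mollification of `μ` by `f` is a polynomial `q`
  -- with `q x₀ = ∫ φ dμ`; integrating it against `g` reproduces this value, and interchanging the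
  -- roles of `f` and `g` gives the integral of `φ` against the mollification `I * p` of `μ` by `g`
  intro φ hφ hφc hφ0
  set f : EuclideanSpace ℝ (Fin n) → ℝ := fun x => φ (x + x₀)
  have hf : ContDiff ℝ ∞ f := hφ.comp (contDiff_id.add contDiff_const)
  have hfc : HasCompactSupport f := hφc.comp_homeomorph (Homeomorph.addRight x₀)
  obtain ⟨q, hq, hqe⟩ := hμ.exists_mollification_eq_eval ha hk hae' hf hfc (fun x => hφ0 _) hx₀
  have h1 := integral_mul_integral_translate_comm M.direction hV hf.continuous hfc hgc hgs
  have h2 : ∀ v : M.direction, ∫ t, f (t - (x₀ + v)) ∂μ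
      = MvPolynomial.eval (fun j => (x₀ + v : EuclideanSpace ℝ (Fin n)) j) q := fun v =>
    hqe _ ((hmem _).1 (hVM v))
  simp_rw [h2, fun v : M.direction => hpe _ (hVM v)] at h1
  have h3 := integral_richardson (volume : Measure M.direction)
    (β := fun v => β (v : EuclideanSpace ℝ (Fin n)))
    (q := fun v => MvPolynomial.eval (fun j => (x₀ + v : EuclideanSpace ℝ (Fin n)) j) q)
    (hβ.continuous.comp continuous_subtype_val) (hβc.comp_isClosedEmbedding hembed)
    (fun v => by simpa using β.neg (v : EuclideanSpace ℝ (Fin n)))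
    ((continuous_eval_euclidean q).comp (by fun_prop))
    (fun v => by
      obtain ⟨a, b, c, h⟩ := MvPolynomial.exists_eval_line (mem_quadraticPolynomials.1 hq).1
        x₀ (v : EuclideanSpace ℝ (Fin n))
      exact ⟨a, b, c, fun s => by rw [← h s]; simp⟩)
  have h4 : ∫ t, φ t ∂μ = MvPolynomial.eval (fun j => x₀ j) q := by
    rw [← hqe x₀ hx₀]
    simp [f]
  change ∫ v : M.direction, g v * _ = I * _ at h3
  rw [h1] at h3
  simp only [ZeroMemClass.coe_zero, add_zero] at h3
  rw [h4]
  refine mul_left_cancel₀ hI.ne' ?_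
  rw [← h3, ← integral_const_mul]
  refine integral_congr_ae (Eventually.of_forall fun v => ?_)
  simp only [f]
  rw [add_comm (v : EuclideanSpace ℝ (Fin n)) x₀]
  ring

end Density

/-! ### Integrals along lines -/

section LineIntegrals

lemma ofReal_sub_ne_zero_of_im {z : ℂ} (hz : z.im ≠ 0) (s : ℝ) : (s : ℂ) - z ≠ 0 := fun h => hz (by
  have := congrArg Complex.im h
  simpa using this)

lemma hasDerivAt_ofReal_sub (z : ℂ) (s : ℝ) : HasDerivAt (fun s : ℝ => (s : ℂ) - z) 1 s :=
  (Complex.ofRealCLM.hasDerivAt (x := s)).sub_const z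

lemma tendsto_inv_ofReal_sub (z : ℂ) {l : Filter ℝ} (hl : l ≤ Bornology.cobounded ℝ) :
    Tendsto (fun s : ℝ => ((s : ℂ) - z)⁻¹) l (𝓝 0) := by
  refine tendsto_inv₀_cobounded.comp ?_
  have h1 : Tendsto (fun s : ℝ => (s : ℂ)) l (Bornology.cobounded ℂ) := by
    rw [← tendsto_norm_atTop_iff_cobounded]
    simp only [Complex.norm_real]
    exact (tendsto_norm_cobounded_atTop (E := ℝ)).mono_left hl
  rw [← tendsto_norm_atTop_iff_cobounded] at h1 ⊢
  refine tendsto_atTop_mono (fun s => ?_) (tendsto_atTop_add_const_right l (-‖z‖) h1)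
  have := norm_sub_norm_le (s : ℂ) z
  simpa [sub_eq_add_neg] using this

/-- A function on the line with an antiderivative that has equal limits at both ends integrates to
zero. -/
lemma integral_eq_zero_of_hasDerivAt {F f : ℝ → ℂ} {L : ℂ} (hF : ∀ s, HasDerivAt F (f s) s)
    (hf : Integrable f) (h : ∀ l ≤ Bornology.cobounded ℝ, Tendsto F l (𝓝 L)) :
    ∫ s, f s = 0 := by
  have hl : Bornology.cobounded ℝ = atBot ⊔ atTop := IsOrderBornology.cobounded_eq
  rw [integral_of_hasDerivAt_of_tendsto hF hf (h _ (hl ▸ le_sup_left)) (h _ (hl ▸ le_sup_right)),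
    sub_self]

lemma hasDerivAt_inv_ofReal_sub {z : ℂ} (hz : z.im ≠ 0) (s : ℝ) :
    HasDerivAt (fun s : ℝ => ((s : ℂ) - z)⁻¹) (-(((s : ℂ) - z)⁻¹ ^ 2)) s := by
  refine ((hasDerivAt_ofReal_sub z s).inv (ofReal_sub_ne_zero_of_im hz s)).congr_deriv ?_
  rw [neg_div, one_div, inv_pow]

lemma integral_mul_inv_ofReal_sub_sq {z : ℂ} (hz : z.im ≠ 0) (k : ℂ)
    (hi : Integrable fun s : ℝ => k * (((s : ℂ) - z) ^ 2)⁻¹) :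
    ∫ s : ℝ, k * (((s : ℂ) - z) ^ 2)⁻¹ = 0 := by
  refine integral_eq_zero_of_hasDerivAt (F := fun s => -k * ((s : ℂ) - z)⁻¹) (L := 0)
    (fun s => ?_) hi fun l hl => by simpa using (tendsto_inv_ofReal_sub z hl).const_mul (-k)
  refine ((hasDerivAt_inv_ofReal_sub hz s).const_mul (-k)).congr_deriv ?_
  rw [inv_pow, neg_mul_neg]

/-- If both double poles of the integrand lie in the upper half plane, there is a rational
antiderivative, up to a multiple of `log ((s - z) / (s - w))`. -/
lemma integral_quadratic_div {z w : ℂ} (hz : 0 < z.im) (hw : 0 < w.im) (a b c : ℂ)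
    (hi : Integrable fun s : ℝ => (a + b * s + c * s ^ 2) *
      ((((s : ℂ) - z) ^ 2)⁻¹ * (((s : ℂ) - w) ^ 2)⁻¹)) :
    ∫ s : ℝ, (a + b * s + c * s ^ 2) * ((((s : ℂ) - z) ^ 2)⁻¹ * (((s : ℂ) - w) ^ 2)⁻¹) = 0 := by
  have hz0 := ofReal_sub_ne_zero_of_im hz.ne'
  have hw0 := ofReal_sub_ne_zero_of_im hw.ne'
  have hzd := hasDerivAt_inv_ofReal_sub hz.ne'
  have hwd := hasDerivAt_inv_ofReal_sub hw.ne'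
  rcases eq_or_ne z w with rfl | hzw
  · -- for a common pole, the numerator is expanded around it
    set B := -(b + 2 * c * z) / 2 with hB
    set A := -(a + b * z + c * z ^ 2) / 3 with hA
    have key : ∀ X s : ℂ, X ≠ 0 → s = X + z → -c * -(X⁻¹ ^ 2) + B * (2 * X⁻¹ * -(X⁻¹ ^ 2))
        + A * (3 * X⁻¹ ^ 2 * -(X⁻¹ ^ 2)) = (a + b * s + c * s ^ 2) * ((X ^ 2)⁻¹ * (X ^ 2)⁻¹) := by
      rintro X s hX rfl
      simp only [hA, hB]
      field_simp
      ring
    refine integral_eq_zero_of_hasDerivAt (L := 0) (F := fun s : ℝ => -c * ((s : ℂ) - z)⁻¹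
      + B * (((s : ℂ) - z)⁻¹) ^ 2 + A * (((s : ℂ) - z)⁻¹) ^ 3) (fun s => ?_) hi fun l hl => ?_
    · refine ((((hzd s).const_mul (-c)).add (((hzd s).fun_pow 2).const_mul B)).add
        (((hzd s).fun_pow 3).const_mul A)).congr_deriv ?_
      rw [← key _ _ (hz0 s) (sub_add_cancel _ _).symm]
      norm_num
    · have h := tendsto_inv_ofReal_sub z hl
      have h2 := h.pow 2
      have h3 := h.pow 3
      rw [zero_pow two_ne_zero] at h2
      rw [zero_pow three_ne_zero] at h3
      have := ((h.const_mul (-c)).add (h2.const_mul B)).add (h3.const_mul A)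
      rwa [mul_zero, mul_zero, mul_zero, add_zero, add_zero] at this
  · have hδ : z - w ≠ 0 := sub_ne_zero.2 hzw
    -- the coefficients of the partial fraction decomposition
    set A := (a + b * z + c * z ^ 2) / (z - w) ^ 2 with hA
    set B := (a + b * w + c * w ^ 2) / (z - w) ^ 2 with hB
    set D := (c - A - B) / (z - w) with hD
    have key : ∀ X Y s : ℂ, X ≠ 0 → Y ≠ 0 → s = X + z → s = Y + w →
        -A * -(X⁻¹ ^ 2) + -B * -(Y⁻¹ ^ 2) + D * ((1 * Y⁻¹ + X * -(Y⁻¹ ^ 2)) / (X * Y⁻¹))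
          = (a + b * s + c * s ^ 2) * ((X ^ 2)⁻¹ * (Y ^ 2)⁻¹) := by
      rintro X Y s hX hY h1 h2
      obtain rfl : X = s - z := by rw [h1]; ring
      obtain rfl : Y = s - w := by rw [h2]; ring
      simp only [hD, hA, hB]
      field_simp
      ring
    -- the quotient is not a nonpositive number, as numerator and denominator have negative imaginary
    -- parts
    have hslit : ∀ s : ℝ, ((s : ℂ) - z) * ((s : ℂ) - w)⁻¹ ∈ Complex.slitPlane := by
      intro s
      rw [Complex.mem_slitPlane_iff_not_le_zero]
      intro hle
      rw [Complex.le_def] at hle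
      set q := ((s : ℂ) - z) * ((s : ℂ) - w)⁻¹
      have hq : (s : ℂ) - z = q * ((s : ℂ) - w) := by simp [q, hw0 s]
      have := congrArg Complex.im hq
      simp only [Complex.sub_im, Complex.ofReal_im, Complex.mul_im, Complex.sub_re,
        Complex.ofReal_re, hle.2, Complex.zero_im, zero_mul, add_zero, zero_sub] at this
      have h1 : q.re ≤ 0 := hle.1
      nlinarith
    refine integral_eq_zero_of_hasDerivAt (L := 0) (F := fun s : ℝ => -A * ((s : ℂ) - z)⁻¹
      + -B * ((s : ℂ) - w)⁻¹ + D * Complex.log (((s : ℂ) - z) * ((s : ℂ) - w)⁻¹)) (fun s => ?_) hi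
      fun l hl => ?_
    · rw [← key _ _ _ (hz0 s) (hw0 s) (sub_add_cancel _ _).symm (sub_add_cancel _ _).symm]
      exact (((hzd s).const_mul (-A)).add ((hwd s).const_mul (-B))).add
        ((((hasDerivAt_ofReal_sub z s).fun_mul (hwd s)).clog_real (hslit s)).const_mul D)
    · have hr : Tendsto (fun s : ℝ => ((s : ℂ) - z) * ((s : ℂ) - w)⁻¹) l (𝓝 1) := by
        have := ((tendsto_inv_ofReal_sub w hl).const_mul (w - z)).const_add 1
        rw [mul_zero, add_zero] at this
        refine this.congr fun s => ?_
        rw [← sub_add_sub_cancel (s : ℂ) w z, add_mul, mul_inv_cancel₀ (hw0 s)]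
      have h3 := (continuousAt_clog Complex.one_mem_slitPlane).tendsto.comp hr
      rw [Complex.log_one] at h3
      have := (((tendsto_inv_ofReal_sub z hl).const_mul (-A)).add
        ((tendsto_inv_ofReal_sub w hl).const_mul (-B))).add (h3.const_mul D)
      rwa [mul_zero, mul_zero, mul_zero, add_zero, add_zero] at this

/-- Fubini's theorem for parallel lines: an integrable function with vanishing integrals along all lines
in the direction of a nonzero vector has integral zero. -/
lemma integral_eq_zero_of_integral_line_eq_zero {V : Type*} [NormedAddCommGroup V] [NormedSpace ℝ V]
    [FiniteDimensional ℝ V] [MeasurableSpace V] [BorelSpace V] (ν : Measure V) [ν.IsAddHaarMeasure]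
    {Φ : V → ℂ} (hΦ : Integrable Φ ν) {u : V} (hu : u ≠ 0)
    (h : ∀ v, Integrable (fun s : ℝ => Φ (v + s • u)) → ∫ s : ℝ, Φ (v + s • u) = 0) :
    ∫ v, Φ v ∂ν = 0 := by
  obtain ⟨W, hW⟩ := Submodule.exists_isCompl (Submodule.span ℝ {u})
  let e : (W × ℝ) ≃L[ℝ] V := (((LinearEquiv.refl ℝ W).prodCongr
    (LinearEquiv.toSpanNonzeroSingleton ℝ V u hu)).trans
      (Submodule.prodEquivOfIsCompl W _ hW.symm)).toContinuousLinearEquiv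
  have he : ∀ x : W × ℝ, e x = x.1 + x.2 • u := fun x => by
    simp [e, LinearEquiv.toSpanNonzeroSingleton]
  let _ : MeasurableSpace W := borel W
  have : BorelSpace W := ⟨rfl⟩
  let ρ : Measure W := Measure.addHaar
  have hmap : ((ρ.prod volume).map e).IsAddHaarMeasure := e.isAddHaarMeasure_map _
  have hν := Measure.isAddLeftInvariant_eq_smul ν ((ρ.prod volume).map e)
  have hν' := Measure.isAddLeftInvariant_eq_smul ((ρ.prod volume).map e) ν
  have hi : Integrable (fun x => Φ (e x)) (ρ.prod volume) := by
    refine (e.toHomeomorph.measurableEmbedding.integrable_map_iff (g := Φ)).1 ?_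
    change Integrable Φ ((ρ.prod volume).map e)
    rw [hν']
    exact hΦ.smul_measure_nnreal
  rw [hν, integral_smul_nnreal_measure]
  have h1 := e.toHomeomorph.measurableEmbedding.integral_map (μ := ρ.prod volume) Φ
  change ∫ v, Φ v ∂((ρ.prod volume).map e) = ∫ x, Φ (e x) ∂(ρ.prod volume) at h1
  rw [h1, integral_prod _ hi, integral_eq_zero_of_ae, smul_zero]
  filter_upwards [hi.prod_right_ae] with x hx
  simp only [he] at hx ⊢
  exact h x hx

end LineIntegrals

/-! ### The growth condition for polynomial densities -/

section Converse

variable {n : ℕ} {a : Fin n → ℝ} {c : ℝ}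

/-- The sum is at least `1` because `a k > 0` for some `k`, so it bounds monomials of degree less than
`2` as well. -/
lemma abs_eval_le_of_mem_quadraticPolynomials {p : MvPolynomial (Fin n) ℝ}
    (hp : p ∈ quadraticPolynomials a) {k : Fin n} (hk : 0 < a k) :
    ∃ C : ℝ, 0 ≤ C ∧ ∀ x : Fin n → ℝ,
      |MvPolynomial.eval x p| ≤ C * ∑ l with 0 < a l, (1 + x l ^ 2) := by
  obtain ⟨hd, hv⟩ := mem_quadraticPolynomials.1 hp
  refine ⟨∑ d ∈ p.support, |p.coeff d|, Finset.sum_nonneg fun _ _ => abs_nonneg _, fun x => ?_⟩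
  set r : ℝ := ∑ l with 0 < a l, (1 + x l ^ 2)
  have hle : ∀ l, 0 < a l → 1 + x l ^ 2 ≤ r := fun l hl =>
    Finset.single_le_sum (f := fun l => 1 + x l ^ 2) (fun _ _ => by positivity) (by simp [hl])
  have hr1 : 1 ≤ r := by nlinarith [hle k hk, sq_nonneg (x k)]
  have hx : ∀ l, 0 < a l → |x l| ≤ Real.sqrt r := fun l hl =>
    Real.abs_le_sqrt (by linarith [hle l hl])
  rw [MvPolynomial.eval_eq, Finset.sum_mul]
  refine (Finset.abs_sum_le_sum_abs _ _).trans (Finset.sum_le_sum fun d hdp => ?_)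
  rw [abs_mul]
  refine mul_le_mul_of_nonneg_left ?_ (abs_nonneg _)
  rw [Finset.abs_prod]
  calc ∏ l ∈ d.support, |x l ^ d l| ≤ ∏ l ∈ d.support, Real.sqrt r ^ d l := by
        refine Finset.prod_le_prod (fun _ _ => abs_nonneg _) fun l hl => ?_
        rw [abs_pow]
        exact pow_le_pow_left₀ (abs_nonneg _) (hx l (hv l ((MvPolynomial.mem_vars_iff_mem_support l).2
          ⟨d, hdp, hl⟩))) _
    _ = Real.sqrt r ^ ∑ l ∈ d.support, d l := Finset.prod_pow_eq_pow_sum _ _ _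
    _ ≤ Real.sqrt r ^ 2 := pow_le_pow_right₀ (Real.one_le_sqrt.2 hr1)
        ((MvPolynomial.le_totalDegree hdp).trans hd)
    _ = r := Real.sq_sqrt (by linarith)

lemma eval_add_smul_of_notMem_vars {p : MvPolynomial (Fin n) ℝ} {i : Fin n} (hi : i ∉ p.vars)
    (x : EuclideanSpace ℝ (Fin n)) (s : ℝ) :
    MvPolynomial.eval (fun j => (x + s • EuclideanSpace.single i 1 : EuclideanSpace ℝ (Fin n)) j) p
      = MvPolynomial.eval (fun j => x j) p := by
  refine MvPolynomial.eval₂Hom_congr' rfl (fun j hj _ => ?_) rfl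
  have : j ≠ i := fun h => hi (h ▸ hj)
  simp [this]

variable {M : AffineSubspace ℝ (EuclideanSpace ℝ (Fin n))} {x₀ : EuclideanSpace ℝ (Fin n)}

lemma mem_direction_iff_of_eq_hyperplane
    (hM : (M : Set (EuclideanSpace ℝ (Fin n))) = {x | ∑ l, a l * x l = c}) (hx₀ : x₀ ∈ M)
    (v : EuclideanSpace ℝ (Fin n)) : v ∈ M.direction ↔ ∑ l, a l * v l = 0 := by
  have hmem : ∀ x, x ∈ M ↔ ∑ l, a l * x l = c := fun x => by
    rw [← SetLike.mem_coe, hM]; rfl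
  rw [← AffineSubspace.vadd_mem_iff_mem_direction v hx₀, hmem]
  have := (hmem x₀).1 hx₀
  simp only [vadd_eq_add, PiLp.add_apply, mul_add, Finset.sum_add_distrib, this, add_eq_right]

/-- On a hyperplane that is a graph over the coordinates other than `l`, one factor of the growth
weight can be spared. -/
lemma integrable_prod_inv_one_add_sq_hyperplane
    (hM : (M : Set (EuclideanSpace ℝ (Fin n))) = {x | ∑ l, a l * x l = c}) (hx₀ : x₀ ∈ M)
    {l : Fin n} (hl : a l ≠ 0) :
    Integrable fun v : M.direction =>
      ∏ j : {j // j ≠ l}, (1 + (x₀ + v : EuclideanSpace ℝ (Fin n)) j ^ 2)⁻¹ := by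
  have hdir := mem_direction_iff_of_eq_hyperplane hM hx₀
  let T : M.direction →ₗ[ℝ] ({j // j ≠ l} → ℝ) :=
    { toFun := fun v j => (v : EuclideanSpace ℝ (Fin n)) j
      map_add' := fun _ _ => rfl
      map_smul' := fun _ _ => rfl }
  have hT : Function.Bijective T := by
    constructor
    · rw [← LinearMap.ker_eq_bot, LinearMap.ker_eq_bot']
      intro v hv
      have h1 : ∀ j, j ≠ l → (v : EuclideanSpace ℝ (Fin n)) j = 0 := fun j hj =>
        congrFun hv ⟨j, hj⟩
      have h2 := (hdir v).1 v.2
      rw [Finset.sum_eq_single l (fun j _ hj => by rw [h1 j hj, mul_zero]) (by simp)] at h2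
      ext j
      rcases eq_or_ne j l with rfl | hj
      · exact (mul_eq_zero.1 h2).resolve_left hl
      · exact h1 j hj
    · intro w
      let v : EuclideanSpace ℝ (Fin n) := WithLp.toLp 2 fun j =>
        if hj : j ≠ l then w ⟨j, hj⟩ else -(∑ j : {j // j ≠ l}, a j * w j) / a l
      have hv : ∀ j : {j // j ≠ l}, v j = w j := fun j => by simp [v, j.2]
      refine ⟨⟨v, (hdir v).2 ?_⟩, funext hv⟩
      · rw [Fintype.sum_eq_add_sum_subtype_ne _ l]
        simp only [hv]
        simp only [v, ne_eq, not_true_eq_false, dite_false]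
        field_simp
        ring
  let e : M.direction ≃L[ℝ] ({j // j ≠ l} → ℝ) := (LinearEquiv.ofBijective T hT).toContinuousLinearEquiv
  have he : ∀ v j, e v j = (v : EuclideanSpace ℝ (Fin n)) j := fun _ _ => rfl
  have hmap : (Measure.map e (volume : Measure M.direction)).IsAddHaarMeasure :=
    e.isAddHaarMeasure_map _
  have hν := Measure.isAddLeftInvariant_eq_smul (Measure.map e (volume : Measure M.direction)) volume
  have h1 : Integrable fun r : {j // j ≠ l} → ℝ => ∏ j : {j // j ≠ l}, (1 + (x₀ j + r j) ^ 2)⁻¹ :=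
    (integrable_prod_inv_one_add_sq (ι := {j // j ≠ l})).comp_add_left (fun j => x₀ j)
  have h2 : Integrable (fun r : {j // j ≠ l} → ℝ => ∏ j : {j // j ≠ l}, (1 + (x₀ j + r j) ^ 2)⁻¹)
      (Measure.map e (volume : Measure M.direction)) := by
    rw [hν]
    exact h1.smul_measure_nnreal
  exact (e.toHomeomorph.measurableEmbedding.integrable_map_iff
    (μ := (volume : Measure M.direction))).1 h2

lemma integrable_eval_mul_growthWeight
    (hM : (M : Set (EuclideanSpace ℝ (Fin n))) = {x | ∑ l, a l * x l = c}) (hx₀ : x₀ ∈ M)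
    {p : MvPolynomial (Fin n) ℝ} (hp : p ∈ quadraticPolynomials a) {k : Fin n} (hk : 0 < a k) :
    Integrable fun v : M.direction =>
      MvPolynomial.eval (fun j => (x₀ + v : EuclideanSpace ℝ (Fin n)) j) p *
        growthWeight (x₀ + v : EuclideanSpace ℝ (Fin n)) := by
  obtain ⟨C, hC, hle⟩ := abs_eval_le_of_mem_quadraticPolynomials hp hk
  have hh : Continuous fun v : M.direction => x₀ + (v : EuclideanSpace ℝ (Fin n)) := by fun_prop
  have hi : Integrable fun v : M.direction => C * ∑ l with 0 < a l,
      ∏ j : {j // j ≠ l}, (1 + (x₀ + v : EuclideanSpace ℝ (Fin n)) j ^ 2)⁻¹ :=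
    (integrable_finsetSum _ fun l hl =>
      integrable_prod_inv_one_add_sq_hyperplane hM hx₀ (Finset.mem_filter.1 hl).2.ne').const_mul C
  refine hi.mono' (((continuous_eval_euclidean p).comp hh).mul
    (continuous_growthWeight.comp hh)).aestronglyMeasurable (Eventually.of_forall fun v => ?_)
  set x : EuclideanSpace ℝ (Fin n) := x₀ + v
  rw [norm_mul, Real.norm_eq_abs, Real.norm_of_nonneg (growthWeight_nonneg _)]
  refine (mul_le_mul_of_nonneg_right (hle _) (growthWeight_nonneg _)).trans_eq ?_
  rw [mul_assoc, Finset.sum_mul]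
  congr 1
  refine Finset.sum_congr rfl fun l _ => ?_
  rw [growthWeight, Fintype.prod_eq_mul_prod_subtype_ne _ l, ← mul_assoc,
    mul_inv_cancel₀ (by positivity), one_mul]

end Converse

/-! ### The Nevanlinna condition for polynomial densities -/

section Kernel

variable {n : ℕ}

/-- The integrand of the Nevanlinna condition. -/
noncomputable def nevanlinnaKernel (z : Fin n → ℂ) (i j : Fin n) (t : EuclideanSpace ℝ (Fin n)) : ℂ :=
  1 / (((t i : ℂ) - z i) ^ 2 * ((t j : ℂ) - starRingEnd ℂ (z j)) ^ 2) *
    ∏ l ∈ ({i, j} : Finset (Fin n))ᶜ,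
      (1 / ((t l : ℂ) - z l) - 1 / ((t l : ℂ) - starRingEnd ℂ (z l)))

lemma exists_norm_inv_ofReal_sub_sq_le {z : ℂ} (hz : z.im ≠ 0) :
    ∃ C : ℝ, 0 ≤ C ∧ ∀ t : ℝ, ‖(t : ℂ) - z‖⁻¹ ^ 2 ≤ C * (1 + t ^ 2)⁻¹ := by
  refine ⟨2 + (1 + 2 * z.re ^ 2) / z.im ^ 2, by positivity, fun t => ?_⟩
  have h1 : ‖(t : ℂ) - z‖ ^ 2 = (t - z.re) ^ 2 + z.im ^ 2 := by
    rw [Complex.sq_norm, Complex.normSq_apply]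
    simp only [Complex.sub_re, Complex.ofReal_re, Complex.sub_im, Complex.ofReal_im]
    ring
  have h2 : 0 < z.im ^ 2 := by positivity
  rw [inv_pow, h1, ← div_eq_mul_inv, le_div_iff₀ (by positivity), inv_mul_le_iff₀ (by positivity)]
  have h3 : (1 + 2 * z.re ^ 2) ≤ (1 + 2 * z.re ^ 2) / z.im ^ 2 * ((t - z.re) ^ 2 + z.im ^ 2) := by
    rw [div_mul_eq_mul_div, le_div_iff₀ h2]
    exact mul_le_mul_of_nonneg_left (by nlinarith [sq_nonneg (t - z.re)]) (by positivity)
  nlinarith [sq_nonneg (t - 2 * z.re)]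

variable {z : Fin n → ℂ} {i j : Fin n}

lemma continuous_nevanlinnaKernel (hz : ∀ l, 0 < (z l).im) :
    Continuous (nevanlinnaKernel z i j) := by
  have h1 : ∀ l (t : EuclideanSpace ℝ (Fin n)), (t l : ℂ) - z l ≠ 0 := fun l t =>
    ofReal_sub_ne_zero_of_im (hz l).ne' _
  have h2 : ∀ l (t : EuclideanSpace ℝ (Fin n)), (t l : ℂ) - starRingEnd ℂ (z l) ≠ 0 := fun l t =>
    ofReal_sub_ne_zero_of_im (by simpa using (hz l).ne') _
  refine Continuous.mul (Continuous.div continuous_const (by fun_prop) fun t =>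
    mul_ne_zero (pow_ne_zero _ (h1 i t)) (pow_ne_zero _ (h2 j t))) (continuous_finsetProd _ fun l _ => ?_)
  exact (continuous_const.div (by fun_prop) (h1 l)).sub (continuous_const.div (by fun_prop) (h2 l))

/-- In particular, the integrand of the Nevanlinna condition is integrable whenever the growth condition
holds. -/
lemma exists_norm_nevanlinnaKernel_le (hz : ∀ l, 0 < (z l).im) (hij : i ≠ j) :
    ∃ C : ℝ, ∀ t, ‖nevanlinnaKernel z i j t‖ ≤ C * growthWeight t := by
  choose C hC hle using fun l => exists_norm_inv_ofReal_sub_sq_le (hz l).ne'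
  have hconj : ∀ l (s : ℝ), ‖(s : ℂ) - starRingEnd ℂ (z l)‖ = ‖(s : ℂ) - z l‖ := fun l s => by
    rw [← Complex.norm_conj, map_sub, Complex.conj_conj, Complex.conj_ofReal]
  refine ⟨C i * C j * ∏ l ∈ ({i, j} : Finset (Fin n))ᶜ, (‖z l - starRingEnd ℂ (z l)‖ * C l),
    fun t => ?_⟩
  have h0 : ∀ l, 0 ≤ C l * (1 + t l ^ 2)⁻¹ := fun l => mul_nonneg (hC l) (by positivity)
  have h1 : ‖1 / (((t i : ℂ) - z i) ^ 2 * ((t j : ℂ) - starRingEnd ℂ (z j)) ^ 2)‖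
      ≤ C i * (1 + t i ^ 2)⁻¹ * (C j * (1 + t j ^ 2)⁻¹) := by
    rw [one_div, norm_inv, norm_mul, norm_pow, norm_pow, hconj, mul_inv, ← inv_pow, ← inv_pow]
    exact mul_le_mul (hle i _) (hle j _) (by positivity) (h0 i)
  have h2 : ‖∏ l ∈ ({i, j} : Finset (Fin n))ᶜ,
      (1 / ((t l : ℂ) - z l) - 1 / ((t l : ℂ) - starRingEnd ℂ (z l)))‖
      ≤ ∏ l ∈ ({i, j} : Finset (Fin n))ᶜ,
        (‖z l - starRingEnd ℂ (z l)‖ * (C l * (1 + t l ^ 2)⁻¹)) := by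
    rw [norm_prod]
    refine Finset.prod_le_prod (fun _ _ => norm_nonneg _) fun l _ => ?_
    rw [div_sub_div _ _ (ofReal_sub_ne_zero_of_im (hz l).ne' _)
      (ofReal_sub_ne_zero_of_im (by simpa using (hz l).ne') _), norm_div, norm_mul, hconj,
      div_eq_mul_inv, ← sq, ← inv_pow]
    have : (1 * ((t l : ℂ) - starRingEnd ℂ (z l)) - ((t l : ℂ) - z l) * 1)
        = z l - starRingEnd ℂ (z l) := by ring
    rw [this]
    exact mul_le_mul_of_nonneg_left (hle l _) (norm_nonneg _)
  rw [nevanlinnaKernel, norm_mul]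
  refine (mul_le_mul h1 h2 (norm_nonneg _) (mul_nonneg (h0 i) (h0 j))).trans_eq ?_
  rw [growthWeight, ← Finset.prod_mul_prod_compl {i, j}, Finset.prod_pair hij]
  simp_rw [← mul_assoc]
  rw [Finset.prod_mul_distrib]
  ring

lemma nevanlinnaKernel_add_smul {u : EuclideanSpace ℝ (Fin n)} (hu : ∀ l, l ≠ i → l ≠ j → u l = 0)
    (x : EuclideanSpace ℝ (Fin n)) (s : ℝ) :
    nevanlinnaKernel z i j (x + s • u)
      = 1 / (((x i : ℂ) + s * u i - z i) ^ 2 * ((x j : ℂ) + s * u j - starRingEnd ℂ (z j)) ^ 2) *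
        ∏ l ∈ ({i, j} : Finset (Fin n))ᶜ,
          (1 / ((x l : ℂ) - z l) - 1 / ((x l : ℂ) - starRingEnd ℂ (z l))) := by
  rw [nevanlinnaKernel]
  congr 1
  · simp
  · refine Finset.prod_congr rfl fun l hl => ?_
    have : u l = 0 := by
      simp only [Finset.mem_compl, Finset.mem_insert, Finset.mem_singleton, not_or] at hl
      exact hu l hl.1 hl.2
    simp [this]

end Kernel

section Converse

variable {n : ℕ} {a : Fin n → ℝ} {c : ℝ}
  {M : AffineSubspace ℝ (EuclideanSpace ℝ (Fin n))} {x₀ : EuclideanSpace ℝ (Fin n)}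

/-- Along each pair of coordinates the hyperplane contains a direction in which only these two
coordinates vary, and the integrand of the Nevanlinna condition times a quadratic polynomial
integrates to zero along the lines in this direction. -/
lemma integral_eval_mul_nevanlinnaKernel_eq_zero (ha : ∀ l, 0 ≤ a l)
    (hM : (M : Set (EuclideanSpace ℝ (Fin n))) = {x | ∑ l, a l * x l = c}) (hx₀ : x₀ ∈ M)
    {p : MvPolynomial (Fin n) ℝ} (hp : p ∈ quadraticPolynomials a) {k : Fin n} (hk : 0 < a k)
    {z : Fin n → ℂ} (hz : ∀ l, 0 < (z l).im) {i j : Fin n} (hij : i ≠ j) :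
    ∫ v : M.direction,
      (MvPolynomial.eval (fun l => (x₀ + v : EuclideanSpace ℝ (Fin n)) l) p : ℂ) *
        nevanlinnaKernel z i j (x₀ + v) = 0 := by
  have hdir := mem_direction_iff_of_eq_hyperplane hM hx₀
  obtain ⟨hpd, hpv⟩ := mem_quadraticPolynomials.1 hp
  set Φ : EuclideanSpace ℝ (Fin n) → ℂ := fun x =>
    (MvPolynomial.eval (fun l => x l) p : ℂ) * nevanlinnaKernel z i j x
  have hh : Continuous fun v : M.direction => x₀ + (v : EuclideanSpace ℝ (Fin n)) := by fun_prop
  have hi : Integrable fun v : M.direction => Φ (x₀ + v) := by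
    obtain ⟨C, hC⟩ := exists_norm_nevanlinnaKernel_le hz hij
    refine ((integrable_eval_mul_growthWeight hM hx₀ hp hk).norm.const_mul C).mono'
      (((Complex.continuous_ofReal.comp (continuous_eval_euclidean p)).mul
        (continuous_nevanlinnaKernel hz)).comp hh).aestronglyMeasurable
      (Eventually.of_forall fun v => ?_)
    rw [norm_mul, norm_mul, Complex.norm_real, Real.norm_of_nonneg (growthWeight_nonneg _),
      mul_left_comm]
    exact mul_le_mul_of_nonneg_left (hC _) (norm_nonneg _)
  -- it suffices to find a direction in which all line integrals vanish
  suffices ∃ u : EuclideanSpace ℝ (Fin n), u ≠ 0 ∧ ∑ l, a l * u l = 0 ∧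
      ∀ x, Integrable (fun s : ℝ => Φ (x + s • u)) → ∫ s : ℝ, Φ (x + s • u) = 0 by
    obtain ⟨u, hu0, hu, h⟩ := this
    refine integral_eq_zero_of_integral_line_eq_zero volume hi
      (u := (⟨u, (hdir u).2 hu⟩ : M.direction)) (by simpa [Subtype.ext_iff] using hu0) fun v => ?_
    have := h (x₀ + v)
    simp only [add_assoc] at this
    exact this
  have hconst : ∀ o : Fin n, a o = 0 → ∀ (x : EuclideanSpace ℝ (Fin n)) (s : ℝ),
      MvPolynomial.eval (fun l => (x + s • EuclideanSpace.single o 1 :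
        EuclideanSpace ℝ (Fin n)) l) p = MvPolynomial.eval (fun l => x l) p := fun o ho x s =>
    eval_add_smul_of_notMem_vars (fun h => (hpv o h).ne' ho) x s
  have hsingle : ∀ o : Fin n, (EuclideanSpace.single o 1 : EuclideanSpace ℝ (Fin n)) ≠ 0 := by
    intro o h
    simpa using congrArg (fun x : EuclideanSpace ℝ (Fin n) => x o) h
  rcases (ha i).eq_or_lt with hi0 | hi0
  · -- `p` does not depend on `x i`
    refine ⟨EuclideanSpace.single i 1, hsingle i, by simp [← hi0], fun x hx => ?_⟩
    set k : ℂ := (MvPolynomial.eval (fun l => x l) p : ℂ) *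
      ((((x j : ℂ) - starRingEnd ℂ (z j)) ^ 2)⁻¹ * ∏ l ∈ ({i, j} : Finset (Fin n))ᶜ,
        (1 / ((x l : ℂ) - z l) - 1 / ((x l : ℂ) - starRingEnd ℂ (z l)))) with hk
    have e : (fun s : ℝ => Φ (x + s • EuclideanSpace.single i 1))
        = fun s : ℝ => k * (((s : ℂ) - (z i - x i)) ^ 2)⁻¹ := by
      funext s
      simp only [Φ]
      rw [hconst i hi0.symm, nevanlinnaKernel_add_smul (fun l hl _ => by simp [hl])]
      simp only [PiLp.single_apply, if_true, if_neg hij.symm, Complex.ofReal_one,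
        Complex.ofReal_zero, mul_one, mul_zero, add_zero, one_div, mul_inv, hk]
      rw [show (x i : ℂ) + s - z i = s - (z i - x i) by ring]
      ring
    rw [e] at hx ⊢
    exact integral_mul_inv_ofReal_sub_sq (by simpa using (hz i).ne') k hx
  rcases (ha j).eq_or_lt with hj0 | hj0
  · -- `p` does not depend on `x j`
    refine ⟨EuclideanSpace.single j 1, hsingle j, by simp [← hj0], fun x hx => ?_⟩
    set k : ℂ := (MvPolynomial.eval (fun l => x l) p : ℂ) *
      ((((x i : ℂ) - z i) ^ 2)⁻¹ * ∏ l ∈ ({i, j} : Finset (Fin n))ᶜ,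
        (1 / ((x l : ℂ) - z l) - 1 / ((x l : ℂ) - starRingEnd ℂ (z l)))) with hk
    have e : (fun s : ℝ => Φ (x + s • EuclideanSpace.single j 1))
        = fun s : ℝ => k * (((s : ℂ) - (starRingEnd ℂ (z j) - x j)) ^ 2)⁻¹ := by
      funext s
      simp only [Φ]
      rw [hconst j hj0.symm, nevanlinnaKernel_add_smul (fun l _ hl => by simp [hl])]
      simp only [PiLp.single_apply, if_true, if_neg hij, Complex.ofReal_one,
        Complex.ofReal_zero, mul_one, mul_zero, add_zero, one_div, mul_inv, hk]
      rw [show (x j : ℂ) + s - starRingEnd ℂ (z j) = s - (starRingEnd ℂ (z j) - x j) by ring]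
      ring
    rw [e] at hx ⊢
    exact integral_mul_inv_ofReal_sub_sq (by simpa using (hz j).ne') k hx
  · -- along this direction the poles in both variables lie in the upper half plane
    set r : ℝ := a i / a j with hr
    have hr0 : 0 < r := div_pos hi0 hj0
    have hrc : (r : ℂ) ≠ 0 := Complex.ofReal_ne_zero.2 hr0.ne'
    have hui : hyperplaneDir a j i i = 1 := by simp [hyperplaneDir_apply, hij]
    have huj : hyperplaneDir a j i j = -r := by simp [hyperplaneDir_apply, hij.symm, hr]
    have hul : ∀ l, l ≠ i → l ≠ j → hyperplaneDir a j i l = 0 := fun l h1 h2 => by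
      simp [hyperplaneDir_apply, h1, h2]
    refine ⟨hyperplaneDir a j i, fun h => ?_, ?_, fun x hx => ?_⟩
    · rw [h] at hui
      simp at hui
    · rw [← Finset.sum_subset (Finset.subset_univ {i, j}) fun l _ hl => ?_, Finset.sum_pair hij,
        hui, huj, hr]
      · field_simp
        ring
      · simp only [Finset.mem_insert, Finset.mem_singleton, not_or] at hl
        rw [hul l hl.1 hl.2, mul_zero]
    obtain ⟨A, B, C, hABC⟩ := MvPolynomial.exists_eval_line hpd x (hyperplaneDir a j i)
    set κ : ℂ := ((r : ℂ) ^ 2)⁻¹ * ∏ l ∈ ({i, j} : Finset (Fin n))ᶜ,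
        (1 / ((x l : ℂ) - z l) - 1 / ((x l : ℂ) - starRingEnd ℂ (z l))) with hκ
    have e : (fun s : ℝ => Φ (x + s • hyperplaneDir a j i))
        = fun s : ℝ => (κ * A + κ * B * s + κ * C * s ^ 2) * ((((s : ℂ) - (z i - x i)) ^ 2)⁻¹ *
          (((s : ℂ) - (x j - starRingEnd ℂ (z j)) / r) ^ 2)⁻¹) := by
      funext s
      simp only [Φ]
      rw [nevanlinnaKernel_add_smul hul, hui, huj]
      have h1 : MvPolynomial.eval (fun l => (x + s • hyperplaneDir a j i) l) p
          = A + B * s + C * s ^ 2 := by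
        rw [← hABC s]
        simp
      rw [h1, show (x i : ℂ) + s * ((1 : ℝ) : ℂ) - z i = s - (z i - x i) by push_cast; ring,
        show (x j : ℂ) + s * ((-r : ℝ) : ℂ) - starRingEnd ℂ (z j)
          = -r * (s - (x j - starRingEnd ℂ (z j)) / r) by push_cast; field_simp; ring,
        mul_pow, neg_sq, one_div, mul_inv, mul_inv, hκ]
      push_cast
      ring
    rw [e] at hx ⊢
    refine integral_quadratic_div (by simpa using hz i) ?_ _ _ _ hx
    rw [Complex.div_ofReal_im]
    exact div_pos (by simpa using hz j) hr0

lemma isNevanlinnaMeasure_withDensity (ha : ∀ l, 0 ≤ a l)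
    (hM : (M : Set (EuclideanSpace ℝ (Fin n))) = {x | ∑ l, a l * x l = c})
    {k : Fin n} (hk : 0 < a k) {p : MvPolynomial (Fin n) ℝ} (hp : p ∈ quadraticPolynomials a)
    (hpos : ∀ x ∈ M, 0 ≤ MvPolynomial.eval (fun j => x j) p) :
    IsNevanlinnaMeasure (((μHE[Module.finrank ℝ M.direction]).restrict
      (M : Set (EuclideanSpace ℝ (Fin n)))).withDensity
        fun x => ENNReal.ofReal (MvPolynomial.eval (fun j => x j) p)) := by
  obtain ⟨x₀, hx₀⟩ : ∃ x₀, x₀ ∈ M := by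
    refine ⟨(c / a k) • EuclideanSpace.single k 1, ?_⟩
    rw [← SetLike.mem_coe, hM]
    simp
    field_simp
  have hVM : ∀ v : M.direction, x₀ + v ∈ M := fun v => by
    have := AffineSubspace.vadd_mem_of_mem_direction v.2 hx₀
    simpa [add_comm] using this
  have hh : Continuous fun v : M.direction => x₀ + (v : EuclideanSpace ℝ (Fin n)) := by fun_prop
  have hpc := continuous_eval_euclidean p
  have hpm := hpc.measurable.ennreal_ofReal
  have hlt : ∀ᵐ x ∂(Measure.map (fun v : M.direction => x₀ + (v : EuclideanSpace ℝ (Fin n))) volume),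
      ENNReal.ofReal (MvPolynomial.eval (fun j => x j) p) < ⊤ :=
    Eventually.of_forall fun _ => ENNReal.ofReal_lt_top
  have hdc : Continuous fun x : EuclideanSpace ℝ (Fin n) =>
      (ENNReal.ofReal (MvPolynomial.eval (fun j => x j) p)).toReal := by
    simp only [ENNReal.toReal_ofReal']
    exact hpc.max continuous_const
  rw [AffineSubspace.euclideanHausdorffMeasure_restrict M hx₀]
  refine ⟨?_, fun z hz i j hij => ?_⟩
  · have hc : Continuous fun x : EuclideanSpace ℝ (Fin n) =>
        (ENNReal.ofReal (MvPolynomial.eval (fun j => x j) p)).toReal • growthWeight x :=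
      hdc.smul continuous_growthWeight
    rw [← integrable_growthWeight_iff, integrable_withDensity_iff_integrable_smul' hpm hlt,
      integrable_map_measure hc.aestronglyMeasurable hh.measurable.aemeasurable]
    refine (integrable_eval_mul_growthWeight hM hx₀ hp hk).congr (Eventually.of_forall fun v => ?_)
    simp only [Function.comp, smul_eq_mul]
    rw [ENNReal.toReal_ofReal (hpos _ (hVM v))]
  · have hc : Continuous fun x : EuclideanSpace ℝ (Fin n) =>
        (ENNReal.ofReal (MvPolynomial.eval (fun j => x j) p)).toReal • nevanlinnaKernel z i j x :=
      hdc.smul (continuous_nevanlinnaKernel hz)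
    change ∫ t, nevanlinnaKernel z i j t ∂_ = 0
    rw [integral_withDensity_eq_integral_toReal_smul hpm hlt,
      integral_map hh.measurable.aemeasurable hc.aestronglyMeasurable,
      ← integral_eval_mul_nevanlinnaKernel_eq_zero ha hM hx₀ hp hk hz hij.ne]
    refine integral_congr_ae (Eventually.of_forall fun v => ?_)
    simp only
    rw [ENNReal.toReal_ofReal (hpos _ (hVM v)), Complex.real_smul]

end Converse

/-! ### Planes that support Nevanlinna measures -/

section Support

variable {n : ℕ} {M : AffineSubspace ℝ (EuclideanSpace ℝ (Fin n))}

lemma sum_mul_eq_of_mem_orthogonal {w : EuclideanSpace ℝ (Fin n)} (hw : w ∈ M.directionᗮ)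
    {x y : EuclideanSpace ℝ (Fin n)} (hx : x ∈ M) (hy : y ∈ M) :
    ∑ l, w l * x l = ∑ l, w l * y l := by
  have h := (Submodule.mem_orthogonal' _ _).1 hw _ (AffineSubspace.vsub_mem_direction hx hy)
  simp only [PiLp.inner_apply, RCLike.inner_apply, conj_trivial, vsub_eq_sub, PiLp.sub_apply,
    sub_mul, Finset.sum_sub_distrib] at h
  rw [sub_eq_zero] at h
  simpa only [mul_comm] using h

/-- If no vector of the orthogonal complement of the direction has both positive and negative
coordinates, the orthogonal complement is at most a line: otherwise it would contain two independent
vectors, one of which vanishes in a coordinate in which the other does not, and some linear combination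
of these has mixed signs. -/
lemma exists_smul_eq_of_no_mixed_sign {N : Submodule ℝ (EuclideanSpace ℝ (Fin n))}
    (hN : ∀ w ∈ N, ∀ i j, 0 < w i → 0 ≤ w j) {w : EuclideanSpace ℝ (Fin n)} (hw : w ∈ N) {i : Fin n}
    (hi : 0 < w i) {u : EuclideanSpace ℝ (Fin n)} (hu : u ∈ N) : ∃ r : ℝ, r • w = u := by
  refine ⟨u i / w i, ?_⟩
  by_contra hne
  set u' : EuclideanSpace ℝ (Fin n) := u - (u i / w i) • w with hu'
  have hu'N : u' ∈ N := N.sub_mem hu (N.smul_mem _ hw)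
  have hu'i : u' i = 0 := by
    simp only [hu', PiLp.sub_apply, PiLp.smul_apply, smul_eq_mul]
    field_simp
    ring
  obtain ⟨j, hj⟩ : ∃ j, u' j ≠ 0 := by
    by_contra! h
    exact hne (sub_eq_zero.1 (show u - (u i / w i) • w = 0 by ext j; exact h j)).symm
  have h := hN (w - ((w j + 1) / u' j) • u') (N.sub_mem hw (N.smul_mem _ hu'N)) i j
    (by simpa [hu'i] using hi)
  simp only [PiLp.sub_apply, PiLp.smul_apply, smul_eq_mul, div_mul_cancel₀ _ hj] at h
  linarith

/-- A plane that supports a nontrivial Nevanlinna measure and is not parallel to a coordinate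
hyperplane is a hyperplane with a normal vector that is nonnegative. -/
lemma IsNevanlinnaMeasureOn.isNonnegHyperplane {μ : Measure (EuclideanSpace ℝ (Fin n))}
    (hμ : IsNevanlinnaMeasureOn M μ) (hμ0 : μ ≠ 0) (hdim : Module.finrank ℝ M.direction < n)
    (hM : ¬ ParallelToCoordinateHyperplane M) :
    Module.finrank ℝ M.direction = n - 1 ∧ ∃ (a : Fin n → ℝ) (c : ℝ), IsNonnegHyperplane M a c := by
  have hae : ∀ᵐ t ∂μ, t ∈ M := by rw [ae_iff]; exact hμ.2
  obtain ⟨x₀, hx₀⟩ : ∃ x₀, x₀ ∈ M := by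
    by_contra! h
    refine hμ0 (Measure.measure_univ_eq_zero.1 ?_)
    rw [← hμ.2]
    congr 1
    ext x
    simp [h x]
  set N := M.directionᗮ with hN
  have hmixed : ∀ w ∈ N, ∀ i j, 0 < w i → 0 ≤ w j := by
    intro w hw i j hi
    by_contra! hj
    exact hμ0 (hμ.1.eq_zero_of_mixed_sign (a := w) (c := ∑ l, w l * x₀ l)
      (hae.mono fun t ht => sum_mul_eq_of_mem_orthogonal hw ht hx₀) hi hj)
  have hsum : Module.finrank ℝ M.direction + Module.finrank ℝ N = n := by
    rw [hN, Submodule.finrank_add_finrank_orthogonal, finrank_euclideanSpace_fin]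
  obtain ⟨w, hwN, i, hi⟩ : ∃ w ∈ N, ∃ i, 0 < w i := by
    have hbot : N ≠ ⊥ := fun h => by
      rw [h, finrank_bot] at hsum
      omega
    obtain ⟨w, hw, hw0⟩ := N.exists_mem_ne_zero_of_ne_bot hbot
    obtain ⟨i, hi⟩ : ∃ i, w i ≠ 0 := by
      by_contra! h
      exact hw0 (by ext j; exact h j)
    rcases hi.lt_or_gt with hi | hi
    · exact ⟨-w, N.neg_mem hw, i, by simpa using hi⟩
    · exact ⟨w, hw, i, hi⟩
  have hspan := fun u (hu : u ∈ N) => exists_smul_eq_of_no_mixed_sign hmixed hwN hi hu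
  have hN1 : Module.finrank ℝ N ≤ 1 := finrank_le_one (⟨w, hwN⟩ : N) fun u => by
    obtain ⟨r, hr⟩ := hspan u u.2
    exact ⟨r, Subtype.ext hr⟩
  have hMw : (M : Set (EuclideanSpace ℝ (Fin n))) = {x | ∑ k, w k * x k = ∑ k, w k * x₀ k} := by
    ext x
    refine ⟨fun hx => sum_mul_eq_of_mem_orthogonal hwN hx hx₀, fun hx => ?_⟩
    have hdir : x - x₀ ∈ M.direction := by
      rw [← Submodule.orthogonal_orthogonal M.direction, Submodule.mem_orthogonal]
      intro u hu
      obtain ⟨r, rfl⟩ := hspan u hu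
      rw [inner_smul_left]
      simp only [PiLp.inner_apply, RCLike.inner_apply, conj_trivial, PiLp.sub_apply, sub_mul,
        Finset.sum_sub_distrib]
      have hx' : ∑ k, w k * x k = ∑ k, w k * x₀ k := hx
      simp only [mul_comm _ (w _), hx', sub_self, mul_zero]
    have := AffineSubspace.vadd_mem_of_mem_direction hdir hx₀
    simpa using this
  refine ⟨by omega, w, _, fun k => hmixed w hwN i k hi, ?_, hMw⟩
  by_contra! h
  have h0 : ∀ k, k ≠ i → w k = 0 := fun k hk =>
    le_antisymm (h i k hk.symm hi) (hmixed w hwN i k hi)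
  refine hM ⟨i, x₀ i, fun x hx => ?_⟩
  have hx' := sum_mul_eq_of_mem_orthogonal hwN hx hx₀
  rw [Finset.sum_eq_single i (fun k _ hk => by rw [h0 k hk, zero_mul]) (by simp),
    Finset.sum_eq_single i (fun k _ hk => by rw [h0 k hk, zero_mul]) (by simp)] at hx'
  exact mul_left_cancel₀ hi.ne' hx'

end Support

theorem theorem3p8 (n m : ℕ) (hmn : m < n)
    (M : AffineSubspace ℝ (EuclideanSpace ℝ (Fin n)))
    (hdim : Module.finrank ℝ M.direction = m)
    (hM : ¬ ParallelToCoordinateHyperplane M) :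
    ((∃ μ : Measure (EuclideanSpace ℝ (Fin n)), IsNevanlinnaMeasureOn M μ ∧ μ ≠ 0) ↔
      m = n - 1 ∧ ∃ (a : Fin n → ℝ) (c : ℝ), IsNonnegHyperplane M a c) ∧
    ∀ (a : Fin n → ℝ) (c : ℝ), IsNonnegHyperplane M a c →
      ∀ μ : Measure (EuclideanSpace ℝ (Fin n)),
        IsNevanlinnaMeasureOn M μ ↔
          ∃ p : MvPolynomial (Fin n) ℝ,
            p.totalDegree ≤ 2 ∧
            (∀ j ∈ p.vars, 0 < a j) ∧
            (∀ x ∈ M, 0 ≤ MvPolynomial.eval (fun j => x j) p) ∧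
            μ = (μHE[m].restrict (M : Set (EuclideanSpace ℝ (Fin n)))).withDensity
              (fun x => ENNReal.ofReal (MvPolynomial.eval (fun j => x j) p)) := by
  subst hdim
  have main : ∀ (a : Fin n → ℝ) (c : ℝ), IsNonnegHyperplane M a c →
      ∀ μ : Measure (EuclideanSpace ℝ (Fin n)), IsNevanlinnaMeasureOn M μ ↔
        ∃ p : MvPolynomial (Fin n) ℝ, p.totalDegree ≤ 2 ∧ (∀ j ∈ p.vars, 0 < a j) ∧
          (∀ x ∈ M, 0 ≤ MvPolynomial.eval (fun j => x j) p) ∧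
          μ = (μHE[Module.finrank ℝ M.direction].restrict
            (M : Set (EuclideanSpace ℝ (Fin n)))).withDensity
              (fun x => ENNReal.ofReal (MvPolynomial.eval (fun j => x j) p)) := by
    rintro a c ⟨ha, ⟨-, k, -, -, hk⟩, hMa⟩ μ
    constructor
    · rintro ⟨hμ, hμM⟩
      obtain ⟨p, hp, hpos, hμp⟩ := hμ.exists_density ha hk hMa hμM
      obtain ⟨hpd, hpv⟩ := mem_quadraticPolynomials.1 hp
      exact ⟨p, hpd, hpv, hpos, hμp⟩
    · rintro ⟨p, hpd, hpv, hpos, rfl⟩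
      refine ⟨isNevanlinnaMeasure_withDensity ha hMa hk (mem_quadraticPolynomials.2 ⟨hpd, hpv⟩) hpos,
        withDensity_absolutelyContinuous _ _ ?_⟩
      have hmeas : MeasurableSet (M : Set (EuclideanSpace ℝ (Fin n))) :=
        M.closed_of_finiteDimensional.measurableSet
      rw [Measure.restrict_apply hmeas.compl, Set.compl_inter_self, measure_empty]
  refine ⟨⟨fun ⟨μ, hμ, hμ0⟩ => hμ.isNonnegHyperplane hμ0 hmn hM, fun ⟨_, a, c, hac⟩ => ?_⟩, main⟩
  refine ⟨_, (main a c hac _).2 ⟨1, by simp, by simp, by simp, rfl⟩, ?_⟩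
  obtain ⟨x₀, hx₀⟩ : (M : Set (EuclideanSpace ℝ (Fin n))).Nonempty := by
    by_contra h
    rw [Set.not_nonempty_iff_eq_empty] at h
    exact hM ⟨⟨0, by omega⟩, 0, fun x hx => (Set.eq_empty_iff_forall_notMem.1 h x hx).elim⟩
  intro h
  rw [AffineSubspace.euclideanHausdorffMeasure_restrict M hx₀] at h
  have h2 := congrArg (fun ν : Measure (EuclideanSpace ℝ (Fin n)) => ν Set.univ) h
  have hh : Continuous fun v : M.direction => x₀ + (v : EuclideanSpace ℝ (Fin n)) := by fun_prop
  simp [Measure.map_apply hh.measurable MeasurableSet.univ] at h2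
  exact isOpen_univ.measure_ne_zero (volume : Measure M.direction) Set.univ_nonempty (by simp [h2])
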